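/- Conventions. A pointed rack is a set $X$ with an operation $\lhd$ and an element $e$ such that $e\lhd g=e$, $g\lhd e=g$, $(x\lhd h)\lhd g=(x\lhd g)\lhd(h\lhd g)$ and every map $-\lhd g$ is bijective. For a commutative ring $\Bbbk$ its rack chain complex $\mathrm{CR}_\bullet(X,\Bbbk)$ is, in degree $n$, the free module $\Bbbk[X^n]$ modulo the span of the tuples having some entry equal to $e$, with differential $\sum_{i=1}^n(-1)^{i+1}(d_{i,1}-d_{i,0})$, where $d_{i,0}$ deletes $x_i$ and $d_{i,1}(x_1,\dots,x_n)=(x_1\lhd x_i,\dots,x_{i-1}\lhd x_i,x_{i+1},\dots,x_n)$; $\mathrm{HR}_n(X,\Bbbk)$ is its homology. A group is a pointed rack with $h\lhd g=g^{-1}hg$ and $e=1$. Let $G$ be an abelian group, written multiplicatively; then every chain of $\mathrm{CR}_\bullet(G,\Bbbk)$ and of $\mathrm{CR}_\bullet(G\times G,\Bbbk)$ is a cycle, and $[g_1,\dots,g_n]$ denotes the class of a tuple. For a group $G$ and $g_1,\dots,g_n\in G$, the map $\mathrm{S}_n$ to the homology $\mathrm{H}_n(G,\Bbbk)$ of the inhomogeneous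 bar complex is given by $\mathrm{S}_n[g_1,\dots,g_n]=\big[\sum_{\sigma\in\mathbb S_n}\epsilon(\sigma)(g_1^\sigma,\dots,g_n^\sigma)\big]$ with $g_i^\sigma=g_{\sigma(i)}\lhd g_{i_1}\lhd\cdots\lhd g_{i_m}$, where $i_1<\dots<i_m$ are the elements of $\{\sigma(1),\dots,\sigma(i-1)\}$ greater than $\sigma(i)$ (so $g_i^\sigma=g_{\sigma(i)}$ if $G$ is abelian). A $(p,q)$-shuffle is a permutation of $\{1,\dots,p+q\}$ that is increasing on $\{1,\dots,p\}$ and on $\{p+1,\dots,p+q\}$. A (graded) connected coZinbiel-associative bialgebra is a graded $\Bbbk$-module $H=\bigoplus_n H_n$ with a unital associative product $\star$, a multiplicative counit $c:H\to\Bbbk$ with $c(1)=1$, and a coproduct $\Delta_\prec:\ker c\to H\otimes H$, all homogeneous of degree $0$, such that, $\tau$ being the flip with Koszul sign: (a) $(c\otimes\mathrm{id})\Delta_\prec=0$ and $(\mathrm{id}\otimes c)\Delta_\prec=\mathrm{id}$; (b) the reduced coproduct $\Delta_\prec^-(x)=\Delta_\prec(x)-x\otimes1$ on $\ker c$ satisfies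 $(\Delta_\prec^-\otimes\mathrm{id})\Delta_\prec^-=(\mathrm{id}\otimes\Delta_\prec^-+\mathrm{id}\otimes\tau\Delta_\prec^-)\Delta_\prec^-$; (c) $\Delta_\prec(x\star y)=\Delta_\prec(x)\star\Delta(y)$ for $x\in\ker c$, $y\in H$, where $\Delta=\Delta_\prec+\tau\Delta_\prec$ on $\ker c$, $\Delta(1)=1\otimes1$, and $(a\otimes b)\star(a'\otimes b')=(-1)^{|b||a'|}(a\star a')\otimes(b\star b')$; (d) $\ker c=\bigcup_{r\ge1}F_r$, where $F_1=\ker\Delta_\prec^-$ and $F_r=\{x\in\ker c : \Delta_\prec^-(x)\in F_{r-1}\otimes F_{r-1}\}$ (image in $H\otimes H$) for $r>1$. Theorem. Let $G$ be an abelian group (written multiplicatively) and $\Bbbk$ a commutative ring. 1. For all $n\in\mathbb N$ there is an isomorphism $\varphi_n:\mathrm{HR}_n(G,\Bbbk)\simeq\mathrm T^n(\Bbbk[G\setminus\{1\}])$ with $\varphi_n[g_1,\dots,g_n]=g_1\otimes\cdots\otimes g_n$ if all $g_i\ne1$. 2. The formula above defines a linear map $\mathrm S_n:\mathrm{HR}_n(G,\Bbbk)\to\mathrm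 H_n(G,\Bbbk)$ for all $n$. If $\Bbbk$ is a field of characteristic $0$, there are isomorphisms $\psi_n:\mathrm H_n(G,\Bbbk)\simeq\Lambda^n(G\otimes\Bbbk)$ such that $\psi_n^{-1}\big((g_1\otimes1)\wedge\cdots\wedge(g_n\otimes1)\big)$ is the class of the iterated Pontryagin product $(g_1)\star\cdots\star(g_n)$ in the bar complex, where $(g_1,\dots,g_p)\star(g_{p+1},\dots,g_{p+q})=\sum_\sigma\epsilon(\sigma)(g_{\sigma^{-1}(1)},\dots,g_{\sigma^{-1}(p+q)})$ over all $(p,q)$-shuffles $\sigma$; and $\psi_n\circ\mathrm S_n\circ\varphi_n^{-1}$ is the canonical projection $\mathrm T^n(\Bbbk[G\setminus\{1\}])\twoheadrightarrow\Lambda^n(G\otimes\Bbbk)$, $g_1\otimes\cdots\otimes g_n\mapsto(g_1\otimes1)\wedge\cdots\wedge(g_n\otimes1)$, which is surjective. 3. $\mathrm{HR}_\bullet(G,\Bbbk)=\bigoplus_n\mathrm{HR}_n(G,\Bbbk)$ is a connected coZinbiel-associative bialgebra whose unit is the class of the empty tuple, whose product is induced by the morphism of racks $\mu:G\times G\to G$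 given by the group law, namely $[g_1,\dots,g_p]\star[h_1,\dots,h_q]=\mathrm{HR}(\mu)[(g_1,1),\dots,(g_p,1),(1,h_1),\dots,(1,h_q)]=[g_1,\dots,g_p,h_1,\dots,h_q]$, and whose coproduct is the one of rack homology: for $n\ge1$, $\Delta_\prec[g_1,\dots,g_n]=\sum_{p+q=n,\,p\ge1}\sum_\sigma\epsilon(\sigma)\,[g_{\sigma(1)},\dots,g_{\sigma(p)}]\otimes[g_{\sigma(p+1)},\dots,g_{\sigma(n)}]$, the inner sum being over the $(p,q)$-shuffles with $\sigma(1)=1$. -/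

import Mathlib

universe u

open CategoryTheory
open scoped TensorProduct DirectSum

noncomputable section

namespace RackHomology

/-! ### Pointed racks -/

/-- A pointed (right) rack structure on `X`; `rhd x g` is `x ◁ g` and `pt` is the neutral element. -/
structure PointedRack (X : Type u) where
  rhd : X → X → X
  pt : X
  pt_rhd : ∀ g, rhd pt g = pt
  rhd_pt : ∀ g, rhd g pt = g
  rhd_rhd : ∀ x h g, rhd (rhd x h) g = rhd (rhd x g) (rhd h g)
  bijective_rhd : ∀ g, Function.Bijective fun x => rhd x g

/-- A morphism of pointed racks. -/
structure PointedRack.Hom {X Y : Type u} (R : PointedRack X) (S : PointedRack Y) where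
  toFun : X → Y
  map_rhd : ∀ x g, toFun (R.rhd x g) = S.rhd (toFun x) (toFun g)
  map_pt : toFun R.pt = S.pt

/-- The conjugation rack of a group: `h ◁ g = g⁻¹ h g`, pointed by the neutral element. -/
def PointedRack.conj (G : Type u) [Group G] : PointedRack G where
  rhd h g := g⁻¹ * h * g
  pt := 1
  pt_rhd g := by simp
  rhd_pt g := by simp
  rhd_rhd x h g := by group
  bijective_rhd g := by
    refine ⟨fun a b h => by simpa using h, fun b => ⟨g * b * g⁻¹, by simp [mul_assoc]⟩⟩

/-- The product of two pointed racks. -/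
def PointedRack.prod {X Y : Type u} (R : PointedRack X) (S : PointedRack Y) :
    PointedRack (X × Y) where
  rhd a b := (R.rhd a.1 b.1, S.rhd a.2 b.2)
  pt := (R.pt, S.pt)
  pt_rhd g := by simp [R.pt_rhd, S.pt_rhd]
  rhd_pt g := by simp [R.rhd_pt, S.rhd_pt]
  rhd_rhd x h g := by
    ext
    · exact R.rhd_rhd _ _ _
    · exact S.rhd_rhd _ _ _
  bijective_rhd g := (R.bijective_rhd g.1).prodMap (S.bijective_rhd g.2)

/-- The operation of the rack is trivial. -/
def PointedRack.IsTrivial {X : Type u} (R : PointedRack X) : Prop := ∀ x g, R.rhd x g = x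

theorem PointedRack.isTrivial_conj (G : Type u) [CommGroup G] :
    (PointedRack.conj G).IsTrivial := fun _ _ => by simp [PointedRack.conj]

theorem PointedRack.IsTrivial.prod {X Y : Type u} {R : PointedRack X} {S : PointedRack Y}
    (hR : R.IsTrivial) (hS : S.IsTrivial) : (R.prod S).IsTrivial :=
  fun _ _ => Prod.ext (hR _ _) (hS _ _)

/-- For an abelian group the multiplication `G × G → G` is a morphism of racks. -/
def mulHom (G : Type u) [CommGroup G] :
    ((PointedRack.conj G).prod (PointedRack.conj G)).Hom (PointedRack.conj G) where
  toFun a := a.1 * a.2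
  map_rhd x g := by simp [PointedRack.prod, PointedRack.conj]
  map_pt := by simp [PointedRack.prod, PointedRack.conj]

/-! ### The rack chain complex and rack homology -/

section Complex

variable {X : Type u}

/-- The faces of the nerve of a rack (a cubical set with `Xⁿ` in degree `n`): both delete `xᵢ`;
for `ε = true` the entries before `xᵢ` are moreover acted upon by `xᵢ`. -/
def face (R : PointedRack X) {n : ℕ} (ε : Bool) (i : Fin (n + 1)) (x : Fin (n + 1) → X) :
    Fin n → X :=
  fun j => if ε = true ∧ j.castSucc < i then R.rhd (x (i.succAbove j)) (x i) else x (i.succAbove j)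

variable (k : Type u) [CommRing k]

/-- The map `d_{i,1} - d_{i,0}` on the free module on `Xⁿ⁺¹`. -/
def faceDiff (R : PointedRack X) (n : ℕ) (i : Fin (n + 1)) :
    ((Fin (n + 1) → X) →₀ k) →ₗ[k] ((Fin n → X) →₀ k) :=
  Finsupp.lmapDomain k k (face R true i) - Finsupp.lmapDomain k k (face R false i)

/-- The differential `∑ᵢ (-1)ⁱ (d_{i,1} - d_{i,0})`, where `i` starts from `0`. -/
def dQ (R : PointedRack X) (n : ℕ) : ((Fin (n + 1) → X) →₀ k) →ₗ[k] ((Fin n → X) →₀ k) :=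
  ∑ i : Fin (n + 1), (-1 : k) ^ (i : ℕ) • faceDiff k R n i

/-- The degenerate chains. The `i`-th degeneracy inserts the neutral element as `i`-th entry, so
its image consists of the tuples whose `i`-th entry is neutral. -/
def degenerate (R : PointedRack X) (n : ℕ) : Submodule k ((Fin n → X) →₀ k) :=
  Submodule.span k {c | ∃ x : Fin n → X, (∃ i, x i = R.pt) ∧ c = Finsupp.single x 1}

theorem face_face (R : PointedRack X) {n : ℕ} (ε ω : Bool) (i j : Fin (n + 1))
    (hij : i ≤ j) (x : Fin (n + 2) → X) :
    face R ω j (face R ε i.castSucc x) = face R ε i (face R ω j.succ x) := by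
  funext l
  have hsa : ∀ {m : ℕ} (a : Fin (m + 1)) (b : Fin m),
      ((a.succAbove b : Fin (m + 1)) : ℕ) = if (b : ℕ) < a then (b : ℕ) else b + 1 := by
    intro m a b
    simp only [Fin.succAbove, Fin.lt_def, Fin.val_castSucc]
    split_ifs <;> simp
  have e1 : i.castSucc.succAbove j = j.succ := by
    ext; rw [hsa]; simp only [Fin.val_castSucc, Fin.val_succ]
    rw [Fin.le_def] at hij; split_ifs <;> omega
  have e2 : j.succ.succAbove i = i.castSucc := by
    ext; rw [hsa]; simp only [Fin.val_castSucc, Fin.val_succ]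
    rw [Fin.le_def] at hij; split_ifs <;> omega
  have e3 : i.castSucc.succAbove (j.succAbove l) = j.succ.succAbove (i.succAbove l) := by
    ext; simp only [hsa, Fin.val_castSucc, Fin.val_succ]
    rw [Fin.le_def] at hij; split_ifs <;> omega
  have v1 := hsa i l
  have v2 := hsa j l
  rw [Fin.le_def] at hij
  simp only [face, e1, e2, e3, Fin.lt_def, Fin.val_castSucc, Fin.val_succ]
  rw [v1, v2]
  have := i.2; have := j.2; have := l.2
  by_cases h1 : (l : ℕ) < i
  · have h2 : (l : ℕ) < j := by omega
    have h3 : (l : ℕ) < j + 1 := by omega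
    have h4 : (i : ℕ) < j + 1 := by omega
    have h6 : ¬ (j : ℕ) < i := by omega
    cases ε <;> cases ω <;> (simp [h1, h2, h3, h4, h6]; try exact R.rhd_rhd _ _ _)
  · by_cases h2 : (l : ℕ) < j
    · have h4 : (i : ℕ) < j + 1 := by omega
      have h6 : ¬ (j : ℕ) < i := by omega
      cases ε <;> cases ω <;> simp [h1, h2, h6]
    · have h7 : ¬ (l : ℕ) + 1 < i := by omega
      cases ε <;> cases ω <;> simp [h1, h2, h7]

theorem faceDiff_faceDiff (R : PointedRack X) (n : ℕ) (i j : Fin (n + 1)) (hij : i ≤ j) :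
    faceDiff k R n j ∘ₗ faceDiff k R (n + 1) i.castSucc =
      faceDiff k R n i ∘ₗ faceDiff k R (n + 1) j.succ := by
  refine Finsupp.lhom_ext fun x a => ?_
  simp only [faceDiff, LinearMap.comp_apply, LinearMap.sub_apply, Finsupp.lmapDomain_apply,
    Finsupp.mapDomain_single, map_sub, face_face R _ _ i j hij]
  abel

theorem dQ_dQ (R : PointedRack X) (n : ℕ) : dQ k R n ∘ₗ dQ k R (n + 1) = 0 := by
  have key : dQ k R n ∘ₗ dQ k R (n + 1) =
      ∑ p : Fin (n + 1) × Fin (n + 2), ((-1 : k) ^ (p.1 : ℕ) * (-1 : k) ^ (p.2 : ℕ)) •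
        (faceDiff k R n p.1 ∘ₗ faceDiff k R (n + 1) p.2) := by
    rw [Fintype.sum_prod_type]
    refine LinearMap.ext fun c => ?_
    simp only [dQ, LinearMap.comp_apply, LinearMap.sum_apply, LinearMap.smul_apply, map_sum,
      map_smul, Finset.smul_sum, smul_smul]
    rw [Finset.sum_comm]
    exact Finset.sum_congr rfl fun _ _ => Finset.sum_congr rfl fun _ _ => by rw [mul_comm]
  rw [key]
  let S : Finset (Fin (n + 1) × Fin (n + 2)) := {p | (p.2 : ℕ) ≤ (p.1 : ℕ)}
  rw [← Finset.sum_add_sum_compl S]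
  refine LinearMap.ext fun c => ?_
  simp only [LinearMap.add_apply, LinearMap.sum_apply, LinearMap.smul_apply,
    LinearMap.comp_apply, LinearMap.zero_apply]
  rw [← eq_neg_iff_add_eq_zero, ← Finset.sum_neg_distrib]
  refine Finset.sum_bij
    (fun p hp => (Fin.castLT p.2 (lt_of_le_of_lt (Finset.mem_filter.mp hp).right p.1.is_lt),
      p.1.succ)) ?_ ?_ ?_ ?_
  · intro p hp
    simp only [S, Finset.compl_filter, Finset.mem_filter, Finset.mem_univ, true_and,
      Fin.val_succ, Fin.val_castLT] at hp ⊢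
    omega
  · rintro ⟨i, j⟩ hp ⟨i', j'⟩ hp' h
    simp only [Prod.mk.injEq, Fin.ext_iff, Fin.val_castLT, Fin.val_succ] at h
    ext
    · simp only; omega
    · simp only; omega
  · rintro ⟨i', j'⟩ hp
    simp only [S, Finset.compl_filter, Finset.mem_filter, Finset.mem_univ, true_and,
      not_le] at hp
    refine ⟨(⟨j' - 1, by omega⟩, i'.castSucc), ?_, ?_⟩
    · simp only [S, Finset.mem_filter, Finset.mem_univ, true_and, Fin.val_castSucc]
      omega
    · ext
      · simp
      · simp only [Fin.succ_mk]; omega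
  · rintro ⟨i, j⟩ hp
    simp only [S, Finset.mem_filter, Finset.mem_univ, true_and] at hp
    have h := faceDiff_faceDiff k R n (Fin.castLT j (lt_of_le_of_lt hp i.is_lt)) i
      (by simpa [Fin.le_def] using hp)
    rw [Fin.castSucc_castLT] at h
    replace h := LinearMap.congr_fun h c
    simp only [LinearMap.comp_apply] at h
    simp only [h, ← neg_smul]
    congr 1
    simp only [Fin.val_castLT, Fin.val_succ, pow_succ]
    ring

theorem face_degenerate (R : PointedRack X) {n : ℕ} (ε : Bool) (i i₀ : Fin (n + 1)) (hi : i ≠ i₀)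
    (x : Fin (n + 1) → X) (hx : x i₀ = R.pt) : ∃ j, face R ε i x j = R.pt := by
  obtain ⟨j, hj⟩ := Fin.exists_succAbove_eq hi.symm
  refine ⟨j, ?_⟩
  simp only [face, hj, hx, R.pt_rhd, ite_self]

theorem face_neutral (R : PointedRack X) {n : ℕ} (i : Fin (n + 1)) (x : Fin (n + 1) → X)
    (hx : x i = R.pt) : face R true i x = face R false i x := by
  funext j
  simp [face, hx, R.rhd_pt]

theorem degenerate_le_comap_dQ (R : PointedRack X) (n : ℕ) :
    degenerate k R (n + 1) ≤ (degenerate k R n).comap (dQ k R n) := by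
  refine Submodule.span_le.2 ?_
  rintro _ ⟨x, ⟨i₀, hx⟩, rfl⟩
  simp only [SetLike.mem_coe, Submodule.mem_comap, dQ, LinearMap.sum_apply, LinearMap.smul_apply]
  refine Submodule.sum_mem _ fun i _ => Submodule.smul_mem _ _ ?_
  simp only [faceDiff, LinearMap.sub_apply, Finsupp.lmapDomain_apply, Finsupp.mapDomain_single]
  by_cases hi : i = i₀
  · subst hi
    simp [face_neutral R i x hx]
  · exact Submodule.sub_mem _
      (Submodule.subset_span ⟨_, face_degenerate R true i i₀ hi x hx, rfl⟩)
      (Submodule.subset_span ⟨_, face_degenerate R false i i₀ hi x hx, rfl⟩)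

/-- The differential on chains modulo degenerate chains. -/
def dC (R : PointedRack X) (n : ℕ) :
    (((Fin (n + 1) → X) →₀ k) ⧸ degenerate k R (n + 1)) →ₗ[k]
      (((Fin n → X) →₀ k) ⧸ degenerate k R n) :=
  Submodule.mapQ _ _ (dQ k R n) (degenerate_le_comap_dQ k R n)

theorem dC_dC (R : PointedRack X) (n : ℕ) : dC k R n ∘ₗ dC k R (n + 1) = 0 := by
  refine Submodule.linearMap_qext _ (LinearMap.ext fun c => ?_)
  have h := LinearMap.congr_fun (dQ_dQ k R n) c
  simp only [LinearMap.comp_apply, LinearMap.zero_apply] at h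
  simp [dC, h]

/-- The rack chain complex of a pointed rack with coefficients in `k`: the normalized chain
complex of its nerve. -/
def CR (R : PointedRack X) : ChainComplex (ModuleCat.{u} k) ℕ :=
  ChainComplex.of (fun n => ModuleCat.of k (((Fin n → X) →₀ k) ⧸ degenerate k R n))
    (fun n => ModuleCat.ofHom (dC k R n))
    (fun n => by rw [← ModuleCat.ofHom_comp, dC_dC]; rfl)

/-- Rack homology. -/
abbrev HR (R : PointedRack X) (n : ℕ) : ModuleCat.{u} k := (CR k R).homology n

/-- The chain given by a tuple. -/
def chain (R : PointedRack X) {n : ℕ} (x : Fin n → X) : (CR k R).X n :=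
  (degenerate k R n).mkQ (Finsupp.single x 1)

/-- A morphism of pointed racks maps chains to chains, degree by degree. -/
def CRmapX {Y : Type u} {R : PointedRack X} {S : PointedRack Y} (f : R.Hom S) (n : ℕ) :
    (((Fin n → X) →₀ k) ⧸ degenerate k R n) →ₗ[k] (((Fin n → Y) →₀ k) ⧸ degenerate k S n) :=
  Submodule.mapQ _ _ (Finsupp.lmapDomain k k fun x i => f.toFun (x i)) <| by
    refine Submodule.span_le.2 ?_
    rintro _ ⟨x, ⟨i, hx⟩, rfl⟩
    simp only [SetLike.mem_coe, Submodule.mem_comap, Finsupp.lmapDomain_apply,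
      Finsupp.mapDomain_single]
    exact Submodule.subset_span ⟨_, ⟨i, by simp [hx, f.map_pt]⟩, rfl⟩

theorem CRmapX_comm {Y : Type u} {R : PointedRack X} {S : PointedRack Y} (f : R.Hom S) (n : ℕ) :
    dC k S n ∘ₗ CRmapX k f (n + 1) = CRmapX k f n ∘ₗ dC k R n := by
  refine Submodule.linearMap_qext _ (Finsupp.lhom_ext fun x a => ?_)
  have hf : ∀ (ε : Bool) (i : Fin (n + 1)),
      face S ε i (fun j => f.toFun (x j)) = fun j => f.toFun (face R ε i x j) := by
    intro ε i
    funext j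
    simp only [face]
    split_ifs <;> simp [f.map_rhd]
  have key : dQ k S n (Finsupp.lmapDomain k k (fun x i => f.toFun (x i)) (Finsupp.single x a)) =
      Finsupp.lmapDomain k k (fun x i => f.toFun (x i)) (dQ k R n (Finsupp.single x a)) := by
    simp only [dQ, faceDiff, LinearMap.sum_apply, LinearMap.smul_apply, LinearMap.sub_apply,
      map_sum, map_smul, map_sub, Finsupp.lmapDomain_apply, Finsupp.mapDomain_single, hf]
  exact congrArg (degenerate k S n).mkQ key

/-- Functoriality of the rack chain complex. -/
def CRmap {Y : Type u} {R : PointedRack X} {S : PointedRack Y} (f : R.Hom S) :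
    CR k R ⟶ CR k S :=
  ChainComplex.ofHom (fun n => ModuleCat.ofHom (CRmapX k f n)) fun n => by
    simp only [CR, ChainComplex.of_d, ← ModuleCat.ofHom_comp, CRmapX_comm]

/-- Functoriality of rack homology. -/
def HRmap {Y : Type u} {R : PointedRack X} {S : PointedRack Y} (f : R.Hom S) (n : ℕ) :
    HR k R n →ₗ[k] HR k S n :=
  (HomologicalComplex.homologyMap (CRmap k f) n).hom

theorem d_eq_zero {R : PointedRack X} (hR : R.IsTrivial) (i j : ℕ) : (CR k R).d i j = 0 := by
  by_cases hij : j + 1 = i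
  · subst hij
    have h0 : faceDiff k R j = 0 := by
      funext i
      have : face R (n := j) true i = face R false i := by
        funext x l
        simp [face, hR _ _]
      rw [faceDiff, this]
      exact LinearMap.ext fun c => by simp
    have h1 : dC k R j = 0 := by
      refine Submodule.linearMap_qext _ (LinearMap.ext fun c => ?_)
      simp [dC, dQ, h0]
    simp only [CR, ChainComplex.of_d, h1]
    rfl
  · exact (CR k R).shape _ _ hij

/-- For a trivial rack every chain is a cycle; this is the homology class of a tuple. -/
def cls {R : PointedRack X} (hR : R.IsTrivial) {n : ℕ} (x : Fin n → X) : HR k R n :=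
  ((CR k R).liftCycles (𝟙 ((CR k R).X n)) _ rfl (by rw [d_eq_zero k hR]; simp) ≫
    (CR k R).homologyπ n).hom (chain k R x)

end Complex

/-- The chain `c` is a cycle, and `h` is its homology class. -/
def Represents {k : Type u} [CommRing k] (K : ChainComplex (ModuleCat.{u} k) ℕ) (n : ℕ)
    (c : K.X n) (h : K.homology n) : Prop :=
  ∃ z : K.cycles n, (K.iCycles n).hom z = c ∧ (K.homologyπ n).hom z = h

/-! ### Shuffles and the explicit formulas -/

/-- `σ` is a `(p, n - p)`-shuffle: increasing on the first `p` indices and on the others. -/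
def IsShuffle {n : ℕ} (p : ℕ) (σ : Equiv.Perm (Fin n)) : Prop :=
  (∀ i j : Fin n, i < j → (j : ℕ) < p → σ i < σ j) ∧
    (∀ i j : Fin n, i < j → p ≤ (i : ℕ) → σ i < σ j)

/-- `σ` is a `(p, n - p)`-shuffle with a nonempty first block, and `σ` fixes the first index. -/
def IsShuffleOne {n : ℕ} (p : ℕ) (σ : Equiv.Perm (Fin n)) : Prop :=
  IsShuffle p σ ∧ 0 < p ∧ ∀ i : Fin n, (i : ℕ) = 0 → σ i = i

/-- The element `xⱼ ◁ x_{i₁} ◁ ⋯ ◁ x_{iₘ}`, where `i₁ < ⋯ < iₘ` are the elements of `s` that are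
greater than `j`. -/
def twist {X : Type u} (R : PointedRack X) {n : ℕ} (x : Fin n → X) (s : Finset (Fin n))
    (j : Fin n) : X :=
  ((s.filter fun i => j < i).sort (· ≤ ·)).foldl (fun a i => R.rhd a (x i)) (x j)

/-- The chain `∑_σ ε(σ) (g₁^σ, …, gₙ^σ)` of the inhomogeneous (bar) complex of `G`, where `gᵢ^σ` is
`g_{σ(i)} ◁ g_{i₁} ◁ ⋯ ◁ g_{iₘ}` and `i₁ < ⋯ < iₘ` are the elements of `{σ(1), …, σ(i-1)}` that
are greater than `σ(i)`. -/
def symChain (k : Type u) {G : Type u} [CommRing k] [Group G] {n : ℕ} (g : Fin n → G) :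
    (groupHomology.inhomogeneousChains (Rep.trivial k G k)).X n :=
  (∑ σ : Equiv.Perm (Fin n), ((Equiv.Perm.sign σ : ℤ) : k) •
    Finsupp.single (fun i => twist (PointedRack.conj G) g
      ((Finset.univ.filter fun j => j < i).image σ) (σ i)) 1 : (Fin n → G) →₀ k)

open Classical in
/-- The half-shuffle coproduct of the class of a tuple `(x₁, …, xₙ)`, with values in
`HR ⊗ HR`, for a trivial rack. In degree `0` it is an empty sum. -/
def halfShuffle (k : Type u) [CommRing k] {X : Type u} {R : PointedRack X} (hR : R.IsTrivial)
    {n : ℕ} (x : Fin n → X) :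
    (⨁ m, HR k R m) ⊗[k] (⨁ m, HR k R m) :=
  ∑ p : Fin (n + 1), ∑ σ ∈ Finset.univ.filter (IsShuffleOne (n := n) p),
    ((Equiv.Perm.sign σ : ℤ) : k) •
      (DirectSum.lof k ℕ (fun m => HR k R m) p
          (cls k hR fun i : Fin p => x (σ (Fin.castLE (Nat.lt_succ_iff.1 p.2) i))) ⊗ₜ[k]
        DirectSum.lof k ℕ (fun m => HR k R m) (n - p)
          (cls k hR fun j : Fin (n - p) =>
            twist R x ((Finset.univ.filter fun i : Fin n => (i : ℕ) < p).image σ)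
              (σ ⟨p + j, by omega⟩)))

/-- The cross product `Xᵖ × Yᵠ → (X × Y)ᵖ⁺ᵠ`. -/
def crossTuple {X Y : Type u} (R : PointedRack X) (S : PointedRack Y) {p q : ℕ} (x : Fin p → X)
    (y : Fin q → Y) : Fin (p + q) → X × Y :=
  Fin.append (fun i => (x i, S.pt)) (fun j => (R.pt, y j))

open Classical in
/-- The Pontryagin product on the inhomogeneous (bar) chains of an abelian group:
`(g₁, …, gₚ) ⋆ (gₚ₊₁, …, gₚ₊ᵩ) = ∑_σ ε(σ) (g_{σ⁻¹(1)}, …, g_{σ⁻¹(p+q)})`, the sum being over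
all `(p, q)`-shuffles. -/
def pontryagin (k : Type u) {G : Type u} [CommRing k] [CommGroup G] (p q : ℕ) :
    ((Fin p → G) →₀ k) →ₗ[k] ((Fin q → G) →₀ k) →ₗ[k] ((Fin (p + q) → G) →₀ k) :=
  Finsupp.lsum k fun g => LinearMap.toSpanSingleton k _ <| Finsupp.lsum k fun h =>
    LinearMap.toSpanSingleton k _ <|
      ∑ σ ∈ Finset.univ.filter (IsShuffle (n := p + q) p), ((Equiv.Perm.sign σ : ℤ) : k) •
        Finsupp.single (fun i => Fin.append g h (σ.symm i)) 1

/-- The iterated Pontryagin product `(g₁) ⋆ (g₂) ⋆ ⋯ ⋆ (gₙ)` of chains of degree `1`. -/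
def pontryaginList (k : Type u) {G : Type u} [CommRing k] [CommGroup G] :
    (n : ℕ) → (Fin n → G) → ((Fin n → G) →₀ k)
  | 0, g => Finsupp.single g 1
  | n + 1, g => pontryagin k n 1 (pontryaginList k n (Fin.init g))
      (Finsupp.single (fun _ => g (Fin.last n)) 1)

/-! ### The canonical map from tensor powers to exterior powers -/

/-- The linear map `k[G ∖ {1}] → k ⊗ G` with `[g] ↦ 1 ⊗ g`. -/
def toTensor (k G : Type u) [CommRing k] [CommGroup G] :
    ({g : G // g ≠ 1} →₀ k) →ₗ[k] k ⊗[ℤ] Additive G :=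
  Finsupp.linearCombination k fun g => (1 : k) ⊗ₜ[ℤ] Additive.ofMul (g : G)

/-- The canonical map `Tⁿ(k[G ∖ {1}]) → Λⁿ(G ⊗ k)`, sending `[g₁] ⊗ ⋯ ⊗ [gₙ]` to
`(g₁ ⊗ 1) ∧ ⋯ ∧ (gₙ ⊗ 1)`. -/
def canonicalMap (k G : Type u) [CommRing k] [CommGroup G] (n : ℕ) :
    (⨂[k]^n ({g : G // g ≠ 1} →₀ k)) →ₗ[k] ⋀[k]^n (k ⊗[ℤ] Additive G) :=
  PiTensorProduct.lift
    ((exteriorPower.ιMulti k n).compLinearMap (toTensor k G)).toMultilinearMap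

/-! ### Connected coZinbiel-associative bialgebras -/

section Bialgebra

variable (k : Type u) [CommRing k] (A : ℕ → Type u) [∀ n, AddCommGroup (A n)]
  [∀ n, Module k (A n)]

/-- The product `(a ⊗ b) ⋆ (a' ⊗ b') = (-1)^{|b| |a'|} (a ⋆ a') ⊗ (b ⋆ b')` on `H ⊗ H`. -/
def mulTensor (mul : (⨁ n, A n) →ₗ[k] (⨁ n, A n) →ₗ[k] (⨁ n, A n)) :
    ((⨁ n, A n) ⊗[k] (⨁ n, A n)) →ₗ[k] ((⨁ n, A n) ⊗[k] (⨁ n, A n)) →ₗ[k]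
      ((⨁ n, A n) ⊗[k] (⨁ n, A n)) :=
  TensorProduct.curry <|
    TensorProduct.map (TensorProduct.lift mul) (TensorProduct.lift mul) ∘ₗ
    (TensorProduct.assoc k _ _ _).symm.toLinearMap ∘ₗ
    LinearMap.lTensor _
      ((TensorProduct.assoc k _ _ _).toLinearMap ∘ₗ
        LinearMap.rTensor _ (TensorProduct.gradedComm k A A).toLinearMap ∘ₗ
        (TensorProduct.assoc k _ _ _).symm.toLinearMap) ∘ₗ
    (TensorProduct.assoc k _ _ _).toLinearMap

variable {A}

/-- The reduced coproduct `x ↦ Δ_≺(x) - x ⊗ 1` of the augmentation ideal `ker c`, extended by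
`0` to the unit. -/
def reduced (one : ⨁ n, A n) (counit : (⨁ n, A n) →ₗ[k] k)
    (coprod : (⨁ n, A n) →ₗ[k] (⨁ n, A n) ⊗[k] (⨁ n, A n)) :
    (⨁ n, A n) →ₗ[k] (⨁ n, A n) ⊗[k] (⨁ n, A n) :=
  coprod - (TensorProduct.mk k _ _).flip one ∘ₗ (LinearMap.id - counit.smulRight one)

/-- The coproduct `Δ = Δ_≺ + τ ∘ Δ_≺` on the augmentation ideal `ker c`, extended by
`Δ(1) = 1 ⊗ 1`. Here `τ` is the flip with the Koszul sign. -/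
def fullCoprod (one : ⨁ n, A n) (counit : (⨁ n, A n) →ₗ[k] k)
    (coprod : (⨁ n, A n) →ₗ[k] (⨁ n, A n) ⊗[k] (⨁ n, A n)) :
    (⨁ n, A n) →ₗ[k] (⨁ n, A n) ⊗[k] (⨁ n, A n) :=
  coprod + (TensorProduct.gradedComm k A A).toLinearMap ∘ₗ coprod +
    counit.smulRight (one ⊗ₜ[k] one)

/-- The filtration `F₁ ⊆ F₂ ⊆ ⋯` of the augmentation ideal: `F₁` is the kernel of the reduced
coproduct `Δ⁻` and `Fᵣ₊₁` consists of the `x` with `Δ⁻(x) ∈ Fᵣ ⊗ Fᵣ`. (With `F₀ = 0` the first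
clause is a case of the second.) -/
def filtration (one : ⨁ n, A n) (counit : (⨁ n, A n) →ₗ[k] k)
    (coprod : (⨁ n, A n) →ₗ[k] (⨁ n, A n) ⊗[k] (⨁ n, A n)) : ℕ → Submodule k (⨁ n, A n)
  | 0 => ⊥
  | r + 1 => LinearMap.ker counit ⊓
      (LinearMap.range (TensorProduct.mapIncl (filtration one counit coprod r)
        (filtration one counit coprod r))).comap (reduced k one counit coprod)

/-- `H = ⨁ₙ Aₙ` with the unit `one`, the counit `counit`, the product `mul` and the half-coproduct
`coprod` is a connected (graded) coZinbiel-associative bialgebra. The half-coproduct `Δ_≺` is only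
defined on the augmentation ideal `ker c`, of which `k · 1` is a complement; it is extended to `H`
by the convention `Δ_≺(1) = 0`. -/
structure IsConnectedCoZinbielAssociativeBialgebra (one : ⨁ n, A n)
    (counit : (⨁ n, A n) →ₗ[k] k)
    (mul : (⨁ n, A n) →ₗ[k] (⨁ n, A n) →ₗ[k] (⨁ n, A n))
    (coprod : (⨁ n, A n) →ₗ[k] (⨁ n, A n) ⊗[k] (⨁ n, A n)) : Prop where
  -- all the structure maps are homogeneous of degree `0`
  one_mem : one ∈ LinearMap.range (DirectSum.lof k ℕ A 0)
  counit_lof : ∀ n, n ≠ 0 → ∀ a : A n, counit (DirectSum.lof k ℕ A n a) = 0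
  mul_mem : ∀ p q (a : A p) (b : A q), mul (DirectSum.lof k ℕ A p a) (DirectSum.lof k ℕ A q b) ∈
    LinearMap.range (DirectSum.lof k ℕ A (p + q))
  coprod_mem : ∀ n (a : A n), coprod (DirectSum.lof k ℕ A n a) ∈
    ⨆ p : {p : ℕ × ℕ // p.1 + p.2 = n}, LinearMap.range
      (TensorProduct.map (DirectSum.lof k ℕ A p.1.1) (DirectSum.lof k ℕ A p.1.2))
  -- the unital associative product, with augmentation `counit`
  mul_assoc : ∀ x y z, mul (mul x y) z = mul x (mul y z)
  one_mul : ∀ x, mul one x = x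
  mul_one : ∀ x, mul x one = x
  counit_one : counit one = 1
  counit_mul : ∀ x y, counit (mul x y) = counit x * counit y
  -- the convention on the unit
  coprod_one : coprod one = 0
  -- `(c ⊗ id) ∘ Δ_≺ = 0` and `(id ⊗ c) ∘ Δ_≺ = id` on the augmentation ideal
  counit_coprod : ∀ x, counit x = 0 →
    TensorProduct.lid k _ (counit.rTensor _ (coprod x)) = 0
  coprod_counit : ∀ x, counit x = 0 →
    TensorProduct.rid k _ (counit.lTensor _ (coprod x)) = x
  -- the coZinbiel relation `(Δ_≺ ⊗ id) ∘ Δ_≺ = (id ⊗ Δ_≺ + id ⊗ (τ ∘ Δ_≺)) ∘ Δ_≺` for the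
  -- reduced coproduct on the augmentation ideal
  coZinbiel : ∀ x, counit x = 0 →
    TensorProduct.assoc k _ _ _ ((reduced k one counit coprod).rTensor _
        (reduced k one counit coprod x)) =
      (reduced k one counit coprod + (TensorProduct.gradedComm k A A).toLinearMap ∘ₗ
        reduced k one counit coprod).lTensor _ (reduced k one counit coprod x)
  -- the semi-Hopf relation `Δ_≺(x ⋆ y) = Δ_≺(x) ⋆ Δ(y)`
  semiHopf : ∀ x y, counit x = 0 → coprod (mul x y) =
    mulTensor k A mul (coprod x) (fullCoprod k one counit coprod y)
  -- connectedness: the filtration of the augmentation ideal is exhaustive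
  connected : ∀ x, counit x = 0 → ∃ r, x ∈ filtration k one counit coprod r

end Bialgebra

end RackHomology

end

/-!
For an abelian group `G` the conjugation rack is trivial, so all differentials of the rack complex
vanish and `HRₙ(G, k)` is the module of chains: it is free on the tuples without entry `1`, the
other tuples having class zero (`homologyEquiv`, `HRlift`). This gives the isomorphism with the
tensor power (`tensorPowerEquiv`) and reduces everything else to computations with tuples.

**Group homology.** Antisymmetrized tuples are bar cycles, as the first and the last face cancel
cyclically and the inner faces cancel in pairs (`barD_symSum`). If an entry is `1`, the
antisymmetrization bounds an explicit chain (`exists_barD_eq_symSum`). So `Sₙ` is well defined.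
The shuffle products `(g₁) ⋆ ⋯ ⋆ (gₙ)` are the same cycles (`pontryaginList_eq_symSum`).

In characteristic zero, `(g₁, …, gₙ) ↦ (n!)⁻¹ (g₁ ⊗ 1) ∧ ⋯ ∧ (gₙ ⊗ 1)` vanishes on the
boundaries, because multiplying neighbours is additive in each variable and the alternating sum
telescopes (`barWedge_barD`). The induced map `homologyWedge : Hₙ(G, k) → Λⁿ(G ⊗ k)` sends the
class of an antisymmetrized tuple to the wedge product of its entries; in particular it is
surjective. Its injectivity is a dimension count when `G` is finitely generated: the homology of
`k[G/S]` has dimension at most `r.choose n` in degree `n`, where `r` is the size of an independent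
family in `S`. For `S = 1` this is a contracting homotopy (`homology_permRep_eq_zero`). If a
generator `t` is added to `S`, giving `S'`, then either a power of `t` lies in `S`, and averaging
makes `k[G/S']` a direct summand of `k[G/S]` (`HomologyBound.of_pow_mem`), or
`0 → k[G/S] → k[G/S] → k[G/S'] → 0` is exact, the first map being `t - 1`, and the bound follows
from the long exact sequence and Pascal's rule (`HomologyBound.of_forall_pow_notMem`).
For general `G`, a cycle lives on a finitely generated subgroup `P`, and the map
`Λⁿ(P ⊗ k) → Λⁿ(G ⊗ k)` is injective since `k` is flat over `ℤ`.

**The bialgebra.** The total rack homology is generated by words in the letters `g ∈ G`, freely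
except that a word containing `1` vanishes (`IsWordModule`). Putting a letter `g` in front of a
word is an operator `L` on it, and the coproduct is determined by
`Δ(1) = 1 ⊗ 1` and `Δ ∘ L = (L ⊗ id + s ⊗ L) ∘ Δ`, where `s = (-1)ⁿ` in degree `n`, while
`Δ_≺ ∘ L = (L ⊗ id) ∘ Δ`. A shuffle maps one of the first indices of its two blocks to the first
index, which turns the sum over shuffles into this recursion (`IsWordModule.sum_isShuffle_cut`).
From the recursion it follows by induction on the length of words that `Δ` is invariant under the
flip, multiplicative and coassociative; these give `Δ = Δ_≺ + τ ∘ Δ_≺`, the semi-Hopf relation and,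
after discarding the terms with a factor `1`, the coZinbiel relation. Finally the reduced coproduct
of a word involves only pairs of shorter nonempty words, so the filtration is exhaustive.
-/

noncomputable section

namespace RackHomology

/-! ### Homology classes and their representing cycles -/

section Represents

variable {k : Type u} [CommRing k] {K : ChainComplex (ModuleCat.{u} k) ℕ} {n : ℕ}

theorem exists_represents (h : K.homology n) : ∃ c, Represents K n c h := by
  obtain ⟨z, rfl⟩ := (ModuleCat.epi_iff_surjective (K.homologyπ n)).1 inferInstance h
  exact ⟨_, z, rfl, rfl⟩

theorem exists_represents_of_d_eq_zero {c : K.X n}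
    (hc : (K.d n ((ComplexShape.down ℕ).next n)).hom c = 0) : ∃ h, Represents K n c h :=
  ⟨_, K.cyclesMk c _ rfl hc, K.i_cyclesMk c _ rfl hc, rfl⟩

theorem Represents.unique {c : K.X n} {h h' : K.homology n} (H : Represents K n c h)
    (H' : Represents K n c h') : h = h' := by
  obtain ⟨z, hz, rfl⟩ := H
  obtain ⟨z', hz', rfl⟩ := H'
  have : Function.Injective (K.iCycles n).hom := (ModuleCat.mono_iff_injective _).1 inferInstance
  rw [this (hz.trans hz'.symm)]

theorem Represents.add {c c' : K.X n} {h h' : K.homology n} (H : Represents K n c h)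
    (H' : Represents K n c' h') : Represents K n (c + c') (h + h') := by
  obtain ⟨z, rfl, rfl⟩ := H
  obtain ⟨z', rfl, rfl⟩ := H'
  exact ⟨z + z', map_add _ _ _, map_add _ _ _⟩

theorem Represents.smul {c : K.X n} {h : K.homology n} (a : k) (H : Represents K n c h) :
    Represents K n (a • c) (a • h) := by
  obtain ⟨z, rfl, rfl⟩ := H
  exact ⟨a • z, map_smul _ _ _, map_smul _ _ _⟩

theorem represents_d (w : K.X (n + 1)) : Represents K n ((K.d (n + 1) n).hom w) 0 := by
  refine ⟨(K.toCycles (n + 1) n).hom w, ?_, ?_⟩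
  · rw [← ModuleCat.comp_apply, K.toCycles_i]
  · rw [← ModuleCat.comp_apply, K.toCycles_comp_homologyπ]
    rfl

theorem Represents.d_eq_zero {c : K.X n} {h : K.homology n} (H : Represents K n c h) (j : ℕ) :
    (K.d n j).hom c = 0 := by
  obtain ⟨z, rfl, rfl⟩ := H
  rw [← ModuleCat.comp_apply, K.iCycles_d]
  rfl

theorem Represents.exists_d_eq {c : K.X n} (H : Represents K n c 0) :
    ∃ w : K.X (n + 1), (K.d (n + 1) n).hom w = c := by
  obtain ⟨z, rfl, hz⟩ := H
  have h1 : (K.pOpcycles n).hom ((K.iCycles n).hom z) = 0 := by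
    rw [← ModuleCat.comp_apply, ← K.homology_π_ι, ModuleCat.comp_apply, hz, map_zero]
  have h2 := ((K.sc n).moduleCat_pOpcycles_eq_zero_iff _).1 h1
  obtain ⟨w, hw⟩ := h2
  have hp : (ComplexShape.down ℕ).prev n = n + 1 := ChainComplex.prev ℕ n
  revert w
  change ∀ w : K.X ((ComplexShape.down ℕ).prev n), (K.d _ n).hom w = _ → _
  rw [hp]
  exact fun w hw => ⟨w, hw⟩

end Represents

/-! ### Rack homology of a trivial rack -/

section Trivial

variable {k : Type u} [CommRing k] {X : Type u} {R : PointedRack X}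

/-- The chains of a trivial rack are identified with its homology. -/
def homologyEquiv (k : Type u) [CommRing k] (hR : R.IsTrivial) (n : ℕ) :
    (((Fin n → X) →₀ k) ⧸ degenerate k R n) ≃ₗ[k] HR k R n :=
  have _h1 : IsIso ((CR k R).iCycles n) := (CR k R).isIso_iCycles n _ rfl (d_eq_zero k hR _ _)
  have _h2 : IsIso ((CR k R).homologyπ n) :=
    (CR k R).isIso_homologyπ _ n rfl (d_eq_zero k hR _ _)
  (asIso (inv ((CR k R).iCycles n) ≫ (CR k R).homologyπ n)).toLinearEquiv

theorem homologyEquiv_mk (hR : R.IsTrivial) {n : ℕ} (x : Fin n → X) :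
    homologyEquiv k hR n ((degenerate k R n).mkQ (Finsupp.single x 1)) = cls k hR x := by
  have h1 : IsIso ((CR k R).iCycles n) := (CR k R).isIso_iCycles n _ rfl (d_eq_zero k hR _ _)
  have : (CR k R).liftCycles (𝟙 ((CR k R).X n)) _ rfl (by rw [d_eq_zero k hR]; simp) =
      inv ((CR k R).iCycles n) := by
    rw [← cancel_mono ((CR k R).iCycles n)]
    simp
  unfold cls
  rw [this]
  rfl

theorem cls_eq_zero (hR : R.IsTrivial) {n : ℕ} {x : Fin n → X} (i : Fin n) (hx : x i = R.pt) :
    cls k hR x = 0 := by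
  rw [← homologyEquiv_mk]
  have : (degenerate k R n).mkQ (Finsupp.single x 1) = 0 :=
    (Submodule.Quotient.mk_eq_zero _).2 (Submodule.subset_span ⟨x, ⟨i, hx⟩, rfl⟩)
  rw [this, map_zero]

variable {M : Type*} [AddCommGroup M] [Module k M]

theorem HR_hom_ext (hR : R.IsTrivial) {n : ℕ} {f g : HR k R n →ₗ[k] M}
    (h : ∀ x : Fin n → X, f (cls k hR x) = g (cls k hR x)) : f = g := by
  have : f ∘ₗ (homologyEquiv k hR n).toLinearMap = g ∘ₗ (homologyEquiv k hR n).toLinearMap := by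
    refine Submodule.linearMap_qext _ (Finsupp.lhom_ext' fun x => LinearMap.ext_ring ?_)
    have := h x
    rw [← homologyEquiv_mk] at this
    exact this
  refine LinearMap.ext fun y => ?_
  obtain ⟨y, rfl⟩ := (homologyEquiv k hR n).surjective y
  exact LinearMap.congr_fun this y

/-- A linear map out of the homology of a trivial rack is given by its values on the classes of
tuples, which are arbitrary except for vanishing on degenerate tuples. -/
def HRlift (hR : R.IsTrivial) {n : ℕ} (f : (Fin n → X) → M)
    (hf : ∀ x i, x i = R.pt → f x = 0) : HR k R n →ₗ[k] M :=
  (degenerate k R n).liftQ (Finsupp.linearCombination k f) (Submodule.span_le.2 <| by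
    rintro _ ⟨x, ⟨i, hx⟩, rfl⟩
    simp [hf x i hx]) ∘ₗ (homologyEquiv k hR n).symm.toLinearMap

@[simp]
theorem HRlift_cls (hR : R.IsTrivial) {n : ℕ} (f : (Fin n → X) → M)
    (hf : ∀ x i, x i = R.pt → f x = 0) (x : Fin n → X) :
    HRlift (k := k) hR f hf (cls k hR x) = f x := by
  rw [← homologyEquiv_mk, HRlift, LinearMap.comp_apply, LinearEquiv.coe_coe,
    LinearEquiv.symm_apply_apply]
  exact (Submodule.liftQ_apply _ _ _).trans (by simp)

theorem HRmap_cls {Y : Type u} {S : PointedRack Y} (hR : R.IsTrivial) (hS : S.IsTrivial)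
    (f : R.Hom S) {n : ℕ} (x : Fin n → X) :
    HRmap k f n (cls k hR x) = cls k hS fun i => f.toFun (x i) := by
  have h : ((CRmap k f).f n).hom (chain k R x) = chain k S fun i => f.toFun (x i) := by
    change CRmapX k f n _ = _
    exact (Submodule.mapQ_apply _ _ _ _).trans
      (congrArg (degenerate k S n).mkQ (by simp))
  unfold HRmap cls
  rw [← h, ← ModuleCat.comp_apply, ← ModuleCat.comp_apply]
  congr 2
  simp only [Category.assoc, HomologicalComplex.homologyπ_naturality]
  rw [← Category.assoc, ← Category.assoc]
  congr 1
  rw [← cancel_mono ((CR k S).iCycles n)]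
  simp

end Trivial

section TensorPower

variable {k G : Type u} [CommRing k] [CommGroup G]

open Classical in
/-- The rack homology of an abelian group in degree `n` is the `n`-th tensor power of
`k[G ∖ {1}]`: both are free on the tuples without entry `1`. -/
def tensorPowerEquiv (k G : Type u) [CommRing k] [CommGroup G] (n : ℕ) :
    HR k (PointedRack.conj G) n ≃ₗ[k] ⨂[k]^n ({g : G // g ≠ 1} →₀ k) :=
  LinearEquiv.ofLinearMap
    (HRlift (PointedRack.isTrivial_conj G)
      (fun g : Fin n → G => if hg : ∀ i, g i ≠ 1 then
        Finsupp.single (fun i => (⟨g i, hg i⟩ : {g : G // g ≠ 1})) (1 : k) else 0)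
      (fun x i hx => dif_neg fun h => h i hx))
    (Finsupp.linearCombination k fun g : Fin n → {g : G // g ≠ 1} =>
      cls k (PointedRack.isTrivial_conj G) fun i => (g i : G))
    (by
      refine Finsupp.lhom_ext' fun g => LinearMap.ext_ring ?_
      simp [(g _).2])
    (by
      refine HR_hom_ext (PointedRack.isTrivial_conj G) fun g => ?_
      by_cases hg : ∀ i, g i ≠ 1
      · simp [hg]
      · obtain ⟨i, hi⟩ : ∃ i, g i = 1 := by simpa using hg
        simp [cls_eq_zero (k := k) (PointedRack.isTrivial_conj G) i hi]) ≪≫ₗ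
  PiTensorProduct.ofFinsuppEquiv'.symm

theorem tensorPowerEquiv_cls {n : ℕ} (g : Fin n → G) (hg : ∀ i, g i ≠ 1) :
    tensorPowerEquiv k G n (cls k (PointedRack.isTrivial_conj G) g) =
      PiTensorProduct.tprod k fun i => Finsupp.single (⟨g i, hg i⟩ : {g : G // g ≠ 1}) 1 := by
  classical
  rw [tensorPowerEquiv, LinearEquiv.trans_apply, LinearEquiv.symm_apply_eq,
    PiTensorProduct.ofFinsuppEquiv'_tprod_single]
  simp [hg]

end TensorPower

/-! ### Permutations with a prescribed value -/

section Perm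

variable {n : ℕ}

/-- The permutation of `Fin (n + 1)` that sends `j` to `a` and is given by `σ` on the complements
of `j` and of `a`, each identified with `Fin n` by its order. -/
def insertPerm (a j : Fin (n + 1)) (σ : Equiv.Perm (Fin n)) : Equiv.Perm (Fin (n + 1)) :=
  a.cycleRange⁻¹ * (Equiv.Perm.decomposeFin.symm (0, σ) * j.cycleRange)

@[simp]
theorem insertPerm_self (a j : Fin (n + 1)) (σ : Equiv.Perm (Fin n)) :
    insertPerm a j σ j = a := by
  simp only [insertPerm, Equiv.Perm.mul_apply, Fin.cycleRange_self,
    Equiv.Perm.decomposeFin_symm_apply_zero]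
  exact Fin.cycleRange_symm_zero a

@[simp]
theorem insertPerm_succAbove (a j : Fin (n + 1)) (σ : Equiv.Perm (Fin n)) (i : Fin n) :
    insertPerm a j σ (j.succAbove i) = a.succAbove (σ i) := by
  simp only [insertPerm, Equiv.Perm.mul_apply, Fin.cycleRange_succAbove,
    Equiv.Perm.decomposeFin_symm_apply_succ, Equiv.swap_self, Equiv.refl_apply]
  exact Fin.cycleRange_symm_succ a _

theorem sign_insertPerm (a j : Fin (n + 1)) (σ : Equiv.Perm (Fin n)) :
    Equiv.Perm.sign (insertPerm a j σ) = (-1) ^ (a : ℕ) * (-1) ^ (j : ℕ) * Equiv.Perm.sign σ := by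
  simp [insertPerm, Fin.sign_cycleRange, Equiv.Perm.decomposeFin.symm_sign, mul_comm,
    mul_assoc]

theorem insertPerm_bijective (a : Fin (n + 1)) :
    Function.Bijective fun p : Fin (n + 1) × Equiv.Perm (Fin n) => insertPerm a p.1 p.2 := by
  rw [Fintype.bijective_iff_injective_and_card]
  refine ⟨?_, by simp [Fintype.card_perm, Nat.factorial_succ]⟩
  rintro ⟨j, σ⟩ ⟨j', σ'⟩ h
  simp only at h
  obtain rfl : j = j' := by
    have h1 := insertPerm_self a j σ
    rw [h] at h1
    exact (insertPerm a j' σ').injective (h1.trans (insertPerm_self a j' σ').symm)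
  refine Prod.ext rfl (Equiv.ext fun i => ?_)
  have h1 := insertPerm_succAbove a j σ i
  rw [h, insertPerm_succAbove] at h1
  exact (Fin.succAbove_right_injective h1).symm

theorem sum_perm_eq_sum_insertPerm {M : Type*} [AddCommMonoid M] (a : Fin (n + 1))
    (f : Equiv.Perm (Fin (n + 1)) → M) :
    ∑ σ, f σ = ∑ j : Fin (n + 1), ∑ σ : Equiv.Perm (Fin n), f (insertPerm a j σ) := by
  rw [← Fintype.sum_prod_type']
  exact (Function.Bijective.sum_comp (insertPerm_bijective a) f).symm

theorem comp_insertPerm {α : Type*} (x : Fin (n + 1) → α) (a j : Fin (n + 1))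
    (σ : Equiv.Perm (Fin n)) :
    (fun i => x (insertPerm a j σ i)) =
      j.insertNth (x a) (fun i => x (a.succAbove (σ i))) := by
  rw [Fin.eq_insertNth_iff]
  exact ⟨by simp, by ext i; simp [Fin.removeNth]⟩

end Perm

/-! ### The antisymmetrization cycle -/

section SymSum

variable (k : Type u) {G : Type u} [CommRing k]

/-- The signed sum of all rearrangements of a tuple. -/
def symSum {n : ℕ} (g : Fin n → G) : (Fin n → G) →₀ k :=
  ∑ σ : Equiv.Perm (Fin n), ((Equiv.Perm.sign σ : ℤ) : k) • Finsupp.single (fun i => g (σ i)) 1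

/-- Inserting `a` at position `j`. -/
def insertAt {n : ℕ} (j : Fin (n + 1)) (a : G) :
    ((Fin n → G) →₀ k) →ₗ[k] ((Fin (n + 1) → G) →₀ k) :=
  Finsupp.lmapDomain k k fun x => (Fin.insertNth j a x : Fin (n + 1) → G)

@[simp]
theorem insertAt_single {n : ℕ} (j : Fin (n + 1)) (a : G) (x : Fin n → G) (r : k) :
    insertAt k j a (Finsupp.single x r) =
      Finsupp.single (Fin.insertNth j a x : Fin (n + 1) → G) r :=
  Finsupp.mapDomain_single

/-- The rearrangements of a tuple are obtained from those of the tuple without its entry `g a` by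
inserting `g a` at all positions. -/
theorem symSum_succ {n : ℕ} (a : Fin (n + 1)) (g : Fin (n + 1) → G) :
    symSum k g = (-1 : k) ^ (a : ℕ) • ∑ j : Fin (n + 1), (-1 : k) ^ (j : ℕ) •
      insertAt k j (g a) (symSum k fun i => g (a.succAbove i)) := by
  unfold symSum
  rw [sum_perm_eq_sum_insertPerm a, Finset.smul_sum]
  refine Finset.sum_congr rfl fun j _ => ?_
  rw [map_sum, Finset.smul_sum, Finset.smul_sum]
  refine Finset.sum_congr rfl fun σ _ => ?_
  rw [map_smul, insertAt_single, comp_insertPerm, sign_insertPerm, smul_smul, smul_smul]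
  push_cast
  ring_nf

end SymSum

theorem PointedRack.IsTrivial.twist {X : Type u} {R : PointedRack X} (hR : R.IsTrivial) {n : ℕ}
    (x : Fin n → X) (s : Finset (Fin n)) (j : Fin n) : twist R x s j = x j := by
  unfold RackHomology.twist
  generalize (s.filter fun i => j < i).sort (· ≤ ·) = l
  generalize x j = y
  induction l with
  | nil => rfl
  | cons a l ih => rw [List.foldl_cons, hR]; exact ih

theorem symChain_eq_symSum (k : Type u) {G : Type u} [CommRing k] [CommGroup G] {n : ℕ}
    (g : Fin n → G) : symChain k g = symSum k g := by
  unfold symChain symSum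
  simp only [(PointedRack.isTrivial_conj G).twist]

theorem contractNth_zero_cons {α : Type*} (op : α → α → α) {n : ℕ} (a : α) (x : Fin (n + 1) → α) :
    Fin.contractNth 0 op (Fin.cons a x : Fin (n + 2) → α) =
      (Fin.cons (op a (x 0)) (Fin.tail x) : Fin (n + 1) → α) := by
  funext l
  refine Fin.cases ?_ (fun l => ?_) l
  · rw [Fin.contractNth_apply_of_eq _ _ _ _ (by simp)]
    simp
  · rw [Fin.contractNth_apply_of_gt _ _ _ _ (by simp)]
    simp [Fin.tail]

theorem contractNth_succ_cons {α : Type*} (op : α → α → α) {n : ℕ} (a : α) (x : Fin (n + 1) → α)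
    (j : Fin (n + 1)) :
    Fin.contractNth j.succ op (Fin.cons a x : Fin (n + 2) → α) =
      (Fin.cons a (Fin.contractNth j op x) : Fin (n + 1) → α) := by
  funext l
  refine Fin.cases ?_ (fun l => ?_) l
  · rw [Fin.contractNth_apply_of_lt _ _ _ _ (by simp)]
    simp
  · rw [Fin.cons_succ]
    rcases lt_trichotomy (l : ℕ) (j : ℕ) with h | h | h
    · rw [Fin.contractNth_apply_of_lt _ _ _ _ (by simpa using h),
        Fin.contractNth_apply_of_lt _ _ _ _ (by simpa using h)]
      rw [← Fin.succ_castSucc, Fin.cons_succ]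
    · rw [Fin.contractNth_apply_of_eq _ _ _ _ (by simpa using h),
        Fin.contractNth_apply_of_eq _ _ _ _ (by simpa using h)]
      rw [← Fin.succ_castSucc, Fin.cons_succ, Fin.cons_succ]
    · rw [Fin.contractNth_apply_of_gt _ _ _ _ (by simpa using h),
        Fin.contractNth_apply_of_gt _ _ _ _ (by simpa using h)]
      rw [Fin.cons_succ]

section Bar

variable (k : Type u) (G : Type u) [CommRing k]

section Group

variable [Group G]

/-- The differential of the bar complex with trivial coefficients. -/
def barD (n : ℕ) : ((Fin (n + 1) → G) →₀ k) →ₗ[k] ((Fin n → G) →₀ k) :=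
  Finsupp.lsum k fun g => Finsupp.lsingle (fun i => g i.succ) +
    ∑ j : Fin (n + 1), (-1 : k) ^ ((j : ℕ) + 1) • Finsupp.lsingle (Fin.contractNth j (· * ·) g)

theorem barD_single {n : ℕ} (g : Fin (n + 1) → G) (a : k) :
    barD k G n (Finsupp.single g a) = Finsupp.single (fun i => g i.succ) a +
      ∑ j : Fin (n + 1), (-1 : k) ^ ((j : ℕ) + 1) •
        Finsupp.single (Fin.contractNth j (· * ·) g) a := by
  simp [barD]

theorem inhomogeneousChains_d (n : ℕ) (c : (Fin (n + 1) → G) →₀ k) :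
    ((groupHomology.inhomogeneousChains (Rep.trivial k G k)).d (n + 1) n).hom c =
      barD k G n c := by
  rw [groupHomology.inhomogeneousChains.d_def]
  rfl

end Group

variable {G}

/-- Putting `a` in front. -/
def consMap {n : ℕ} (a : G) : ((Fin n → G) →₀ k) →ₗ[k] ((Fin (n + 1) → G) →₀ k) :=
  Finsupp.lmapDomain k k fun x => (Fin.cons a x : Fin (n + 1) → G)

@[simp]
theorem consMap_single {n : ℕ} (a : G) (x : Fin n → G) (r : k) :
    consMap k a (Finsupp.single x r) = Finsupp.single (Fin.cons a x : Fin (n + 1) → G) r :=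
  Finsupp.mapDomain_single

/-- Deleting the first entry. -/
def tailMap (n : ℕ) : ((Fin (n + 1) → G) →₀ k) →ₗ[k] ((Fin n → G) →₀ k) :=
  Finsupp.lmapDomain k k Fin.tail

@[simp]
theorem tailMap_consMap {n : ℕ} (a : G) (w : (Fin n → G) →₀ k) :
    tailMap k n (consMap k a w) = w := by
  induction w using Finsupp.induction_linear with
  | zero => simp
  | add f g hf hg => simp only [map_add, hf, hg]
  | single x r =>
    rw [consMap_single]
    exact Finsupp.mapDomain_single.trans (by simp)

/-- Every chain of positive degree is a sum of chains in the image of some `consMap`. -/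
theorem consMap_cases {n : ℕ} {p : ((Fin (n + 1) → G) →₀ k) → Prop} (h0 : p 0)
    (hadd : ∀ f g, p f → p g → p (f + g)) (h : ∀ a w, p (consMap k a w))
    (w : (Fin (n + 1) → G) →₀ k) : p w := by
  induction w using Finsupp.induction_linear with
  | zero => exact h0
  | add f g hf hg => exact hadd f g hf hg
  | single x r =>
    have := h (x 0) (Finsupp.single (Fin.tail x) r)
    rwa [consMap_single, Fin.cons_self_tail] at this

variable [CommGroup G]

theorem contractNth_swap {n : ℕ} (i : Fin n) (x : Fin (n + 1) → G) :
    Fin.contractNth i.castSucc (· * ·) (fun l => x (Equiv.swap i.castSucc i.succ l)) =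
      Fin.contractNth i.castSucc (· * ·) x := by
  funext l
  rcases lt_trichotomy (l : ℕ) (i : ℕ) with h | h | h
  · rw [Fin.contractNth_apply_of_lt _ _ _ _ (by simpa using h),
      Fin.contractNth_apply_of_lt _ _ _ _ (by simpa using h), Equiv.swap_apply_of_ne_of_ne]
    · simp [Fin.ext_iff]; omega
    · simp [Fin.ext_iff]; omega
  · obtain rfl : l = i := Fin.ext h
    rw [Fin.contractNth_apply_of_eq _ _ _ _ (by simp),
      Fin.contractNth_apply_of_eq _ _ _ _ (by simp)]
    simp [mul_comm]
  · rw [Fin.contractNth_apply_of_gt _ _ _ _ (by simpa using h),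
      Fin.contractNth_apply_of_gt _ _ _ _ (by simpa using h), Equiv.swap_apply_of_ne_of_ne]
    · simp [Fin.ext_iff]; omega
    · simp [Fin.ext_iff]; omega

/-- In an abelian group the inner faces of the antisymmetrization cancel in pairs, and its two outer
faces cancel by a cyclic rotation. -/
theorem barD_symSum {n : ℕ} (g : Fin (n + 1) → G) : barD k G n (symSum k g) = 0 := by
  have inner : ∀ i : Fin n, ∑ σ : Equiv.Perm (Fin (n + 1)), ((Equiv.Perm.sign σ : ℤ) : k) •
      Finsupp.single (Fin.contractNth i.castSucc (· * ·) fun l => g (σ l)) (1 : k) = 0 := by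
    intro i
    refine Finset.sum_involution (fun σ _ => σ * Equiv.swap i.castSucc i.succ) ?_ ?_ ?_ ?_
    · intro σ _
      have := contractNth_swap i (fun l => g (σ l))
      simp only [Equiv.Perm.mul_apply]
      rw [this, ← add_smul, Equiv.Perm.sign_mul, Equiv.Perm.sign_swap (by simp [Fin.ext_iff])]
      simp
    · intro σ _ _ h
      have : Equiv.swap i.castSucc i.succ = 1 := by simpa using h
      rw [Equiv.swap_eq_one_iff] at this
      simp [Fin.ext_iff] at this
    · intro σ _; exact Finset.mem_univ _
    · intro σ _; simp [mul_assoc]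
  have last : ∀ x : Fin (n + 1) → G,
      Fin.contractNth (Fin.last n) (· * ·) x = fun l => x l.castSucc := by
    intro x
    funext l
    rw [Fin.contractNth_apply_of_lt _ _ _ _ (by simp)]
  have outer : ∑ σ : Equiv.Perm (Fin (n + 1)), ((Equiv.Perm.sign σ : ℤ) : k) •
        Finsupp.single (fun l : Fin n => g (σ l.castSucc)) (1 : k) =
      (-1 : k) ^ n • ∑ σ : Equiv.Perm (Fin (n + 1)), ((Equiv.Perm.sign σ : ℤ) : k) •
        Finsupp.single (fun l : Fin n => g (σ l.succ)) (1 : k) := by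
    rw [← Equiv.sum_comp (Equiv.mulRight (finRotate (n + 1))), Finset.smul_sum]
    refine Finset.sum_congr rfl fun σ _ => ?_
    simp only [Equiv.coe_mulRight, Equiv.Perm.mul_apply, Equiv.Perm.sign_mul, sign_finRotate,
      smul_smul, finRotate_apply, Fin.coeSucc_eq_succ]
    push_cast
    simp [mul_comm]
  unfold symSum
  simp only [map_sum, map_smul, barD_single, smul_add, Finset.sum_add_distrib, Finset.smul_sum]
  rw [Finset.sum_comm, Fin.sum_univ_castSucc]
  simp only [smul_comm _ ((-1 : k) ^ _), ← Finset.smul_sum]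
  simp only [inner, last, outer, smul_zero, Finset.sum_const_zero, smul_smul]
  rw [zero_add, Fin.val_last, ← pow_add, Odd.neg_one_pow ⟨n, by ring⟩, neg_one_smul, add_neg_cancel]

/-! ### Antisymmetrizations of degenerate tuples are boundaries -/

/-- Multiplying the first entry by `a`. -/
def headMul {n : ℕ} (a : G) : ((Fin (n + 1) → G) →₀ k) →ₗ[k] ((Fin (n + 1) → G) →₀ k) :=
  Finsupp.lmapDomain k k fun x => (Fin.cons (a * x 0) (Fin.tail x) : Fin (n + 1) → G)

/-- All faces of the bar complex but the one that deletes the first entry. -/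
def barD' (n : ℕ) : ((Fin (n + 1) → G) →₀ k) →ₗ[k] ((Fin n → G) →₀ k) :=
  barD k G n - tailMap k n

@[simp]
theorem headMul_consMap {n : ℕ} (a b : G) (w : (Fin n → G) →₀ k) :
    headMul k a (consMap k b w) = consMap k (a * b) w := by
  induction w using Finsupp.induction_linear with
  | zero => simp
  | add f g hf hg => simp only [map_add, hf, hg]
  | single x r =>
    rw [consMap_single, consMap_single]
    exact Finsupp.mapDomain_single.trans (by simp)

theorem barD'_single {n : ℕ} (x : Fin (n + 1) → G) (r : k) :
    barD' k n (Finsupp.single x r) = ∑ j : Fin (n + 1), (-1 : k) ^ ((j : ℕ) + 1) •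
        Finsupp.single (Fin.contractNth j (· * ·) x) r := by
  have : tailMap k n (Finsupp.single x r) = Finsupp.single (fun i => x i.succ) r :=
    Finsupp.mapDomain_single
  rw [barD', LinearMap.sub_apply, this, barD_single, add_sub_cancel_left]

theorem barD'_consMap {n : ℕ} (a : G) (w : (Fin (n + 1) → G) →₀ k) :
    barD' k (n + 1) (consMap k a w) = - headMul k a w - consMap k a (barD' k n w) := by
  induction w using Finsupp.induction_linear with
  | zero => simp
  | add f g hf hg => simp only [map_add, hf, hg]; abel
  | single x r =>
    have hh : headMul k a (Finsupp.single x r) =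
        Finsupp.single (Fin.cons (a * x 0) (Fin.tail x) : Fin (n + 1) → G) r :=
      Finsupp.mapDomain_single
    rw [consMap_single, barD'_single, barD'_single, Fin.sum_univ_succ, contractNth_zero_cons, hh,
      map_sum]
    simp only [contractNth_succ_cons, Fin.val_zero, zero_add, pow_one, neg_smul, one_smul,
      Fin.val_succ, map_smul, consMap_single, pow_succ _ (_ + 1), mul_neg, mul_one,
      Finset.sum_neg_distrib, sub_eq_add_neg]

theorem barD'_consMap_zero (a : G) (w : (Fin 0 → G) →₀ k) :
    barD' k 0 (consMap k a w) = - w := by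
  induction w using Finsupp.induction_linear with
  | zero => simp
  | add f g hf hg => simp only [map_add, hf, hg]; abel
  | single x r =>
    rw [consMap_single, barD'_single]
    rw [Fin.sum_univ_one, Fin.val_zero, pow_succ, pow_zero, one_mul, neg_one_smul]
    congr 2
    exact Subsingleton.elim _ _

/-- The sum of all insertions of a pair of adjacent entries `1`. -/
def doubleInsert : (n : ℕ) → ((Fin n → G) →₀ k) →ₗ[k] ((Fin (n + 2) → G) →₀ k)
  | 0 => consMap k 1 ∘ₗ consMap k 1
  | n + 1 => Finsupp.linearCombination k fun x : Fin (n + 1) → G =>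
      consMap k 1 (consMap k 1 (Finsupp.single x 1)) +
        consMap k (x 0) (doubleInsert n (Finsupp.single (Fin.tail x) 1))

/-- The alternating sum of all insertions of an entry `1`. -/
def alternatingInsert (n : ℕ) : ((Fin n → G) →₀ k) →ₗ[k] ((Fin (n + 1) → G) →₀ k) :=
  ∑ j : Fin (n + 1), (-1 : k) ^ (j : ℕ) • insertAt k j 1

theorem doubleInsert_consMap {n : ℕ} (a : G) (w : (Fin n → G) →₀ k) :
    doubleInsert k (n + 1) (consMap k a w) =
      consMap k 1 (consMap k 1 (consMap k a w)) + consMap k a (doubleInsert k n w) := by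
  induction w using Finsupp.induction_linear with
  | zero => simp
  | add f g hf hg => simp only [map_add, hf, hg]; abel
  | single x r =>
    have hr : Finsupp.single x r = r • Finsupp.single x (1 : k) := by simp
    rw [hr]
    simp only [map_smul, ← smul_add]
    congr 1
    rw [consMap_single, doubleInsert]
    simp

theorem alternatingInsert_consMap {n : ℕ} (a : G) (w : (Fin n → G) →₀ k) :
    alternatingInsert k (n + 1) (consMap k a w) =
      consMap k 1 (consMap k a w) - consMap k a (alternatingInsert k n w) := by
  induction w using Finsupp.induction_linear with
  | zero => simp
  | add f g hf hg => simp only [map_add, hf, hg]; abel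
  | single x r =>
    have hs : ∀ j : Fin (n + 1), (j.succ.insertNth 1 (Fin.cons a x : Fin (n + 1) → G) :
        Fin (n + 2) → G) = Fin.cons a (j.insertNth 1 x : Fin (n + 1) → G) := by
      intro j
      rw [Fin.insertNth_eq_iff]
      refine ⟨by simp, ?_⟩
      funext l
      refine Fin.cases ?_ (fun l => ?_) l
      · simp [Fin.removeNth]
      · simp [Fin.removeNth]
    simp only [alternatingInsert, LinearMap.sum_apply, LinearMap.smul_apply, consMap_single,
      insertAt_single, map_sum, map_smul]
    rw [Fin.sum_univ_succ]
    simp only [hs, Fin.val_zero, pow_zero, one_smul, Fin.insertNth_zero', Fin.val_succ, pow_succ,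
      mul_neg, mul_one, neg_smul, Finset.sum_neg_distrib, sub_eq_add_neg]

theorem alternatingInsert_zero (w : (Fin 0 → G) →₀ k) :
    alternatingInsert k 0 w = consMap k 1 w := by
  unfold alternatingInsert
  rw [Fin.sum_univ_one, Fin.val_zero, pow_zero, one_smul]
  unfold insertAt consMap
  simp only [Fin.insertNth_zero']

theorem barD'_doubleInsert_consMap {n : ℕ} (a : G) (w : (Fin n → G) →₀ k) :
    barD' k (n + 2) (doubleInsert k (n + 1) (consMap k a w)) =
      - consMap k a (alternatingInsert k n w) + doubleInsert k n (barD' k n (consMap k a w)) := by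
  induction n generalizing a with
  | zero =>
    rw [doubleInsert_consMap, alternatingInsert_zero]
    simp only [map_add, doubleInsert, LinearMap.comp_apply, barD'_consMap, barD'_consMap_zero,
      headMul_consMap, one_mul, mul_one, map_neg, map_sub]
    abel
  | succ n ih =>
    refine consMap_cases k (p := fun w => barD' k (n + 1 + 2) (doubleInsert k (n + 1 + 1)
      (consMap k a w)) = - consMap k a (alternatingInsert k (n + 1) w) +
        doubleInsert k (n + 1) (barD' k (n + 1) (consMap k a w))) (by simp) ?_ ?_ w
    · intro f g hf hg
      simp only [map_add, hf, hg]
      abel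
    · intro b v
      rw [doubleInsert_consMap, alternatingInsert_consMap, map_add, barD'_consMap, barD'_consMap,
        barD'_consMap k a (doubleInsert k (n + 1) (consMap k b v)), ih, barD'_consMap k a]
      simp only [map_add, map_sub, map_neg, headMul_consMap, doubleInsert_consMap,
        one_mul, mul_one]
      abel

/-- On cycles, inserting an entry `1` in all possible ways, with alternating signs, is a boundary.
In the boundary of the chain with a pair `1, 1` inserted, the faces next to the pair leave one
entry `1`, and the other faces commute with the insertion up to sign. -/
theorem barD_doubleInsert {n : ℕ} (w : (Fin (n + 1) → G) →₀ k) :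
    barD k G (n + 2) (doubleInsert k (n + 1) w) =
      alternatingInsert k (n + 1) w + doubleInsert k n (barD k G n w) := by
  have h : ∀ {m : ℕ} (c : (Fin (m + 1) → G) →₀ k), barD k G m c = tailMap k m c + barD' k m c :=
    fun c => by simp [barD']
  refine consMap_cases k (p := fun w => barD k G (n + 2) (doubleInsert k (n + 1) w) =
      alternatingInsert k (n + 1) w + doubleInsert k n (barD k G n w)) (by simp) ?_ ?_ w
  · intro f g hf hg
    simp only [map_add, hf, hg]
    abel
  · intro a v
    rw [h, h, barD'_doubleInsert_consMap, doubleInsert_consMap, alternatingInsert_consMap]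
    simp only [map_add, tailMap_consMap]
    abel

theorem barD_doubleInsert_zero (w : (Fin 0 → G) →₀ k) :
    barD k G 1 (doubleInsert k 0 w) = alternatingInsert k 0 w := by
  have h : ∀ {m : ℕ} (c : (Fin (m + 1) → G) →₀ k), barD k G m c = tailMap k m c + barD' k m c :=
    fun c => by simp [barD']
  rw [h, alternatingInsert_zero]
  simp [doubleInsert, barD'_consMap, barD'_consMap_zero]

/-- An entry `1` of the tuple is inserted at all positions into the antisymmetrization of the other
entries, which is a cycle. -/
theorem exists_barD_eq_symSum {n : ℕ} (g : Fin n → G) (i : Fin n) (hi : g i = 1) :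
    ∃ w, barD k G n w = symSum k g := by
  obtain ⟨n, rfl⟩ : ∃ m, n = m + 1 := ⟨n - 1, by have := i.2; omega⟩
  have key : symSum k g = (-1 : k) ^ (i : ℕ) •
      alternatingInsert k n (symSum k fun l => g (i.succAbove l)) := by
    rw [symSum_succ k i, hi]
    simp [alternatingInsert]
  rw [key]
  cases n with
  | zero =>
    refine ⟨(-1 : k) ^ (i : ℕ) • doubleInsert k 0 (symSum k fun l => g (i.succAbove l)), ?_⟩
    rw [map_smul, barD_doubleInsert_zero]
  | succ n =>
    refine ⟨(-1 : k) ^ (i : ℕ) • doubleInsert k (n + 1) (symSum k fun l => g (i.succAbove l)), ?_⟩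
    rw [map_smul, barD_doubleInsert, barD_symSum, map_zero, add_zero]

end Bar

/-! ### The map from rack homology to group homology -/

section SymClass

variable (k : Type u) {G : Type u} [CommRing k] [CommGroup G]

theorem exists_represents_symSum {n : ℕ} (g : Fin n → G) :
    ∃ h : groupHomology (Rep.trivial k G k) n,
      Represents (groupHomology.inhomogeneousChains (Rep.trivial k G k)) n (symSum k g) h := by
  refine exists_represents_of_d_eq_zero ?_
  cases n with
  | zero =>
    rw [HomologicalComplex.shape _ _ _ (by simp)]
    rfl
  | succ n =>
    rw [show (ComplexShape.down ℕ).next (n + 1) = n from ChainComplex.next_nat_succ n]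
    exact (inhomogeneousChains_d k G n _).trans (barD_symSum k g)

/-- The homology class of the antisymmetrization of a tuple. -/
def symClass {n : ℕ} (g : Fin n → G) : groupHomology (Rep.trivial k G k) n :=
  (exists_represents_symSum k g).choose

theorem represents_symClass {n : ℕ} (g : Fin n → G) :
    Represents (groupHomology.inhomogeneousChains (Rep.trivial k G k)) n (symSum k g)
      (symClass k g) :=
  (exists_represents_symSum k g).choose_spec

theorem symClass_eq_zero {n : ℕ} (g : Fin n → G) (i : Fin n) (hi : g i = 1) :
    symClass k g = 0 := by
  obtain ⟨w, hw⟩ := exists_barD_eq_symSum k g i hi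
  refine (represents_symClass k g).unique ?_
  have := represents_d (K := groupHomology.inhomogeneousChains (Rep.trivial k G k)) (n := n) w
  rwa [inhomogeneousChains_d, hw] at this

/-- The map `Sₙ` from the rack homology to the group homology of an abelian group. -/
def symMap (k G : Type u) [CommRing k] [CommGroup G] (n : ℕ) :
    HR k (PointedRack.conj G) n →ₗ[k] groupHomology (Rep.trivial k G k) n :=
  HRlift (PointedRack.isTrivial_conj G) (symClass k) (symClass_eq_zero k)

@[simp]
theorem symMap_cls {n : ℕ} (g : Fin n → G) :
    symMap k G n (cls k (PointedRack.isTrivial_conj G) g) = symClass k g :=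
  HRlift_cls _ _ _ _

end SymClass

/-! ### The iterated Pontryagin product -/

section Pontryagin

variable (k : Type u) {G : Type u} [CommRing k] [CommGroup G]

theorem isShuffle_insertPerm_last {n : ℕ} (j : Fin (n + 1)) :
    IsShuffle n (insertPerm j (Fin.last n) 1) := by
  constructor
  · intro a b hab hb
    obtain ⟨b, rfl⟩ : ∃ b' : Fin n, b = b'.castSucc := ⟨⟨b, hb⟩, rfl⟩
    obtain ⟨a, rfl⟩ : ∃ a' : Fin n, a = a'.castSucc :=
      ⟨⟨a, lt_trans (Fin.lt_def.1 hab) b.2⟩, rfl⟩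
    have : ∀ l : Fin n, insertPerm j (Fin.last n) 1 l.castSucc = j.succAbove l := by
      intro l
      rw [← Fin.succAbove_last_apply, insertPerm_succAbove, Equiv.Perm.one_apply]
    rw [this, this]
    exact Fin.strictMono_succAbove j (by simpa using hab)
  · intro a b hab ha
    have := b.2
    rw [Fin.lt_def] at hab
    omega

theorem isShuffle_iff_exists_insertPerm_last {n : ℕ} (τ : Equiv.Perm (Fin (n + 1))) :
    IsShuffle n τ ↔ ∃ j, insertPerm j (Fin.last n) 1 = τ := by
  refine ⟨fun h => ?_, fun ⟨j, hj⟩ => hj ▸ isShuffle_insertPerm_last j⟩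
  refine ⟨τ (Fin.last n), Equiv.ext fun i => ?_⟩
  refine Fin.lastCases ?_ (fun i => ?_) i
  · simp
  · rw [← Fin.succAbove_last_apply, insertPerm_succAbove, Equiv.Perm.one_apply]
    -- two order embeddings with the same range agree
    have h1 : StrictMono fun i : Fin n => τ i.castSucc := fun a b hab => by
      exact h.1 _ _ (by simpa using hab) b.2
    have h2 : StrictMono (τ (Fin.last n)).succAbove := Fin.strictMono_succAbove _
    have h3 : Set.range (τ (Fin.last n)).succAbove = Set.range fun i : Fin n => τ i.castSucc := by
      rw [Fin.range_succAbove]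
      ext x
      simp only [Set.mem_compl_iff, Set.mem_singleton_iff, Set.mem_range]
      constructor
      · intro hx
        have hne : τ.symm x ≠ Fin.last n := fun h' => hx (by rw [← h', Equiv.apply_symm_apply])
        exact ⟨(τ.symm x).castPred hne, by simp⟩
      · rintro ⟨y, rfl⟩ h'
        exact (Fin.castSucc_lt_last y).ne (τ.injective h')
    have := congrFun ((StrictMono.range_inj h2 h1).1 h3) i
    simpa using this

theorem pontryagin_one {n : ℕ} (c : (Fin n → G) →₀ k) (x : Fin 1 → G) :
    pontryagin k n 1 c (Finsupp.single x 1) =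
      (-1 : k) ^ n • ∑ j : Fin (n + 1), (-1 : k) ^ (j : ℕ) • insertAt k j (x 0) c := by
  classical
  induction c using Finsupp.induction_linear with
  | zero => simp
  | add f g hf hg =>
    rw [map_add, LinearMap.add_apply, hf, hg, ← smul_add, ← Finset.sum_add_distrib]
    simp only [map_add, smul_add]
  | single g r =>
    have hset : Finset.univ.filter (IsShuffle (n := n + 1) n) =
        Finset.univ.image fun j : Fin (n + 1) => insertPerm j (Fin.last n) 1 := by
      ext τ
      simp [isShuffle_iff_exists_insertPerm_last]
    have hinj : Function.Injective fun j : Fin (n + 1) => insertPerm j (Fin.last n) 1 := by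
      intro i j h
      have := congrArg (fun τ : Equiv.Perm (Fin (n + 1)) => τ (Fin.last n)) h
      simpa using this
    have happ : ∀ j : Fin (n + 1), (fun i => (Fin.append g x : Fin (n + 1) → G)
        ((insertPerm j (Fin.last n) 1).symm i)) = j.insertNth (x 0) g := by
      intro j
      rw [Fin.eq_insertNth_iff]
      constructor
      · have : (insertPerm j (Fin.last n) 1).symm j = Fin.last n := by
          rw [Equiv.symm_apply_eq, insertPerm_self]
        rw [this]
        exact Fin.append_right g x 0
      · funext i
        have : (insertPerm j (Fin.last n) 1).symm (j.succAbove i) = i.castSucc := by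
          rw [Equiv.symm_apply_eq, ← Fin.succAbove_last_apply, insertPerm_succAbove]
          rfl
        simp only [Fin.removeNth, this]
        exact Fin.append_left g x i
    have : pontryagin k n 1 (Finsupp.single g r) (Finsupp.single x 1) =
        r • ∑ σ ∈ Finset.univ.filter (IsShuffle (n := n + 1) n), ((Equiv.Perm.sign σ : ℤ) : k) •
          Finsupp.single (fun i => (Fin.append g x : Fin (n + 1) → G) (σ.symm i)) 1 := by
      unfold pontryagin
      simp only [Finsupp.lsum_single, LinearMap.toSpanSingleton_apply, LinearMap.smul_apply,
        one_smul]
    rw [this, hset, Finset.sum_image fun i _ j _ h => hinj h, Finset.smul_sum, Finset.smul_sum]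
    refine Finset.sum_congr rfl fun j _ => ?_
    rw [happ, sign_insertPerm, insertAt_single]
    simp only [Equiv.Perm.sign_one, mul_one, Fin.val_last, Finsupp.smul_single,
      smul_eq_mul]
    push_cast
    congr 1
    ring

/-- The iterated Pontryagin product of chains of degree `1` is the antisymmetrization: each further
factor is inserted at all positions. -/
theorem pontryaginList_eq_symSum (n : ℕ) (g : Fin n → G) : pontryaginList k n g = symSum k g := by
  induction n with
  | zero =>
    simp only [pontryaginList, symSum, Finset.univ_unique, Finset.sum_singleton]
    simp
  | succ n ih =>
    rw [pontryaginList, pontryagin_one, ih, symSum_succ k (Fin.last n)]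
    simp only [Fin.val_last, Fin.succAbove_last]
    rfl

end Pontryagin

/-! ### Permutation representations -/

section PermRep

variable (k : Type u) (G : Type u) [CommRing k] [Group G]

/-- The action of `G` on `k[X]` for a `G`-set `X`. -/
def permAction (X : Type u) [MulAction G X] : Representation k G (X →₀ k) where
  toFun g := Finsupp.lmapDomain k k fun x => g • x
  map_one' := by
    refine Finsupp.lhom_ext fun x r => ?_
    simp
  map_mul' g h := by
    refine Finsupp.lhom_ext fun x r => ?_
    simp [mul_smul]

@[simp]
theorem permAction_single {X : Type u} [MulAction G X] (g : G) (x : X) (r : k) :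
    permAction k G X g (Finsupp.single x r) = Finsupp.single (g • x) r :=
  Finsupp.mapDomain_single

/-- The permutation representation `k[X]` of a `G`-set `X`. -/
abbrev permRep (X : Type u) [MulAction G X] : Rep.{u} k G := Rep.of (permAction k G X)

variable {G} {X : Type u} (θ : X → G) (x₀ : X)

/-- A contraction of the chains with coefficients in `k[X]` when `G` acts simply transitively on `X`
and `θ x` is the element that moves `x₀` to `x`. -/
def contraction (n : ℕ) :
    ((Fin n → G) →₀ (X →₀ k)) →ₗ[k] ((Fin (n + 1) → G) →₀ (X →₀ k)) :=
  Finsupp.lsum k fun g => Finsupp.lsum k fun x =>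
    Finsupp.lsingle (Fin.cons (θ x)⁻¹ g : Fin (n + 1) → G) ∘ₗ Finsupp.lsingle x₀

@[simp]
theorem contraction_single {n : ℕ} (g : Fin n → G) (x : X) (r : k) :
    contraction k θ x₀ n (Finsupp.single g (Finsupp.single x r)) =
      Finsupp.single (Fin.cons (θ x)⁻¹ g : Fin (n + 1) → G) (Finsupp.single x₀ r) := by
  unfold contraction
  rw [Finsupp.lsum_single]
  erw [Finsupp.lsum_single]
  rfl

variable [MulAction G X]

/-- The differential of the bar complex with coefficients in `k[X]`. -/
def permD (n : ℕ) : ((Fin (n + 1) → G) →₀ (X →₀ k)) →ₗ[k] ((Fin n → G) →₀ (X →₀ k)) :=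
  (groupHomology.inhomogeneousChains.d (permRep k G X) n).hom

theorem permD_single (n : ℕ) (g : Fin (n + 1) → G) (x : X) (r : k) :
    permD k n (Finsupp.single g (Finsupp.single x r)) =
      Finsupp.single (fun i => g i.succ) (Finsupp.single ((g 0)⁻¹ • x) r) +
      ∑ j : Fin (n + 1), (-1 : k) ^ ((j : ℕ) + 1) •
        Finsupp.single (Fin.contractNth j (· * ·) g) (Finsupp.single x r) := by
  rw [← permAction_single]
  exact groupHomology.inhomogeneousChains.d_single (A := permRep k G X) n g (Finsupp.single x r)

theorem represents_permD {n : ℕ} (w : (Fin (n + 1) → G) →₀ (X →₀ k)) :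
    Represents (groupHomology.inhomogeneousChains (permRep k G X)) n (permD k n w) 0 := by
  have h2 := represents_d (K := groupHomology.inhomogeneousChains (permRep k G X)) w
  rw [groupHomology.inhomogeneousChains.d_def] at h2
  exact h2

variable {θ x₀}

/-- The cancellation in `d_contraction_add`, where `a` is the face that gives back the chain, `b`
the face that multiplies the new entry and `c` are the remaining faces. -/
theorem cancel_alternating {M : Type*} [AddCommGroup M] [Module k M] {n : ℕ} (a b : M)
    (c : Fin n → M) :
    a + ((-1 : k) ^ (((0 : Fin (n + 1)) : ℕ) + 1) • b +
        ∑ i : Fin n, (-1 : k) ^ ((i.succ : ℕ) + 1) • c i) +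
      (b + ∑ i : Fin n, (-1 : k) ^ ((i : ℕ) + 1) • c i) = a := by
  simp only [Fin.val_zero, zero_add, pow_one, neg_smul, one_smul, Fin.val_succ,
    pow_succ _ (_ + 1), mul_neg, mul_one, Finset.sum_neg_distrib]
  abel

theorem add_neg_one_smul_add {M : Type*} [AddCommGroup M] [Module k M] (a b : M) :
    a + (-1 : k) ^ (((0 : Fin 1) : ℕ) + 1) • b + b = a := by
  simp

theorem d_contraction_add (hθ : ∀ (g : G) x, θ (g • x) = g * θ x) (hx₀ : ∀ x, θ x • x₀ = x) (n : ℕ)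
    (c : (Fin (n + 1) → G) →₀ (X →₀ k)) :
    permD k (n + 1)
        (contraction k θ x₀ (n + 1) c) +
      contraction k θ x₀ n (permD k n c) = c := by
  induction c using Finsupp.induction_linear with
  | zero => simp
  | add f g hf hg =>
    simp only [map_add]
    rw [add_add_add_comm, hf, hg]
  | single g a =>
  induction a using Finsupp.induction_linear with
  | zero => simp
  | add f g hf hg =>
    simp only [map_add, Finsupp.single_add]
    rw [add_add_add_comm, hf, hg]
  | single x r =>
  rw [contraction_single, permD_single, permD_single, Fin.sum_univ_succ, contractNth_zero_cons]
  simp only [contractNth_succ_cons, map_add, map_sum, map_smul,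
    contraction_single, hθ, Fin.cons_zero, Fin.cons_succ, inv_inv, hx₀]
  have e : (Fin.cons ((g 0)⁻¹ * θ x)⁻¹ fun i => g i.succ : Fin (n + 1) → G) =
      (Fin.cons ((θ x)⁻¹ * g 0) (Fin.tail g) : Fin (n + 1) → G) := by
    rw [mul_inv_rev, inv_inv]; rfl
  rw [e]
  exact cancel_alternating k (M := (Fin (n + 1) → G) →₀ (X →₀ k)) _ _ _

theorem d_contraction_zero (hx₀ : ∀ x, θ x • x₀ = x) (c : (Fin 0 → G) →₀ (X →₀ k)) :
    ∃ r : k, permD k 0 (contraction k θ x₀ 0 c) +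
      Finsupp.single Fin.elim0 (Finsupp.single x₀ r) = c := by
  induction c using Finsupp.induction_linear with
  | zero => exact ⟨0, by simp⟩
  | add f g hf hg =>
    obtain ⟨r, hr⟩ := hf
    obtain ⟨s, hs⟩ := hg
    refine ⟨r + s, ?_⟩
    rw [map_add, map_add, Finsupp.single_add, Finsupp.single_add, add_add_add_comm, hr, hs]
  | single g a =>
  induction a using Finsupp.induction_linear with
  | zero => exact ⟨0, by simp⟩
  | add f h hf hh =>
    obtain ⟨r, hr⟩ := hf
    obtain ⟨s, hs⟩ := hh
    refine ⟨r + s, ?_⟩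
    rw [Finsupp.single_add g, map_add, map_add, Finsupp.single_add, Finsupp.single_add,
      add_add_add_comm, hr, hs]
  | single x r =>
  refine ⟨r, ?_⟩
  obtain rfl : g = Fin.elim0 := Subsingleton.elim _ _
  have e : ∀ y : Fin 0 → G, y = Fin.elim0 := fun y => Subsingleton.elim _ _
  rw [contraction_single, permD_single, Fin.sum_univ_one]
  simp only [Fin.cons_zero, inv_inv, hx₀, e]
  exact add_neg_one_smul_add k (M := (Fin 0 → G) →₀ (X →₀ k)) _ _

theorem homology_permRep_eq_zero (hθ : ∀ (g : G) x, θ (g • x) = g * θ x)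
    (hx₀ : ∀ x, θ x • x₀ = x) (n : ℕ) (h : groupHomology (permRep k G X) (n + 1)) : h = 0 := by
  obtain ⟨c, hc⟩ := exists_represents (K := groupHomology.inhomogeneousChains (permRep k G X)) h
  have hd := hc.d_eq_zero n
  rw [groupHomology.inhomogeneousChains.d_def] at hd
  have := d_contraction_add k hθ hx₀ n c
  have hd' : permD k n c = 0 := hd
  rw [hd', map_zero, add_zero] at this
  refine hc.unique ?_
  rw [← this]
  exact represents_permD k _

/-- In degree `0` the contraction identifies all points of `X`, up to boundaries. -/
theorem exists_generator_homology_permRep_zero (hx₀ : ∀ x, θ x • x₀ = x) :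
    ∃ v : groupHomology (permRep k G X) 0, ∀ h, ∃ r : k, r • v = h := by
  let K := groupHomology.inhomogeneousChains (permRep k G X)
  have hr : ∀ r : k, ∃ v : K.homology 0, Represents K 0
      (Finsupp.single Fin.elim0 (Finsupp.single x₀ r) : (Fin 0 → G) →₀ (X →₀ k)) v :=
    fun r => exists_represents_of_d_eq_zero (K := K) (n := 0) (by
      rw [HomologicalComplex.shape _ _ _ (by simp)]
      rfl)
  obtain ⟨v, hv⟩ := hr 1
  refine ⟨v, fun h => ?_⟩
  obtain ⟨c, hc⟩ := exists_represents (K := K) h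
  obtain ⟨r, hr⟩ := d_contraction_zero k hx₀ c
  have h3 := (represents_permD k (contraction k θ x₀ 0 c)).add (hv.smul r)
  have e : r • (Finsupp.single Fin.elim0 (Finsupp.single x₀ 1) : (Fin 0 → G) →₀ (X →₀ k)) =
      Finsupp.single Fin.elim0 (Finsupp.single x₀ r) := by simp
  have e1 : permD k 0 (contraction k θ x₀ 0 c) +
      r • (Finsupp.single Fin.elim0 (Finsupp.single x₀ 1) : (Fin 0 → G) →₀ (X →₀ k)) = c := by
    rw [e, hr]
  have e2 : 0 + r • v = r • v := zero_add _
  have h4 : Represents K 0 c (r • v) := by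
    rw [← e1, ← e2]
    exact h3
  exact ⟨r, h4.unique hc⟩

variable {Y : Type u} [MulAction G Y]

/-- A morphism of representations `k[X] → k[Y]` is given by an equivariant map `X → k[Y]`. -/
def permHom (f : X → (Y →₀ k)) (hf : ∀ (g : G) x, f (g • x) = permAction k G Y g (f x)) :
    permRep k G X ⟶ permRep k G Y :=
  Rep.ofHom ⟨Finsupp.linearCombination k f, fun g => by
    refine Finsupp.lhom_ext fun x r => ?_
    simp [hf]⟩

@[simp]
theorem permHom_single (f : X → (Y →₀ k)) (hf : ∀ (g : G) x, f (g • x) = permAction k G Y g (f x))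
    (x : X) (r : k) : (permHom k f hf).hom (Finsupp.single x r) = r • f x :=
  Finsupp.linearCombination_single k r x

end PermRep

/-! ### A bound for the dimension of group homology -/

section Bound

variable {k : Type u} {G : Type u} [Field k]

/-- The `n`-th homology with coefficients in `A` has dimension at most `r.choose n`. -/
def HomologyBound [Group G] (A : Rep.{u} k G) (r : ℕ) : Prop :=
  ∀ n, Module.Finite k (groupHomology A n) ∧ Module.finrank k (groupHomology A n) ≤ r.choose n

theorem HomologyBound.of_surjective [Group G] {A B : Rep.{u} k G} {r : ℕ} (h : HomologyBound A r)
    (f : ∀ n, groupHomology A n →ₗ[k] groupHomology B n)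
    (hf : ∀ n, Function.Surjective (f n)) : HomologyBound B r := fun n => by
  have := (h n).1
  exact ⟨Module.Finite.of_surjective (f n) (hf n),
    (LinearMap.finrank_le_finrank_of_surjective (hf n)).trans (h n).2⟩

theorem HomologyBound.of_retract [Group G] {A B : Rep.{u} k G} {r : ℕ} (h : HomologyBound A r)
    (s : B ⟶ A) (p : A ⟶ B) (hs : s ≫ p = 𝟙 B) : HomologyBound B r := by
  refine h.of_surjective (fun n => (groupHomology.map (MonoidHom.id G) p n).hom) fun n y => ?_
  refine ⟨(groupHomology.map (MonoidHom.id G) s n).hom y, ?_⟩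
  rw [← ModuleCat.comp_apply, ← groupHomology.map_id_comp, hs, groupHomology.map_id]
  rfl

theorem finite_and_finrank_le_of_exact {V₁ V₂ V₃ : Type*} [AddCommGroup V₁] [AddCommGroup V₂]
    [AddCommGroup V₃] [Module k V₁] [Module k V₂] [Module k V₃] [Module.Finite k V₁]
    [Module.Finite k V₃] (f : V₁ →ₗ[k] V₂) (g : V₂ →ₗ[k] V₃)
    (h : LinearMap.range f = LinearMap.ker g) :
    Module.Finite k V₂ ∧ Module.finrank k V₂ ≤ Module.finrank k V₁ + Module.finrank k V₃ := by
  have h1 : Module.Finite k (LinearMap.ker g) := h ▸ inferInstance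
  have h2 : Module.Finite k (V₂ ⧸ LinearMap.ker g) :=
    Module.Finite.equiv g.quotKerEquivRange.symm
  have h3 : Module.Finite k V₂ := Module.Finite.of_submodule_quotient (LinearMap.ker g)
  refine ⟨h3, ?_⟩
  rw [← LinearMap.finrank_range_add_finrank_ker g, ← h, add_comm]
  exact add_le_add (LinearMap.finrank_range_le f) (Submodule.finrank_le _)

/-- If the first two terms of a short exact sequence satisfy the bound for `r`, the third one
satisfies it for `r + 1`: by the long exact sequence its dimension in degree `n + 1` is at most
`r.choose (n + 1) + r.choose n`. -/
theorem HomologyBound.of_shortExact [Group G] {X : ShortComplex (Rep.{u} k G)} (hX : X.ShortExact)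
    {r : ℕ} (h1 : HomologyBound X.X₁ r) (h2 : HomologyBound X.X₂ r) :
    HomologyBound X.X₃ (r + 1) := by
  intro n
  cases n with
  | zero =>
    have := hX.epi_g
    have hs := (ModuleCat.epi_iff_surjective (groupHomology.map (MonoidHom.id G) X.g 0)).1
      inferInstance
    have := (h2 0).1
    refine ⟨Module.Finite.of_surjective _ hs, ?_⟩
    have := (LinearMap.finrank_le_finrank_of_surjective hs).trans (h2 0).2
    simpa using this
  | succ n =>
    have hex := (groupHomology.mapShortComplex₃_exact hX
      (rfl : n + 1 = n + 1)).moduleCat_range_eq_ker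
    have i1 := (h2 (n + 1)).1
    have i3 := (h1 n).1
    obtain ⟨hf, hle⟩ := @finite_and_finrank_le_of_exact k _ (groupHomology X.X₂ (n + 1))
      (groupHomology X.X₃ (n + 1)) (groupHomology X.X₁ n) _ _ _ _ _ _ i1 i3 _ _ hex
    refine ⟨hf, hle.trans ?_⟩
    rw [Nat.choose_succ_succ, add_comm (r.choose n)]
    exact add_le_add (h2 (n + 1)).2 (h1 n).2

theorem shortExact_of_range_eq_ker [Group G] {A B C : Rep.{u} k G} (f : A ⟶ B) (g : B ⟶ C)
    (hf : Function.Injective f.hom) (hg : Function.Surjective g.hom)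
    (h : LinearMap.range f.hom.toLinearMap = LinearMap.ker g.hom.toLinearMap) :
    ∃ w : f ≫ g = 0, (ShortComplex.mk f g w).ShortExact := by
  have w : f ≫ g = 0 := by
    ext x
    have : f.hom x ∈ LinearMap.ker g.hom.toLinearMap := h ▸ ⟨x, rfl⟩
    exact this
  refine ⟨w, ?_⟩
  have h1 : (ShortComplex.mk f g w).Exact := by
    rw [← ShortComplex.exact_map_iff_of_faithful _ (forget₂ (Rep.{u} k G) (ModuleCat.{u} k)),
      ShortComplex.moduleCat_exact_iff_range_eq_ker]
    exact h
  exact { exact := h1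
          mono_f := (Rep.mono_iff_injective f).2 hf
          epi_g := (Rep.epi_iff_surjective g).2 hg }

/-- The regular representation is acyclic, with one-dimensional coinvariants. -/
theorem homologyBound_bot [CommGroup G] : HomologyBound (permRep k G (G ⧸ (⊥ : Subgroup G))) 0 := by
  let e : G ⧸ (⊥ : Subgroup G) ≃* G := QuotientGroup.quotientBot
  have he : ∀ g : G, e (QuotientGroup.mk g) = g := fun g => rfl
  have hθ : ∀ (g : G) (x : G ⧸ (⊥ : Subgroup G)), e (g • x) = g * e x := by
    intro g x
    induction x using QuotientGroup.induction_on
    rfl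
  have hx : ∀ x : G ⧸ (⊥ : Subgroup G), e x • (QuotientGroup.mk 1 : G ⧸ (⊥ : Subgroup G)) = x := by
    intro x
    apply e.injective
    rw [hθ, he, mul_one]
  intro n
  cases n with
  | zero =>
    obtain ⟨v, hv⟩ := exists_generator_homology_permRep_zero k hx
    refine ⟨?_, by simpa using finrank_le_one v hv⟩
    refine Module.Finite.of_surjective (LinearMap.toSpanSingleton k _ v) fun h => ?_
    obtain ⟨r, hr⟩ := hv h
    exact ⟨r, hr⟩
  | succ n =>
    have : Subsingleton (groupHomology (permRep k G (G ⧸ (⊥ : Subgroup G))) (n + 1)) :=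
      ⟨fun a b => by
        rw [homology_permRep_eq_zero k hθ hx n a, homology_permRep_eq_zero k hθ hx n b]⟩
    exact ⟨inferInstance, by simp [Module.finrank_zero_of_subsingleton]⟩

variable [CommGroup G] {S S' : Subgroup G} {t : G}

/-- The projection `k[G/S] → k[G/S']` for `S ≤ S'`. -/
def permProj (k : Type u) [Field k] (h : S ≤ S') : permRep k G (G ⧸ S) ⟶ permRep k G (G ⧸ S') :=
  permHom k (fun x => Finsupp.single (Subgroup.quotientMapOfLE h x) 1) fun g x => by
    induction x using QuotientGroup.induction_on
    rw [permAction_single]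
    rfl

theorem permProj_single (h : S ≤ S') (y : G) (r : k) :
    (permProj k h).hom (Finsupp.single (QuotientGroup.mk y) r) =
      Finsupp.single (QuotientGroup.mk y) r := by
  unfold permProj
  rw [permHom_single, Finsupp.smul_single, smul_eq_mul, mul_one]
  rfl

/-- A function on `G` that is invariant under `S` and `t` is invariant under the subgroup that they
generate. -/
theorem mul_right_invariant {α : Type*} (F : G → α)
    (hgen : ∀ P : Subgroup G, S ≤ P → t ∈ P → S' ≤ P) (hS : ∀ y, ∀ s ∈ S, F (y * s) = F y)
    (ht : ∀ y, F (y * t) = F y) (y s : G) (hs : s ∈ S') : F (y * s) = F y := by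
  let P : Subgroup G :=
    { carrier := {s | ∀ y, F (y * s) = F y}
      one_mem' := fun y => by rw [mul_one]
      mul_mem' := fun {a b} ha hb y => by rw [← mul_assoc, hb, ha]
      inv_mem' := fun {a} ha y => by
        have := ha (y * a⁻¹)
        rw [inv_mul_cancel_right] at this
        exact this.symm }
  exact hgen P (fun s hs y => hS y s hs) ht hs y

/-- Let `S'` be generated by `S` and `t`. If a power `t ^ m` lies in `S`, averaging over the powers
of `t` splits the projection `k[G/S] → k[G/S']`. -/
theorem HomologyBound.of_pow_mem [CharZero k] {r : ℕ}
    (h : HomologyBound (permRep k G (G ⧸ S)) r) (hSS' : S ≤ S')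
    (hgen : ∀ P : Subgroup G, S ≤ P → t ∈ P → S' ≤ P) (htS' : t ∈ S') {m : ℕ} (hm : m ≠ 0)
    (htm : t ^ m ∈ S) : HomologyBound (permRep k G (G ⧸ S')) r := by
  let F : G → (G ⧸ S →₀ k) := fun y =>
    ∑ i ∈ Finset.range m, Finsupp.single (QuotientGroup.mk (y * t ^ i)) ((m : k)⁻¹)
  have hF : ∀ y s : G, s ∈ S' → F (y * s) = F y := by
    refine mul_right_invariant F hgen ?_ ?_
    · intro y s hs
      refine Finset.sum_congr rfl fun i _ => ?_
      congr 1
      rw [mul_right_comm]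
      exact (QuotientGroup.mk_mul_of_mem _ hs)
    · intro y
      have h1 : F (y * t) = ∑ i ∈ Finset.range m,
          Finsupp.single (QuotientGroup.mk (y * t ^ (i + 1)) : G ⧸ S) ((m : k)⁻¹) := by
        refine Finset.sum_congr rfl fun i _ => ?_
        rw [mul_assoc, ← pow_succ']
      have h2 := Finset.sum_range_succ
        (fun i => Finsupp.single (QuotientGroup.mk (y * t ^ i) : G ⧸ S) ((m : k)⁻¹)) m
      rw [Finset.sum_range_succ'] at h2
      have h3 : (QuotientGroup.mk (y * t ^ m) : G ⧸ S) = QuotientGroup.mk (y * t ^ 0) := by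
        rw [pow_zero, mul_one]
        exact QuotientGroup.mk_mul_of_mem _ htm
      rw [h3] at h2
      rw [h1]
      exact add_right_cancel h2
  let F' : G ⧸ S' → (G ⧸ S →₀ k) := fun x => Quotient.liftOn' x F fun a b hab => by
    have := hF a (a⁻¹ * b) (QuotientGroup.leftRel_apply.1 hab)
    rw [mul_inv_cancel_left] at this
    exact this.symm
  have hF' : ∀ (g : G) (x : G ⧸ S'), F' (g • x) = permAction k G (G ⧸ S) g (F' x) := by
    intro g x
    induction x using QuotientGroup.induction_on with
    | H y =>
    change F (g * y) = permAction k G (G ⧸ S) g (F y)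
    simp only [F, map_sum, permAction_single, mul_assoc]
    rfl
  refine h.of_retract (permHom k F' hF') (permProj k hSS') ?_
  refine Rep.hom_ext (DFunLike.ext _ _ fun x => ?_)
  change (permProj k hSS').hom ((permHom k F' hF').hom x) = x
  induction (show G ⧸ S' →₀ k from x) using Finsupp.induction_linear with
  | zero => rw [map_zero, map_zero]
  | add a b ha hb => rw [map_add, map_add, ha, hb]
  | single x c =>
  induction x using QuotientGroup.induction_on with
  | H y =>
  rw [permHom_single]
  change (permProj k hSS').hom (c • F y) = _
  have h1 : ∀ i, (QuotientGroup.mk (y * t ^ i) : G ⧸ S') = QuotientGroup.mk y := fun i =>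
    QuotientGroup.mk_mul_of_mem _ (pow_mem htS' i)
  have hm' : (m : k) ≠ 0 := Nat.cast_ne_zero.2 hm
  have h2 : (permProj k hSS').hom (F y) = Finsupp.single (QuotientGroup.mk y) 1 := by
    have h3 : ∀ i ∈ Finset.range m, (permProj k hSS').hom (Finsupp.single
        (QuotientGroup.mk (y * t ^ i)) (m : k)⁻¹) =
          Finsupp.single (QuotientGroup.mk y) (m : k)⁻¹ := fun i _ =>
      (permProj_single hSS' _ _).trans (by rw [h1])
    refine (map_sum _ _ _).trans ((Finset.sum_congr rfl h3).trans ?_)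
    rw [Finset.sum_const, Finset.card_range, ← Nat.cast_smul_eq_nsmul k]
    refine (Finsupp.smul_single _ _ _).trans ?_
    rw [smul_eq_mul, mul_inv_cancel₀ hm']
  refine (map_smul _ _ _).trans ?_
  rw [h2]
  refine (Finsupp.smul_single _ _ _).trans ?_
  rw [smul_eq_mul, mul_one]

/-- Let `S'` be generated by `S` and `t`. If `t` has infinite order modulo `S`, the projection
`k[G/S] → k[G/S']` is the cokernel of the injective map `t - 1`. -/
theorem HomologyBound.of_forall_pow_notMem {r : ℕ}
    (h : HomologyBound (permRep k G (G ⧸ S)) r) (hSS' : S ≤ S')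
    (hgen : ∀ P : Subgroup G, S ≤ P → t ∈ P → S' ≤ P) (htS' : t ∈ S')
    (ht : ∀ m : ℕ, m ≠ 0 → t ^ m ∉ S) : HomologyBound (permRep k G (G ⧸ S')) (r + 1) := by
  let f : permRep k G (G ⧸ S) ⟶ permRep k G (G ⧸ S) :=
    permHom k (fun x => Finsupp.single (t • x) 1 - Finsupp.single x 1) fun g x => by
      rw [map_sub, permAction_single, permAction_single, smul_comm]
  have hf : ∀ c : G ⧸ S →₀ k, f.hom c = Finsupp.mapDomain (t • ·) c - c := by
    intro c
    induction c using Finsupp.induction_linear with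
    | zero => rw [map_zero, Finsupp.mapDomain_zero, sub_zero]
    | add a b ha hb => rw [map_add, ha, hb, Finsupp.mapDomain_add]; abel
    | single x a =>
      refine (permHom_single _ _ _ x a).trans ?_
      rw [smul_sub, Finsupp.mapDomain_single, Finsupp.smul_single, Finsupp.smul_single, smul_eq_mul,
        mul_one]
  have hinj : Function.Injective f.hom := by
    refine (injective_iff_map_eq_zero _).2 fun c hc => ?_
    have hc' : Finsupp.mapDomain (t • ·) (show G ⧸ S →₀ k from c) = c :=
      sub_eq_zero.1 ((hf c).symm.trans hc)
    have h1 : ∀ x, (show G ⧸ S →₀ k from c) (t • x) = (show G ⧸ S →₀ k from c) x := fun x => by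
      conv_lhs => rw [← hc']
      exact Finsupp.mapDomain_apply (MulAction.injective t) _ x
    have h2 : ∀ (n : ℕ) x,
        (show G ⧸ S →₀ k from c) (t ^ n • x) = (show G ⧸ S →₀ k from c) x := fun n x => by
      induction n with
      | zero => simp
      | succ n ih => rw [pow_succ', mul_smul, h1, ih]
    refine Finsupp.ext (f := (show G ⧸ S →₀ k from c)) (g := 0) fun x => ?_
    by_contra hx
    -- the orbit of a point in the support would be infinite
    have h3 : Function.Injective fun n : ℕ => t ^ n • x := by
      refine Function.Injective.of_lt_imp_ne fun a b hab heq => ?_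
      induction x using QuotientGroup.induction_on with
      | H y =>
      have h4 := QuotientGroup.eq.1 (show (QuotientGroup.mk (t ^ a * y) : G ⧸ S) =
        QuotientGroup.mk (t ^ b * y) from heq)
      obtain ⟨d, rfl⟩ := Nat.exists_eq_add_of_lt hab
      refine ht (d + 1) (Nat.succ_ne_zero d) ?_
      convert h4 using 1
      rw [eq_inv_mul_iff_mul_eq, add_assoc, pow_add t a, mul_assoc, mul_assoc, mul_comm y]
    refine Set.infinite_range_of_injective h3
      ((show G ⧸ S →₀ k from c).support.finite_toSet.subset ?_)
    rintro _ ⟨n, rfl⟩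
    simpa [h2] using hx
  have hproj : ∀ c : G ⧸ S →₀ k, (permProj k hSS').hom c =
      Finsupp.mapDomain (Subgroup.quotientMapOfLE hSS') c := by
    intro c
    induction c using Finsupp.induction_linear with
    | zero => rw [map_zero, Finsupp.mapDomain_zero]
    | add a b ha hb => rw [map_add, ha, hb, Finsupp.mapDomain_add]
    | single x a =>
      refine (permHom_single _ _ _ x a).trans ?_
      rw [Finsupp.mapDomain_single, Finsupp.smul_single, smul_eq_mul, mul_one]
  have hquot : Function.Surjective (Subgroup.quotientMapOfLE hSS') := by
    intro x
    induction x using QuotientGroup.induction_on with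
    | H y => exact ⟨QuotientGroup.mk y, rfl⟩
  have hsurj : Function.Surjective (permProj k hSS').hom := by
    intro c
    obtain ⟨c', hc'⟩ := Finsupp.mapDomain_surjective hquot (show G ⧸ S' →₀ k from c)
    exact ⟨c', (hproj c').trans hc'⟩
  have hexact : LinearMap.range f.hom.toLinearMap =
      LinearMap.ker (permProj k hSS').hom.toLinearMap := by
    refine le_antisymm ?_ ?_
    · rintro _ ⟨c, rfl⟩
      refine LinearMap.mem_ker.2 ?_
      change (permProj k hSS').hom (f.hom c) = 0
      rw [hf, map_sub, hproj, hproj, ← Finsupp.mapDomain_comp]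
      refine sub_eq_zero.2 (congrArg (fun u => Finsupp.mapDomain u _) (funext fun x => ?_))
      induction x using QuotientGroup.induction_on with
      | H y =>
      change (QuotientGroup.mk (t * y) : G ⧸ S') = QuotientGroup.mk y
      rw [mul_comm]
      exact QuotientGroup.mk_mul_of_mem _ htS'
    · intro c hc
      -- modulo the image of `t - 1`, a coset of `S` depends only on the coset of `S'`, so the
      -- quotient map factors through `k[G/S']`
      let σ : G ⧸ S' → G ⧸ S := Function.surjInv hquot
      let Q : (G ⧸ S →₀ k) →ₗ[k] (G ⧸ S →₀ k) ⧸ LinearMap.range f.hom.toLinearMap :=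
        Submodule.mkQ _
      have hQt : ∀ y : G, Q (Finsupp.single (QuotientGroup.mk (y * t)) 1) =
          Q (Finsupp.single (QuotientGroup.mk y) 1) := by
        intro y
        refine (Submodule.Quotient.eq _).2 ⟨Finsupp.single (QuotientGroup.mk y) 1, ?_⟩
        refine (hf _).trans ?_
        rw [Finsupp.mapDomain_single, mul_comm]
        rfl
      have hQS' := mul_right_invariant (S := S) (t := t) (S' := S')
        (fun y : G => Q (Finsupp.single (QuotientGroup.mk y) 1)) hgen
        (fun y s hs => by rw [QuotientGroup.mk_mul_of_mem _ hs]) hQt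
      have hQ : Q = Q ∘ₗ Finsupp.lmapDomain k k σ ∘ₗ
          Finsupp.lmapDomain k k (Subgroup.quotientMapOfLE hSS') := by
        refine Finsupp.lhom_ext' fun x => LinearMap.ext_ring ?_
        simp only [LinearMap.comp_apply, Finsupp.lsingle_apply, Finsupp.lmapDomain_apply,
          Finsupp.mapDomain_single]
        have h5 := Function.surjInv_eq hquot (Subgroup.quotientMapOfLE hSS' x)
        change Subgroup.quotientMapOfLE hSS' (σ _) = _ at h5
        generalize σ (Subgroup.quotientMapOfLE hSS' x) = z at h5 ⊢
        induction x using QuotientGroup.induction_on with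
        | H y =>
        induction z using QuotientGroup.induction_on with
        | H z =>
        have h6 := QuotientGroup.eq.1 (show (QuotientGroup.mk z : G ⧸ S') = QuotientGroup.mk y
          from h5)
        have := hQS' z _ h6
        rwa [mul_inv_cancel_left] at this
      have hc' : Finsupp.mapDomain (Subgroup.quotientMapOfLE hSS') (show G ⧸ S →₀ k from c) = 0 :=
        (hproj c).symm.trans hc
      have : Q c = 0 := by
        rw [hQ]
        simp only [LinearMap.comp_apply, Finsupp.lmapDomain_apply]
        erw [hc']
        simp
      exact (Submodule.Quotient.mk_eq_zero _).1 this
  obtain ⟨w, hw⟩ := shortExact_of_range_eq_ker f (permProj k hSS') hinj hsurj hexact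
  exact HomologyBound.of_shortExact hw h h

end Bound

section TrivialBound

variable {k : Type u} {G : Type u} [Field k] [CommGroup G]

theorem homologyBound_trivial {S : Subgroup G} (hS : S = ⊤) {r : ℕ}
    (h : HomologyBound (permRep k G (G ⧸ S)) r) : HomologyBound (Rep.trivial k G k) r := by
  have hmk : ∀ g : G, (QuotientGroup.mk g : G ⧸ S) = QuotientGroup.mk 1 := fun g =>
    QuotientGroup.eq.2 (hS ▸ Subgroup.mem_top _)
  let s : Rep.trivial k G k ⟶ permRep k G (G ⧸ S) :=
    Rep.ofHom ⟨Finsupp.lsingle (QuotientGroup.mk 1), fun g => LinearMap.ext_ring <| by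
      refine ((permAction_single k G g (QuotientGroup.mk 1 : G ⧸ S) 1).trans ?_).symm
      exact congrArg (fun x => Finsupp.single x (1 : k)) (hmk (g * 1))⟩
  let p : permRep k G (G ⧸ S) ⟶ Rep.trivial k G k :=
    Rep.ofHom ⟨Finsupp.linearCombination k fun _ => 1, fun g =>
      Finsupp.lhom_ext fun x a => by simp⟩
  refine h.of_retract s p (Rep.hom_ext (DFunLike.ext _ _ fun x => ?_))
  change Finsupp.linearCombination k (fun _ => (1 : k)) (Finsupp.single _ x) = x
  simp

variable [CharZero k]

/-- Adding the generators of `S` one at a time, the bound goes up only for those that have infinite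
order modulo the preceding ones, and these are independent. -/
theorem exists_linearIndependent_homologyBound (T : Finset G) :
    ∃ (r : ℕ) (v : Fin r → Additive G), LinearIndependent ℤ v ∧
      (∀ i, (v i).toMul ∈ Subgroup.closure (T : Set G)) ∧
      HomologyBound (permRep k G (G ⧸ Subgroup.closure (T : Set G))) r := by
  classical
  induction T using Finset.induction_on with
  | empty =>
    refine ⟨0, Fin.elim0, linearIndependent_empty_type, fun i => i.elim0, ?_⟩
    rw [Finset.coe_empty, Subgroup.closure_empty]
    exact homologyBound_bot
  | insert t T _ ih =>
    obtain ⟨r, v, hv, hvT, hb⟩ := ih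
    have hTT' : Subgroup.closure (T : Set G) ≤ Subgroup.closure ((insert t T : Finset G) : Set G) :=
      Subgroup.closure_mono (by simp)
    have ht : t ∈ Subgroup.closure ((insert t T : Finset G) : Set G) :=
      Subgroup.subset_closure (by simp)
    have hgen : ∀ P : Subgroup G, Subgroup.closure (T : Set G) ≤ P → t ∈ P →
        Subgroup.closure ((insert t T : Finset G) : Set G) ≤ P := fun P hP htP => by
      rw [Finset.coe_insert, Subgroup.closure_le, Set.insert_subset_iff]
      exact ⟨htP, (Subgroup.closure_le _).1 hP⟩
    by_cases h : ∃ m : ℕ, m ≠ 0 ∧ t ^ m ∈ Subgroup.closure (T : Set G)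
    · obtain ⟨m, hm, htm⟩ := h
      exact ⟨r, v, hv, fun i => hTT' (hvT i), hb.of_pow_mem hTT' hgen ht hm htm⟩
    · push Not at h
      refine ⟨r + 1, Fin.cons (Additive.ofMul t) v, ?_, ?_,
        hb.of_forall_pow_notMem hTT' hgen ht h⟩
      · refine LinearIndependent.finCons' _ _ hv fun c y hy hcy => ?_
        have h1 : Submodule.span ℤ (Set.range v) ≤
            AddSubgroup.toIntSubmodule (Subgroup.closure (T : Set G)).toAddSubgroup := by
          rw [Submodule.span_le]
          rintro _ ⟨i, rfl⟩
          exact hvT i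
        have h2 : y.toMul ∈ Subgroup.closure (T : Set G) := h1 hy
        have h3 : t ^ c ∈ Subgroup.closure (T : Set G) := by
          have h4 : t ^ c * y.toMul = 1 := hcy
          rw [eq_inv_of_mul_eq_one_left h4]
          exact inv_mem h2
        by_contra hc
        obtain ⟨m, rfl | rfl⟩ := c.eq_nat_or_neg
        · exact h m (by simpa using hc) (by simpa using h3)
        · exact h m (by simpa using hc) (by simpa using h3)
      · intro i
        refine Fin.cases ht (fun i => ?_) i
        exact hTT' (hvT i)

/-- The rational homology of a finitely generated abelian group is not larger than the exterior
algebra. -/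
theorem finite_and_finrank_groupHomology_le [hG : Group.FG G] (n : ℕ) :
    Module.Finite k (groupHomology (Rep.trivial k G k) n) ∧
      Module.finrank k (groupHomology (Rep.trivial k G k) n) ≤
        (Module.finrank k (k ⊗[ℤ] Additive G)).choose n := by
  obtain ⟨T, hT⟩ := Group.fg_def.1 hG
  obtain ⟨r, v, hv, -, hb⟩ := exists_linearIndependent_homologyBound (k := k) T
  have hle : r ≤ Module.finrank k (k ⊗[ℤ] Additive G) := by
    have : Module.Finite ℤ (Additive G) :=
      Module.Finite.iff_addGroup_fg.2 (GroupFG.iff_add_fg.1 hG)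
    have := (Module.Flat.linearIndependent_one_tmul (S := k) hv).fintype_card_le_finrank
    simpa using this
  have h := homologyBound_trivial hT hb n
  exact ⟨h.1, h.2.trans (Nat.choose_le_choose n hle)⟩

end TrivialBound

/-! ### The comparison with the exterior powers -/

section Desc

variable {k : Type u} [CommRing k] (K : ChainComplex (ModuleCat.{u} k) ℕ) (n : ℕ)
  {M : Type u} [AddCommGroup M] [Module k M]

/-- The map from homology that a linear map vanishing on the boundaries induces. -/
def homologyDesc (f : K.X n →ₗ[k] M) (hf : ∀ w, f ((K.d (n + 1) n).hom w) = 0) :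
    K.homology n →ₗ[k] M :=
  (K.homologyι n ≫ K.descOpcycles (ModuleCat.ofHom f) (n + 1) (ChainComplex.prev ℕ n)
    (ModuleCat.hom_ext (LinearMap.ext hf))).hom

variable {K n}

theorem Represents.homologyDesc {f : K.X n →ₗ[k] M} {hf : ∀ w, f ((K.d (n + 1) n).hom w) = 0}
    {c : K.X n} {h : K.homology n} (H : Represents K n c h) : homologyDesc K n f hf h = f c := by
  obtain ⟨z, rfl, rfl⟩ := H
  unfold RackHomology.homologyDesc
  rw [← ModuleCat.comp_apply, K.homology_π_ι_assoc, K.p_descOpcycles, ModuleCat.comp_apply]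
  rfl

end Desc

theorem units_smul_eq_cast_smul (k : Type*) [CommRing k] {M : Type*} [AddCommGroup M]
    [Module k M] (s : ℤˣ) (x : M) : s • x = ((s : ℤ) : k) • x := by
  rw [Units.smul_def, Int.cast_smul_eq_zsmul]

section Wedge

variable (k : Type u) {G : Type u} [Field k] [CommGroup G]

/-- The element `(g₁ ⊗ 1) ∧ ⋯ ∧ (gₙ ⊗ 1)` of `Λⁿ(G ⊗ k)`. -/
def wedge {n : ℕ} (g : Fin n → G) : ⋀[k]^n (k ⊗[ℤ] Additive G) :=
  exteriorPower.ιMulti k n fun i => (1 : k) ⊗ₜ[ℤ] Additive.ofMul (g i)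

theorem wedge_insertNth_mul {n : ℕ} (j : Fin (n + 1)) (a b : G) (x : Fin n → G) :
    wedge k (j.insertNth (a * b) x : Fin (n + 1) → G) =
      wedge k (j.insertNth a x : Fin (n + 1) → G) +
        wedge k (j.insertNth b x : Fin (n + 1) → G) := by
  have h : ∀ c : G, (fun i => (1 : k) ⊗ₜ[ℤ] Additive.ofMul
      ((j.insertNth c x : Fin (n + 1) → G) i)) = Function.update (fun i => (1 : k) ⊗ₜ[ℤ]
        Additive.ofMul ((j.insertNth 1 x : Fin (n + 1) → G) i)) j
          ((1 : k) ⊗ₜ[ℤ] Additive.ofMul c) := by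
    intro c
    funext i
    rcases Fin.eq_self_or_eq_succAbove j i with rfl | ⟨i, rfl⟩
    · simp
    · simp [Fin.succAbove_ne]
  unfold wedge
  rw [h (a * b), h a, h b, ofMul_mul, TensorProduct.tmul_add, AlternatingMap.map_update_add]

theorem wedge_eq_zero {n : ℕ} (g : Fin n → G) (i : Fin n) (hi : g i = 1) : wedge k g = 0 :=
  AlternatingMap.map_coord_zero _ i (by rw [hi, ofMul_one, TensorProduct.tmul_zero])

theorem wedge_comp_perm {n : ℕ} (g : Fin n → G) (σ : Equiv.Perm (Fin n)) :
    wedge k (fun i => g (σ i)) = ((Equiv.Perm.sign σ : ℤ) : k) • wedge k g := by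
  unfold wedge
  exact (AlternatingMap.map_perm _ (fun i => (1 : k) ⊗ₜ[ℤ] Additive.ofMul (g i)) σ).trans
    (units_smul_eq_cast_smul k _ _)

/-- Multiplying two neighbours is additive in the sense that it is the sum of deleting the one and
the other. -/
theorem wedge_contractNth {n : ℕ} (j : Fin n) (g : Fin (n + 1) → G) :
    wedge k (Fin.contractNth j.castSucc (· * ·) g) =
      wedge k (fun i => g (j.castSucc.succAbove i)) +
        wedge k (fun i => g (j.succ.succAbove i)) := by
  cases n with
  | zero => exact j.elim0
  | succ n =>
  have e1 : Fin.contractNth j.castSucc (· * ·) g =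
      (j.insertNth (g j.succ * g j.castSucc) fun i => g (j.succ.succAbove (j.succAbove i)) :
        Fin (n + 1) → G) := by
    rw [Fin.eq_insertNth_iff]
    constructor
    · simp [Fin.contractNth, mul_comm]
    · funext i
      simp only [Fin.removeNth, Fin.contractNth]
      rcases lt_or_ge i.castSucc j with h | h
      · have := Fin.lt_def.1 h
        rw [Fin.succAbove_of_castSucc_lt _ _ h, Fin.succAbove_of_castSucc_lt _ _ (by
          rw [Fin.lt_def]; simp at this ⊢; omega), if_pos (by simpa using this)]
      · have := Fin.le_def.1 h
        rw [Fin.succAbove_of_le_castSucc _ _ h, Fin.succAbove_of_le_castSucc _ _ (by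
          rw [Fin.le_def]; simp at this ⊢; omega), if_neg (by simp at this ⊢; omega),
          if_neg (by simp at this ⊢; omega)]
  have e2 : (fun i => g (j.castSucc.succAbove i)) =
      (j.insertNth (g j.succ) fun i => g (j.succ.succAbove (j.succAbove i)) :
        Fin (n + 1) → G) := by
    rw [Fin.eq_insertNth_iff]
    constructor
    · simp
    · funext i
      simp only [Fin.removeNth]
      congr 1
      simp only [Fin.succAbove, Fin.lt_def, Fin.ext_iff]
      split_ifs <;> simp_all <;> omega
  have e3 : (fun i => g (j.succ.succAbove i)) =
      (j.insertNth (g j.castSucc) fun i => g (j.succ.succAbove (j.succAbove i)) :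
        Fin (n + 1) → G) := by
    rw [Fin.eq_insertNth_iff]
    constructor
    · simp
    · rfl
  rw [e1, e2, e3, wedge_insertNth_mul]

theorem alternating_telescope {M : Type*} [AddCommGroup M] [Module k M] (n : ℕ)
    (a : Fin (n + 1) → M) :
    ∑ j : Fin n, (-1 : k) ^ ((j : ℕ) + 1) • (a j.castSucc + a j.succ) =
      (-1 : k) ^ n • a (Fin.last n) - a 0 := by
  induction n with
  | zero => simp
  | succ n ih =>
    have := ih fun i => a i.castSucc
    rw [Fin.sum_univ_castSucc]
    simp only [Fin.val_castSucc, Fin.succ_castSucc, Fin.val_last] at this ⊢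
    rw [this, Fin.succ_last, Fin.castSucc_zero]
    simp only [pow_succ, mul_neg, mul_one, neg_smul, smul_add]
    abel

/-- The cancellation in `barWedge_barD`, where `a` and `b` are the terms that delete the first and
the last entry. -/
theorem smul_smul_cancel {M : Type*} [AddCommGroup M] [Module k M] (c r : k) (n : ℕ) (a b : M) :
    c • r • (a + (((-1 : k) ^ n • b - a) + (-1 : k) ^ (n + 1) • b)) = 0 := by
  rw [pow_succ, mul_neg_one, neg_smul, add_comm a, add_right_comm, sub_add_cancel, add_neg_cancel,
    smul_zero, smul_zero]

/-- The linear extension of `(g₁, …, gₙ) ↦ (n!)⁻¹ (g₁ ⊗ 1) ∧ ⋯ ∧ (gₙ ⊗ 1)` to the bar chains. -/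
def barWedge (n : ℕ) : ((Fin n → G) →₀ k) →ₗ[k] ⋀[k]^n (k ⊗[ℤ] Additive G) :=
  (n.factorial : k)⁻¹ • Finsupp.linearCombination k (wedge k)

theorem barWedge_single {n : ℕ} (g : Fin n → G) (r : k) :
    barWedge k n (Finsupp.single g r) = (n.factorial : k)⁻¹ • r • wedge k g := by
  simp [barWedge]

/-- The faces of a bar chain become an alternating telescoping sum. -/
theorem barWedge_barD {n : ℕ} (w : (Fin (n + 1) → G) →₀ k) :
    barWedge k n (barD k G n w) = 0 := by
  induction w using Finsupp.induction_linear with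
  | zero => simp
  | add f g hf hg => rw [map_add, map_add, hf, hg, add_zero]
  | single g r =>
    have h0 : (fun i => g i.succ) = fun i => g ((0 : Fin (n + 1)).succAbove i) := by
      simp
    have hl : Fin.contractNth (Fin.last n) (· * ·) g =
        fun i => g ((Fin.last n).succAbove i) := by
      funext i
      simp [Fin.contractNth]
    have key := alternating_telescope k n fun i => wedge k fun l => g (i.succAbove l)
    simp only [← wedge_contractNth] at key
    rw [barD_single, Fin.sum_univ_castSucc, map_add, map_add, map_sum]
    simp only [map_smul, barWedge_single, h0, hl, Fin.val_castSucc, Fin.val_last]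
    have hs : ∀ (a : k) (x : ⋀[k]^n (k ⊗[ℤ] Additive G)),
        a • (n.factorial : k)⁻¹ • r • x = (n.factorial : k)⁻¹ • r • a • x := fun a x => by
      rw [smul_comm a, smul_comm a]
    simp only [hs, ← Finset.smul_sum, ← smul_add]
    rw [key]
    exact smul_smul_cancel k _ _ _ _ _

theorem barWedge_symSum [CharZero k] {n : ℕ} (g : Fin n → G) :
    barWedge k n (symSum k g) = wedge k g := by
  have h : ∀ σ : Equiv.Perm (Fin n), ((Equiv.Perm.sign σ : ℤ) : k) *
      ((Equiv.Perm.sign σ : ℤ) : k) = 1 := fun σ => by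
    rw [← Int.cast_mul, ← Units.val_mul, Int.units_mul_self, Units.val_one, Int.cast_one]
  unfold symSum
  simp only [map_sum, map_smul, barWedge_single, wedge_comp_perm, smul_smul,
    mul_left_comm _ (n.factorial : k)⁻¹, one_mul, h]
  rw [Finset.sum_const, Finset.card_univ, Fintype.card_perm, Fintype.card_fin,
    ← Nat.cast_smul_eq_nsmul k, smul_smul, mul_one,
    mul_inv_cancel₀ (Nat.cast_ne_zero.2 n.factorial_ne_zero), one_smul]

variable (G)

/-- The map `Hₙ(G, k) → Λⁿ(G ⊗ k)` induced by `barWedge`. -/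
def homologyWedge (n : ℕ) :
    groupHomology (Rep.trivial k G k) n →ₗ[k] ⋀[k]^n (k ⊗[ℤ] Additive G) :=
  homologyDesc (groupHomology.inhomogeneousChains (Rep.trivial k G k)) n (barWedge k n)
    fun w => (congrArg (barWedge k n) (inhomogeneousChains_d k G n w)).trans (barWedge_barD k w)

variable {G}

theorem homologyWedge_of_represents {n : ℕ} {c : (Fin n → G) →₀ k}
    {h : groupHomology (Rep.trivial k G k) n}
    (H : Represents (groupHomology.inhomogeneousChains (Rep.trivial k G k)) n c h) :
    homologyWedge k G n h = barWedge k n c :=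
  H.homologyDesc

theorem homologyWedge_symClass [CharZero k] {n : ℕ} (g : Fin n → G) :
    homologyWedge k G n (symClass k g) = wedge k g :=
  (homologyWedge_of_represents k (represents_symClass k g)).trans (barWedge_symSum k g)

theorem span_range_one_tmul :
    Submodule.span k (Set.range fun g : G => (1 : k) ⊗ₜ[ℤ] Additive.ofMul g) = ⊤ := by
  rw [eq_top_iff]
  rintro x -
  induction x using TensorProduct.induction_on with
  | zero => exact zero_mem _
  | add x y hx hy => exact add_mem hx hy
  | tmul a g =>
    have : a ⊗ₜ[ℤ] g = a • ((1 : k) ⊗ₜ[ℤ] Additive.ofMul g.toMul) := by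
      rw [TensorProduct.smul_tmul', smul_eq_mul, mul_one]
      rfl
    rw [this]
    exact Submodule.smul_mem _ _ (Submodule.subset_span ⟨_, rfl⟩)

theorem span_range_wedge (n : ℕ) :
    Submodule.span k (Set.range (wedge k : (Fin n → G) → _)) = ⊤ := by
  rw [← exteriorPower.ιMulti_span_of_span k n _ (span_range_one_tmul k (G := G))]
  congr 1
  ext x
  constructor
  · rintro ⟨g, rfl⟩
    exact ⟨_, Set.range_subset_iff.2 fun i => ⟨g i, rfl⟩, rfl⟩
  · rintro ⟨a, ha, rfl⟩
    choose g hg using Set.range_subset_iff.1 ha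
    exact ⟨g, congrArg _ (funext hg)⟩

theorem homologyWedge_surjective [CharZero k] (n : ℕ) :
    Function.Surjective (homologyWedge k G n) := by
  rw [← LinearMap.range_eq_top, eq_top_iff, ← span_range_wedge, Submodule.span_le]
  rintro _ ⟨g, rfl⟩
  exact ⟨_, homologyWedge_symClass k g⟩

/-- A surjection onto a space that is not of smaller dimension is injective. -/
theorem homologyWedge_injective_of_fg [CharZero k] [hG : Group.FG G] (n : ℕ) :
    Function.Injective (homologyWedge k G n) := by
  have : Module.Finite ℤ (Additive G) :=
    Module.Finite.iff_addGroup_fg.2 (GroupFG.iff_add_fg.1 hG)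
  obtain ⟨h1, h2⟩ := finite_and_finrank_groupHomology_le (k := k) (G := G) n
  have h3 := homologyWedge_surjective k (G := G) n
  rw [← exteriorPower.finrank_eq] at h2
  have h4 := le_antisymm h2 (LinearMap.finrank_le_finrank_of_surjective h3)
  exact (LinearMap.injective_iff_surjective_of_finrank_eq_finrank h4).2 h3

variable {G' : Type u} [CommGroup G'] (f : G' →* G)

/-- The map on bar chains induced by a homomorphism. -/
abbrev barMap (n : ℕ) : ((Fin n → G') →₀ k) →ₗ[k] ((Fin n → G) →₀ k) :=
  Finsupp.lmapDomain k k fun x i => f (x i)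

theorem barMap_barD {n : ℕ} (w : (Fin (n + 1) → G') →₀ k) :
    barMap k f n (barD k G' n w) = barD k G n (barMap k f (n + 1) w) := by
  induction w using Finsupp.induction_linear with
  | zero => simp
  | add a b ha hb => simp only [map_add, ha, hb]
  | single g r =>
    have h : ∀ j : Fin (n + 1), (fun i => f (Fin.contractNth j (· * ·) g i)) =
        Fin.contractNth j (· * ·) fun i => f (g i) := by
      intro j
      funext i
      simp only [Fin.contractNth]
      split_ifs <;> simp
    rw [Finsupp.lmapDomain_apply _ _ _ (Finsupp.single g r), Finsupp.mapDomain_single, barD_single,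
      barD_single, map_add, map_sum]
    simp only [map_smul, Finsupp.lmapDomain_apply, Finsupp.mapDomain_single, h]

theorem map_barWedge {n : ℕ} (c : (Fin n → G') →₀ k) :
    exteriorPower.map n (LinearMap.baseChange k f.toAdditive.toIntLinearMap) (barWedge k n c) =
      barWedge k n (barMap k f n c) := by
  induction c using Finsupp.induction_linear with
  | zero => simp
  | add a b ha hb => simp only [map_add, ha, hb]
  | single g r =>
    rw [Finsupp.lmapDomain_apply, Finsupp.mapDomain_single, barWedge_single, barWedge_single,
      map_smul, map_smul]
    congr 2
    unfold wedge
    rw [exteriorPower.map_apply_ιMulti]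
    rfl

variable {f}

theorem map_baseChange_injective [CharZero k] (hf : Function.Injective f) (n : ℕ) :
    Function.Injective (exteriorPower.map (R := k) n
      (LinearMap.baseChange k f.toAdditive.toIntLinearMap)) := by
  refine exteriorPower.map_injective_field ?_
  exact Module.Flat.lTensor_preserves_injective_linearMap (M := k) f.toAdditive.toIntLinearMap hf

/-- Every chain comes from a finitely generated subgroup. -/
theorem exists_barMap_subtype_eq {n : ℕ} (c : (Fin n → G) →₀ k) :
    ∃ (P : Subgroup G) (_ : Group.FG P) (c' : (Fin n → P) →₀ k), barMap k P.subtype n c' = c := by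
  classical
  let T : Finset G := c.support.biUnion fun x => Finset.univ.image x
  have hT : ∀ x ∈ c.support, ∀ i, x i ∈ Subgroup.closure (T : Set G) := fun x hx i =>
    Subgroup.subset_closure (Finset.mem_coe.2 (Finset.mem_biUnion.2
      ⟨x, hx, Finset.mem_image_of_mem _ (Finset.mem_univ i)⟩))
  refine ⟨Subgroup.closure (T : Set G), Group.closure_finset_fg T,
    ∑ x ∈ c.support.attach, Finsupp.single (fun i => ⟨x.1 i, hT x.1 x.2 i⟩) (c x.1), ?_⟩
  rw [map_sum]
  simp only [Finsupp.lmapDomain_apply, Finsupp.mapDomain_single, Subgroup.subtype_apply]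
  rw [Finset.sum_attach c.support fun x => Finsupp.single x (c x)]
  exact Finsupp.sum_single c

/-- A cycle that is sent to zero comes from a finitely generated subgroup `P`, where it is sent to
zero already, since `Λⁿ(P ⊗ k)` embeds into `Λⁿ(G ⊗ k)`. So it is a boundary over `P`. -/
theorem homologyWedge_injective [CharZero k] (n : ℕ) :
    Function.Injective (homologyWedge k G n) := by
  refine (injective_iff_map_eq_zero _).2 fun h hh => ?_
  obtain ⟨c, hc⟩ := exists_represents
    (K := groupHomology.inhomogeneousChains (Rep.trivial k G k)) h
  obtain ⟨P, hP, c', hc'⟩ := exists_barMap_subtype_eq k c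
  have hinj : ∀ m, Function.Injective (barMap k P.subtype m) := fun m =>
    Finsupp.mapDomain_injective fun x y hxy => funext fun i =>
      Subtype.ext (congrFun hxy i)
  have h1 : ∃ h' : groupHomology (Rep.trivial k P k) n,
      Represents (groupHomology.inhomogeneousChains (Rep.trivial k P k)) n c' h' := by
    refine exists_represents_of_d_eq_zero ?_
    cases n with
    | zero =>
      rw [HomologicalComplex.shape _ _ _ (by simp)]
      rfl
    | succ n =>
      rw [show (ComplexShape.down ℕ).next (n + 1) = n from ChainComplex.next_nat_succ n]
      refine (inhomogeneousChains_d k P n _).trans (hinj n ?_)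
      rw [barMap_barD, hc', map_zero]
      exact (inhomogeneousChains_d k G n _).symm.trans (hc.d_eq_zero n)
  obtain ⟨h', hh'⟩ := h1
  have h2 : homologyWedge k P n h' = 0 := by
    rw [homologyWedge_of_represents k hh']
    refine map_baseChange_injective k P.subtype_injective n ?_
    rw [map_barWedge, hc', map_zero, ← hh]
    exact (homologyWedge_of_represents k hc).symm
  have h3 : h' = 0 := homologyWedge_injective_of_fg k n (h2.trans (map_zero _).symm)
  rw [h3] at hh'
  obtain ⟨w, hw⟩ := hh'.exists_d_eq
  rw [inhomogeneousChains_d] at hw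
  refine hc.unique ?_
  have h4 := represents_d (K := groupHomology.inhomogeneousChains (Rep.trivial k G k)) (n := n)
    (barMap k P.subtype (n + 1) w)
  rw [inhomogeneousChains_d, ← barMap_barD] at h4
  rw [← hc', ← hw]
  exact h4

variable (G) in
/-- The isomorphism `Hₙ(G, k) ≃ Λⁿ(G ⊗ k)`. -/
def homologyWedgeEquiv [CharZero k] (n : ℕ) :
    groupHomology (Rep.trivial k G k) n ≃ₗ[k] ⋀[k]^n (k ⊗[ℤ] Additive G) :=
  LinearEquiv.ofBijective (homologyWedge k G n)
    ⟨homologyWedge_injective k n, homologyWedge_surjective k n⟩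

theorem homologyWedgeEquiv_symClass [CharZero k] {n : ℕ} (g : Fin n → G) :
    homologyWedgeEquiv k G n (symClass k g) = wedge k g :=
  homologyWedge_symClass k g

theorem canonicalMap_tensorPowerEquiv_cls {n : ℕ} (g : Fin n → G) :
    canonicalMap k G n (tensorPowerEquiv k G n (cls k (PointedRack.isTrivial_conj G) g)) =
      wedge k g := by
  by_cases h : ∃ i, g i = 1
  · obtain ⟨i, hi⟩ := h
    rw [cls_eq_zero (PointedRack.isTrivial_conj G) i hi, map_zero, map_zero,
      wedge_eq_zero k g i hi]
  · push Not at h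
    rw [tensorPowerEquiv_cls g h, canonicalMap, PiTensorProduct.lift.tprod]
    simp only [AlternatingMap.coe_multilinearMap, AlternatingMap.compLinearMap_apply, toTensor,
      Finsupp.linearCombination_single, one_smul]
    rfl

theorem canonicalMap_surjective (n : ℕ) : Function.Surjective (canonicalMap k G n) := by
  rw [← LinearMap.range_eq_top, eq_top_iff, ← span_range_wedge, Submodule.span_le]
  rintro _ ⟨g, rfl⟩
  exact ⟨_, canonicalMap_tensorPowerEquiv_cls k g⟩

theorem homologyWedgeEquiv_symMap [CharZero k] {n : ℕ} (x : HR k (PointedRack.conj G) n) :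
    homologyWedgeEquiv k G n (symMap k G n x) = canonicalMap k G n (tensorPowerEquiv k G n x) := by
  have : (homologyWedgeEquiv k G n).toLinearMap ∘ₗ symMap k G n =
      canonicalMap k G n ∘ₗ (tensorPowerEquiv k G n).toLinearMap := by
    refine HR_hom_ext (PointedRack.isTrivial_conj G) fun g => ?_
    simp only [LinearMap.comp_apply, LinearEquiv.coe_coe]
    rw [symMap_cls, homologyWedgeEquiv_symClass, canonicalMap_tensorPowerEquiv_cls]
  exact LinearMap.congr_fun this x

end Wedge

/-! ### The bialgebra of words -/

/-- The elements `e l` of the graded module `⨁ n, A n` indexed by words `l` in a pointed set vanish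
for the words containing the base point, and are otherwise free generators, `e l` being homogeneous
of degree the length of `l`. -/
structure IsWordModule (k : Type u) [CommRing k] {X : Type u} (pt : X) (A : ℕ → Type u)
    [∀ n, AddCommGroup (A n)] [∀ n, Module k (A n)] (e : List X → ⨁ n, A n) : Prop where
  eq_zero : ∀ l, pt ∈ l → e l = 0
  exists_lof_eq : ∀ l, ∃ a : A l.length, DirectSum.lof k ℕ A l.length a = e l
  lof_mem_span : ∀ n (a : A n),
    DirectSum.lof k ℕ A n a ∈ Submodule.span k {y | ∃ l : List X, l.length = n ∧ e l = y}
  exists_lift : ∀ {M : Type u} [AddCommGroup M] [Module k M] (f : List X → M),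
    (∀ l, pt ∈ l → f l = 0) → ∃ F : (⨁ n, A n) →ₗ[k] M, ∀ l, F (e l) = f l

namespace IsWordModule

variable {k : Type u} [CommRing k] {X : Type u} {pt : X} {A : ℕ → Type u}
  [∀ n, AddCommGroup (A n)] [∀ n, Module k (A n)] {e : List X → ⨁ n, A n}

theorem span_range (h : IsWordModule k pt A e) : Submodule.span k (Set.range e) = ⊤ := by
  rw [eq_top_iff]
  rintro x -
  induction x using DirectSum.induction_on with
  | zero => exact zero_mem _
  | add x y hx hy => exact add_mem hx hy
  | of n a =>
    refine Submodule.span_mono ?_ (h.lof_mem_span n a)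
    rintro _ ⟨l, -, rfl⟩
    exact ⟨l, rfl⟩

theorem hom_ext (h : IsWordModule k pt A e) {M : Type*} [AddCommGroup M] [Module k M]
    {F F' : (⨁ n, A n) →ₗ[k] M} (hF : ∀ l, F (e l) = F' (e l)) : F = F' :=
  LinearMap.ext_on_range h.span_range hF

theorem tensor_ext (h : IsWordModule k pt A e) {M : Type*} [AddCommGroup M] [Module k M]
    {F F' : ((⨁ n, A n) ⊗[k] (⨁ n, A n)) →ₗ[k] M}
    (hF : ∀ l m, F (e l ⊗ₜ e m) = F' (e l ⊗ₜ e m)) : F = F' :=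
  TensorProduct.ext (h.hom_ext fun l => h.hom_ext fun m => hF l m)

theorem tensor_ext₂ (h : IsWordModule k pt A e) {M : Type*} [AddCommGroup M] [Module k M]
    {F F' : ((⨁ n, A n) ⊗[k] (⨁ n, A n)) →ₗ[k] ((⨁ n, A n) ⊗[k] (⨁ n, A n)) →ₗ[k] M}
    (hF : ∀ a b c d, F (e a ⊗ₜ e b) (e c ⊗ₜ e d) = F' (e a ⊗ₜ e b) (e c ⊗ₜ e d)) : F = F' :=
  h.tensor_ext fun a b => h.tensor_ext fun c d => hF a b c d

variable {M : Type u} [AddCommGroup M] [Module k M]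

/-- The linear map with given values on the words. -/
def lift (h : IsWordModule k pt A e) (f : List X → M) (hf : ∀ l, pt ∈ l → f l = 0) :
    (⨁ n, A n) →ₗ[k] M :=
  (h.exists_lift f hf).choose

@[simp]
theorem lift_apply (h : IsWordModule k pt A e) (f : List X → M) (hf : ∀ l, pt ∈ l → f l = 0)
    (l : List X) : h.lift f hf (e l) = f l :=
  (h.exists_lift f hf).choose_spec l

/-- Putting a letter in front of a word. -/
def cons (h : IsWordModule k pt A e) (g : X) : (⨁ n, A n) →ₗ[k] (⨁ n, A n) :=
  h.lift (fun l => e (g :: l)) fun _ hl => h.eq_zero _ (List.mem_cons_of_mem _ hl)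

@[simp]
theorem cons_apply (h : IsWordModule k pt A e) (g : X) (l : List X) :
    h.cons g (e l) = e (g :: l) :=
  lift_apply _ _ _ _

theorem cons_pt (h : IsWordModule k pt A e) : h.cons pt = 0 :=
  h.hom_ext fun l => by
    rw [cons_apply, LinearMap.zero_apply, h.eq_zero _ List.mem_cons_self]

/-- The involution that is the sign `(-1)ⁿ` in degree `n`. -/
def sgn (h : IsWordModule k pt A e) : (⨁ n, A n) →ₗ[k] (⨁ n, A n) :=
  h.lift (fun l => (-1 : k) ^ l.length • e l) fun _ hl => by rw [h.eq_zero _ hl, smul_zero]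

@[simp]
theorem sgn_apply (h : IsWordModule k pt A e) (l : List X) :
    h.sgn (e l) = (-1 : k) ^ l.length • e l :=
  lift_apply _ _ _ _

/-- The augmentation: the coefficient of the empty word. -/
def counit (h : IsWordModule k pt A e) : (⨁ n, A n) →ₗ[k] k :=
  h.lift (fun l => if l.isEmpty then 1 else 0) fun l hl => by
    cases l <;> simp at hl ⊢

@[simp]
theorem counit_nil (h : IsWordModule k pt A e) : h.counit (e []) = 1 :=
  lift_apply _ _ _ _

@[simp]
theorem counit_cons (h : IsWordModule k pt A e) (g : X) (l : List X) :
    h.counit (e (g :: l)) = 0 :=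
  lift_apply _ _ _ _

theorem counit_comp_cons (h : IsWordModule k pt A e) (g : X) : h.counit ∘ₗ h.cons g = 0 :=
  h.hom_ext fun l => by simp

/-- The concatenation product. -/
def mul (h : IsWordModule k pt A e) : (⨁ n, A n) →ₗ[k] (⨁ n, A n) →ₗ[k] (⨁ n, A n) :=
  h.lift (fun l => h.lift (fun m => e (l ++ m))
      fun _ hm => h.eq_zero _ (List.mem_append_right _ hm))
    fun _ hl => h.hom_ext fun m => by
      rw [lift_apply, LinearMap.zero_apply, h.eq_zero _ (List.mem_append_left _ hl)]

@[simp]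
theorem mul_apply (h : IsWordModule k pt A e) (l m : List X) :
    h.mul (e l) (e m) = e (l ++ m) := by
  rw [mul, lift_apply, lift_apply]

theorem mul_nil (h : IsWordModule k pt A e) (y : ⨁ n, A n) : h.mul (e []) y = y :=
  LinearMap.congr_fun (h.hom_ext (F' := LinearMap.id) fun m => by simp) y

theorem mul_cons (h : IsWordModule k pt A e) (g : X) (x y : ⨁ n, A n) :
    h.mul (h.cons g x) y = h.cons g (h.mul x y) := by
  have : h.mul ∘ₗ h.cons g = h.mul.compr₂ (h.cons g) :=
    h.hom_ext fun l => h.hom_ext fun m => by simp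
  exact LinearMap.congr_fun₂ this x y

/-- The coproduct of a word: each letter goes to the left or, with a sign, to the right factor. -/
def full (h : IsWordModule k pt A e) : List X → (⨁ n, A n) ⊗[k] (⨁ n, A n)
  | [] => e [] ⊗ₜ e []
  | g :: l => (h.cons g).rTensor _ (full h l) + TensorProduct.map h.sgn (h.cons g) (full h l)

/-- The half-coproduct of a word: the first letter goes to the left factor. -/
def half (h : IsWordModule k pt A e) : List X → (⨁ n, A n) ⊗[k] (⨁ n, A n)
  | [] => 0
  | g :: l => (h.cons g).rTensor _ (h.full l)

theorem full_eq_zero (h : IsWordModule k pt A e) (l : List X) (hl : pt ∈ l) : h.full l = 0 := by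
  induction l with
  | nil => simp at hl
  | cons g l ih =>
    rw [full]
    rcases List.mem_cons.1 hl with rfl | hl
    · rw [cons_pt, LinearMap.rTensor_zero, TensorProduct.map_zero_right, LinearMap.zero_apply,
        add_zero]
    · rw [ih hl, map_zero, map_zero, add_zero]

theorem half_eq_zero (h : IsWordModule k pt A e) (l : List X) (hl : pt ∈ l) : h.half l = 0 := by
  cases l with
  | nil => rfl
  | cons g l =>
    rw [half]
    rcases List.mem_cons.1 hl with rfl | hl
    · rw [cons_pt, LinearMap.rTensor_zero, LinearMap.zero_apply]
    · rw [h.full_eq_zero l hl, map_zero]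

/-- The linear extension of `full`. -/
def diag (h : IsWordModule k pt A e) : (⨁ n, A n) →ₗ[k] (⨁ n, A n) ⊗[k] (⨁ n, A n) :=
  h.lift h.full h.full_eq_zero

/-- The linear extension of `half`. -/
def coprod (h : IsWordModule k pt A e) : (⨁ n, A n) →ₗ[k] (⨁ n, A n) ⊗[k] (⨁ n, A n) :=
  h.lift h.half h.half_eq_zero

@[simp]
theorem diag_apply (h : IsWordModule k pt A e) (l : List X) : h.diag (e l) = h.full l :=
  lift_apply _ _ _ _

@[simp]
theorem coprod_apply (h : IsWordModule k pt A e) (l : List X) : h.coprod (e l) = h.half l :=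
  lift_apply _ _ _ _

theorem diag_nil (h : IsWordModule k pt A e) : h.diag (e []) = e [] ⊗ₜ e [] :=
  h.diag_apply []

theorem coprod_nil (h : IsWordModule k pt A e) : h.coprod (e []) = 0 :=
  h.coprod_apply []

theorem diag_cons (h : IsWordModule k pt A e) (g : X) (x : ⨁ n, A n) :
    h.diag (h.cons g x) =
      (h.cons g).rTensor _ (h.diag x) + TensorProduct.map h.sgn (h.cons g) (h.diag x) := by
  have : h.diag ∘ₗ h.cons g = (h.cons g).rTensor _ ∘ₗ h.diag +
      TensorProduct.map h.sgn (h.cons g) ∘ₗ h.diag := h.hom_ext fun l => by simp [full]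
  exact LinearMap.congr_fun this x

theorem coprod_cons (h : IsWordModule k pt A e) (g : X) (x : ⨁ n, A n) :
    h.coprod (h.cons g x) = (h.cons g).rTensor _ (h.diag x) := by
  have : h.coprod ∘ₗ h.cons g = (h.cons g).rTensor _ ∘ₗ h.diag := h.hom_ext fun l => by simp [half]
  exact LinearMap.congr_fun this x

/-- Two linear maps that agree on the nonempty words agree on the augmentation ideal. -/
theorem eq_of_counit_eq_zero (h : IsWordModule k pt A e) {N : Type*} [AddCommGroup N] [Module k N]
    {F F' : (⨁ n, A n) →ₗ[k] N} (hF : ∀ g l, F (e (g :: l)) = F' (e (g :: l))) {x : ⨁ n, A n}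
    (hx : h.counit x = 0) : F x = F' x := by
  have : F - F' = h.counit.smulRight (F (e []) - F' (e [])) := h.hom_ext fun l => by
    cases l with
    | nil => simp
    | cons g l => simp [hF]
  have := LinearMap.congr_fun this x
  rw [LinearMap.smulRight_apply, hx, zero_smul, LinearMap.sub_apply] at this
  exact sub_eq_zero.1 this

theorem comm_tmul (h : IsWordModule k pt A e) (l m : List X) :
    TensorProduct.gradedComm k A A (e l ⊗ₜ e m) =
      (-1 : k) ^ (m.length * l.length) • (e m ⊗ₜ e l) := by
  obtain ⟨a, ha⟩ := h.exists_lof_eq l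
  obtain ⟨b, hb⟩ := h.exists_lof_eq m
  rw [← ha, ← hb, TensorProduct.gradedComm_of_tmul_of, units_smul_eq_cast_smul k]
  simp

theorem comm_rTensor_cons (h : IsWordModule k pt A e) (g : X) (z : (⨁ n, A n) ⊗[k] (⨁ n, A n)) :
    TensorProduct.gradedComm k A A ((h.cons g).rTensor _ z) =
      TensorProduct.map h.sgn (h.cons g) (TensorProduct.gradedComm k A A z) := by
  have : (TensorProduct.gradedComm k A A).toLinearMap ∘ₗ (h.cons g).rTensor _ =
      TensorProduct.map h.sgn (h.cons g) ∘ₗ (TensorProduct.gradedComm k A A).toLinearMap :=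
    h.tensor_ext fun l m => by
      simp [h.comm_tmul, ← TensorProduct.smul_tmul', smul_smul, mul_add, pow_add]
  exact LinearMap.congr_fun this z

theorem comm_map_cons (h : IsWordModule k pt A e) (g : X) (z : (⨁ n, A n) ⊗[k] (⨁ n, A n)) :
    TensorProduct.gradedComm k A A (TensorProduct.map h.sgn (h.cons g) z) =
      (h.cons g).rTensor _ (TensorProduct.gradedComm k A A z) := by
  have : (TensorProduct.gradedComm k A A).toLinearMap ∘ₗ TensorProduct.map h.sgn (h.cons g) =
      (h.cons g).rTensor _ ∘ₗ (TensorProduct.gradedComm k A A).toLinearMap :=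
    h.tensor_ext fun l m => by
      have h1 : (-1 : k) ^ l.length * (-1) ^ l.length = 1 := by rw [← mul_pow]; simp
      simp [h.comm_tmul, ← TensorProduct.smul_tmul', smul_smul, add_mul, pow_add,
        mul_left_comm _ ((-1 : k) ^ (m.length * l.length)), h1]
  exact LinearMap.congr_fun this z

/-- The coproduct is graded cocommutative, as the flip exchanges the two terms of the recursion. -/
theorem comm_full (h : IsWordModule k pt A e) (l : List X) :
    TensorProduct.gradedComm k A A (h.full l) = h.full l := by
  induction l with
  | nil => simp [full, h.comm_tmul]
  | cons g l ih => rw [full, map_add, comm_rTensor_cons, comm_map_cons, ih, add_comm]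

/-- The two terms in the recursion for `Δ` are `Δ_≺` and its flip. -/
theorem fullCoprod_eq (h : IsWordModule k pt A e) :
    fullCoprod k (e []) h.counit h.coprod = h.diag :=
  h.hom_ext fun l => by
    cases l with
    | nil => simp [fullCoprod, half, full]
    | cons g l => simp [fullCoprod, half, full, h.comm_rTensor_cons, h.comm_full]

/-! ### The counits, the semi-Hopf relation and coassociativity -/

theorem mulTensor_apply (h : IsWordModule k pt A e) (a b c d : List X) :
    mulTensor k A h.mul (e a ⊗ₜ e b) (e c ⊗ₜ e d) =
      (-1 : k) ^ (c.length * b.length) • (e (a ++ c) ⊗ₜ e (b ++ d)) := by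
  simp [mulTensor, h.comm_tmul, ← TensorProduct.smul_tmul', TensorProduct.tmul_smul]

theorem mulTensor_nil (h : IsWordModule k pt A e) (z : (⨁ n, A n) ⊗[k] (⨁ n, A n)) :
    mulTensor k A h.mul (e [] ⊗ₜ e []) z = z :=
  LinearMap.congr_fun (h.tensor_ext (F' := LinearMap.id) fun l m => by
    simp [h.mulTensor_apply]) z

theorem mulTensor_rTensor_cons (h : IsWordModule k pt A e) (g : X)
    (z w : (⨁ n, A n) ⊗[k] (⨁ n, A n)) :
    mulTensor k A h.mul ((h.cons g).rTensor _ z) w =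
      (h.cons g).rTensor _ (mulTensor k A h.mul z w) := by
  have : mulTensor k A h.mul ∘ₗ (h.cons g).rTensor _ =
      (mulTensor k A h.mul).compr₂ ((h.cons g).rTensor _) :=
    h.tensor_ext₂ fun a b c d => by simp [h.mulTensor_apply]
  exact LinearMap.congr_fun₂ this z w

theorem mulTensor_map_cons (h : IsWordModule k pt A e) (g : X)
    (z w : (⨁ n, A n) ⊗[k] (⨁ n, A n)) :
    mulTensor k A h.mul (TensorProduct.map h.sgn (h.cons g) z) w =
      TensorProduct.map h.sgn (h.cons g) (mulTensor k A h.mul z w) := by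
  have : mulTensor k A h.mul ∘ₗ TensorProduct.map h.sgn (h.cons g) =
      (mulTensor k A h.mul).compr₂ (TensorProduct.map h.sgn (h.cons g)) :=
    h.tensor_ext₂ fun a b c d => by
      simp only [LinearMap.comp_apply, LinearMap.compr₂_apply, TensorProduct.map_tmul, sgn_apply,
        cons_apply, ← TensorProduct.smul_tmul', map_smul, LinearMap.smul_apply, h.mulTensor_apply,
        smul_smul, List.cons_append, List.length_cons, List.length_append]
      congr 1
      ring
  exact LinearMap.congr_fun₂ this z w

/-- The coproduct is multiplicative. -/
theorem diag_mul (h : IsWordModule k pt A e) (l : List X) (y : ⨁ n, A n) :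
    h.diag (h.mul (e l) y) = mulTensor k A h.mul (h.diag (e l)) (h.diag y) := by
  induction l with
  | nil => rw [mul_nil, diag_nil, mulTensor_nil]
  | cons g l ih =>
    rw [← h.cons_apply, mul_cons, diag_cons, diag_cons, ih, map_add, LinearMap.add_apply,
      mulTensor_rTensor_cons, mulTensor_map_cons]

theorem coprod_mul (h : IsWordModule k pt A e) {x : ⨁ n, A n} (hx : h.counit x = 0)
    (y : ⨁ n, A n) :
    h.coprod (h.mul x y) = mulTensor k A h.mul (h.coprod x) (h.diag y) := by
  refine h.eq_of_counit_eq_zero (F := h.coprod ∘ₗ h.mul.flip y)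
    (F' := (mulTensor k A h.mul).flip (h.diag y) ∘ₗ h.coprod) (fun g l => ?_) hx
  simp only [LinearMap.comp_apply, LinearMap.flip_apply]
  rw [← h.cons_apply, mul_cons, coprod_cons, coprod_cons, diag_mul, mulTensor_rTensor_cons]

theorem rid_lTensor_counit_diag (h : IsWordModule k pt A e) (x : ⨁ n, A n) :
    TensorProduct.rid k _ (h.counit.lTensor _ (h.diag x)) = x := by
  have h1 : ∀ g z, TensorProduct.rid k _ (h.counit.lTensor _ ((h.cons g).rTensor _ z)) =
      h.cons g (TensorProduct.rid k _ (h.counit.lTensor _ z)) := fun g z => by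
    induction z using TensorProduct.induction_on with
    | zero => simp
    | add z w hz hw => simp only [map_add, hz, hw]
    | tmul x y => simp
  have h2 : ∀ g z, h.counit.lTensor (⨁ n, A n) (TensorProduct.map h.sgn (h.cons g) z) = 0 :=
    fun g z => by
      rw [← LinearMap.comp_apply, LinearMap.lTensor, ← TensorProduct.map_comp, counit_comp_cons,
        TensorProduct.map_zero_right, LinearMap.zero_apply]
  have : (TensorProduct.rid k _).toLinearMap ∘ₗ h.counit.lTensor _ ∘ₗ h.diag = LinearMap.id :=
    h.hom_ext fun l => by
      simp only [LinearMap.comp_apply, LinearEquiv.coe_coe, LinearMap.id_apply]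
      induction l with
      | nil => simp [full]
      | cons g l ih =>
        rw [← h.cons_apply, diag_cons, map_add, map_add, h1, h2, map_zero, add_zero, ih]
  exact LinearMap.congr_fun this x

theorem rTensor_counit_coprod (h : IsWordModule k pt A e) {x : ⨁ n, A n} (hx : h.counit x = 0) :
    h.counit.rTensor (⨁ n, A n) (h.coprod x) = 0 := by
  refine h.eq_of_counit_eq_zero (F := h.counit.rTensor _ ∘ₗ h.coprod) (F' := 0) (fun g l => ?_) hx
  rw [LinearMap.comp_apply, ← h.cons_apply, coprod_cons, ← LinearMap.comp_apply,
    ← LinearMap.rTensor_comp, counit_comp_cons, LinearMap.rTensor_zero]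
  rfl

theorem rid_lTensor_counit_coprod (h : IsWordModule k pt A e) {x : ⨁ n, A n}
    (hx : h.counit x = 0) : TensorProduct.rid k _ (h.counit.lTensor _ (h.coprod x)) = x := by
  refine h.eq_of_counit_eq_zero
    (F := (TensorProduct.rid k _).toLinearMap ∘ₗ h.counit.lTensor _ ∘ₗ h.coprod)
    (F' := LinearMap.id) (fun g l => ?_) hx
  have := h.rid_lTensor_counit_diag (e (g :: l))
  rw [← h.cons_apply, diag_cons, map_add, map_add] at this
  have h2 : h.counit.lTensor (⨁ n, A n)
      (TensorProduct.map h.sgn (h.cons g) (h.diag (e l))) = 0 := by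
    rw [← LinearMap.comp_apply, LinearMap.lTensor, ← TensorProduct.map_comp, counit_comp_cons,
      TensorProduct.map_zero_right, LinearMap.zero_apply]
  rw [h2, map_zero, add_zero] at this
  simp only [LinearMap.comp_apply, LinearEquiv.coe_coe, LinearMap.id_apply]
  rw [← h.cons_apply, coprod_cons]
  exact this

theorem diag_sgn (h : IsWordModule k pt A e) (x : ⨁ n, A n) :
    h.diag (h.sgn x) = TensorProduct.map h.sgn h.sgn (h.diag x) := by
  have h1 : ∀ g (y : ⨁ n, A n), h.sgn (h.cons g y) = - h.cons g (h.sgn y) := fun g y =>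
    LinearMap.congr_fun (h.hom_ext (F := h.sgn ∘ₗ h.cons g) (F' := -(h.cons g ∘ₗ h.sgn))
      fun l => by simp [pow_succ]) y
  have h2 : ∀ g z, TensorProduct.map h.sgn h.sgn ((h.cons g).rTensor _ z) =
      -(h.cons g).rTensor _ (TensorProduct.map h.sgn h.sgn z) := fun g z => by
    induction z using TensorProduct.induction_on with
    | zero => simp
    | add z w hz hw => simp only [map_add, hz, hw, neg_add]
    | tmul x y => simp [h1, TensorProduct.neg_tmul]
  have h3 : ∀ g z, TensorProduct.map h.sgn h.sgn (TensorProduct.map h.sgn (h.cons g) z) =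
      -TensorProduct.map h.sgn (h.cons g) (TensorProduct.map h.sgn h.sgn z) := fun g z => by
    induction z using TensorProduct.induction_on with
    | zero => simp
    | add z w hz hw => simp only [map_add, hz, hw, neg_add]
    | tmul x y => simp [h1, TensorProduct.tmul_neg]
  have : h.diag ∘ₗ h.sgn = TensorProduct.map h.sgn h.sgn ∘ₗ h.diag := h.hom_ext fun l => by
    simp only [LinearMap.comp_apply]
    induction l with
    | nil => simp [full]
    | cons g l ih =>
      rw [← h.cons_apply, h1, map_neg, diag_cons, diag_cons, map_add, h2, h3, ih, neg_add]
  exact LinearMap.congr_fun this x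

theorem assoc_rTensor_diag_rTensor_cons (h : IsWordModule k pt A e) (g : X)
    (z : (⨁ n, A n) ⊗[k] (⨁ n, A n)) :
    TensorProduct.assoc k _ _ _ (h.diag.rTensor _ ((h.cons g).rTensor _ z)) =
      (h.cons g).rTensor _ (TensorProduct.assoc k _ _ _ (h.diag.rTensor _ z)) +
      TensorProduct.map h.sgn ((h.cons g).rTensor _)
        (TensorProduct.assoc k _ _ _ (h.diag.rTensor _ z)) := by
  induction z using TensorProduct.induction_on with
  | zero => simp
  | add z w hz hw => simp only [map_add, hz, hw]; abel
  | tmul x y =>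
    simp only [LinearMap.rTensor_tmul, diag_cons, TensorProduct.add_tmul, map_add]
    generalize h.diag x = w
    congr 1
    · induction w using TensorProduct.induction_on with
      | zero => simp
      | add z w hz hw => simp only [map_add, TensorProduct.add_tmul, hz, hw]
      | tmul a b => simp
    · induction w using TensorProduct.induction_on with
      | zero => simp
      | add z w hz hw => simp only [map_add, TensorProduct.add_tmul, hz, hw]
      | tmul a b => simp

theorem assoc_rTensor_diag_map_cons (h : IsWordModule k pt A e) (g : X)
    (z : (⨁ n, A n) ⊗[k] (⨁ n, A n)) :
    TensorProduct.assoc k _ _ _ (h.diag.rTensor _ (TensorProduct.map h.sgn (h.cons g) z)) =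
      TensorProduct.map h.sgn (TensorProduct.map h.sgn (h.cons g))
        (TensorProduct.assoc k _ _ _ (h.diag.rTensor _ z)) := by
  induction z using TensorProduct.induction_on with
  | zero => simp
  | add z w hz hw => simp only [map_add, hz, hw]
  | tmul x y =>
    simp only [LinearMap.rTensor_tmul, TensorProduct.map_tmul, diag_sgn]
    induction h.diag x using TensorProduct.induction_on with
    | zero => simp
    | add z w hz hw => simp only [map_add, TensorProduct.add_tmul, hz, hw]
    | tmul a b => simp

theorem lTensor_diag_map_cons (h : IsWordModule k pt A e) (g : X)
    (z : (⨁ n, A n) ⊗[k] (⨁ n, A n)) :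
    h.diag.lTensor _ (TensorProduct.map h.sgn (h.cons g) z) =
      TensorProduct.map h.sgn ((h.cons g).rTensor _) (h.diag.lTensor _ z) +
      TensorProduct.map h.sgn (TensorProduct.map h.sgn (h.cons g)) (h.diag.lTensor _ z) := by
  induction z using TensorProduct.induction_on with
  | zero => simp
  | add z w hz hw => simp only [map_add, hz, hw]; abel
  | tmul x y => simp [diag_cons, TensorProduct.tmul_add]

theorem lTensor_rTensor_comm {V W V' W' : Type*} [AddCommGroup V] [AddCommGroup W]
    [AddCommGroup V'] [AddCommGroup W'] [Module k V] [Module k W] [Module k V'] [Module k W']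
    (f : V →ₗ[k] V') (g : W →ₗ[k] W') (z : V ⊗[k] W) :
    g.lTensor V' (f.rTensor W z) = f.rTensor W' (g.lTensor V z) := by
  rw [← LinearMap.comp_apply, ← LinearMap.comp_apply, LinearMap.lTensor_comp_rTensor,
    LinearMap.rTensor_comp_lTensor]

/-- The coproduct is coassociative. -/
theorem diag_coassoc (h : IsWordModule k pt A e) (x : ⨁ n, A n) :
    TensorProduct.assoc k _ _ _ (h.diag.rTensor _ (h.diag x)) = h.diag.lTensor _ (h.diag x) := by
  have : (TensorProduct.assoc k _ _ _).toLinearMap ∘ₗ h.diag.rTensor _ ∘ₗ h.diag =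
      h.diag.lTensor _ ∘ₗ h.diag := h.hom_ext fun l => by
    simp only [LinearMap.comp_apply, LinearEquiv.coe_coe]
    induction l with
    | nil => simp [full]
    | cons g l ih =>
      rw [← h.cons_apply, diag_cons, map_add, map_add, map_add, assoc_rTensor_diag_rTensor_cons,
        assoc_rTensor_diag_map_cons, ih, lTensor_diag_map_cons, lTensor_rTensor_comm, add_assoc]
  exact LinearMap.congr_fun this x

theorem coprod_coassoc (h : IsWordModule k pt A e) {x : ⨁ n, A n} (hx : h.counit x = 0) :
    TensorProduct.assoc k _ _ _ (h.coprod.rTensor _ (h.coprod x)) =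
      h.diag.lTensor _ (h.coprod x) := by
  have h1 : ∀ (g : X) (z : (⨁ n, A n) ⊗[k] (⨁ n, A n)),
      TensorProduct.assoc k _ _ _ (h.coprod.rTensor _ ((h.cons g).rTensor _ z)) =
      (h.cons g).rTensor _ (TensorProduct.assoc k _ _ _ (h.diag.rTensor _ z)) := fun g z => by
    induction z using TensorProduct.induction_on with
    | zero => simp
    | add z w hz hw => simp only [map_add, hz, hw]
    | tmul x y =>
      simp only [LinearMap.rTensor_tmul, coprod_cons]
      induction h.diag x using TensorProduct.induction_on with
      | zero => simp
      | add z w hz hw => simp only [map_add, TensorProduct.add_tmul, hz, hw]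
      | tmul a b => simp
  refine h.eq_of_counit_eq_zero
    (F := (TensorProduct.assoc k _ _ _).toLinearMap ∘ₗ h.coprod.rTensor _ ∘ₗ h.coprod)
    (F' := h.diag.lTensor _ ∘ₗ h.coprod) (fun g l => ?_) hx
  simp only [LinearMap.comp_apply, LinearEquiv.coe_coe]
  rw [← h.cons_apply, coprod_cons, h1, diag_coassoc, lTensor_rTensor_comm]

end IsWordModule

namespace IsWordModule

variable {k : Type u} [CommRing k] {X : Type u} {pt : X} {A : ℕ → Type u}
  [∀ n, AddCommGroup (A n)] [∀ n, Module k (A n)] {e : List X → ⨁ n, A n}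

/-! ### The coZinbiel relation -/

theorem reduced_apply (h : IsWordModule k pt A e) (y : ⨁ n, A n) :
    reduced k (e []) h.counit h.coprod y =
      h.coprod y - y ⊗ₜ e [] + h.counit y • (e [] ⊗ₜ e []) := by
  simp [reduced, TensorProduct.smul_tmul', sub_add]

theorem comm_tmul_nil (h : IsWordModule k pt A e) (y : ⨁ n, A n) :
    TensorProduct.gradedComm k A A (y ⊗ₜ e []) = e [] ⊗ₜ y :=
  LinearMap.congr_fun (h.hom_ext (F := (TensorProduct.gradedComm k A A).toLinearMap ∘ₗ
    (TensorProduct.mk k _ _).flip (e [])) (F' := TensorProduct.mk k _ _ (e [])) fun l => by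
      simp [h.comm_tmul]) y

theorem reduced_add_comm_reduced (h : IsWordModule k pt A e) (y : ⨁ n, A n) :
    (reduced k (e []) h.counit h.coprod + (TensorProduct.gradedComm k A A).toLinearMap ∘ₗ
        reduced k (e []) h.counit h.coprod) y =
      h.diag y - y ⊗ₜ e [] - e [] ⊗ₜ y + h.counit y • (e [] ⊗ₜ e []) := by
  rw [← h.fullCoprod_eq]
  simp only [fullCoprod, LinearMap.add_apply, LinearMap.comp_apply, LinearEquiv.coe_coe,
    reduced_apply, map_add, map_sub, map_smul, h.comm_tmul_nil, LinearMap.smulRight_apply]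
  abel

/-- The coZinbiel relation is coassociativity, up to terms with a tensor factor `1`. -/
theorem coZinbiel (h : IsWordModule k pt A e) {x : ⨁ n, A n} (hx : h.counit x = 0) :
    TensorProduct.assoc k _ _ _ ((reduced k (e []) h.counit h.coprod).rTensor _
        (reduced k (e []) h.counit h.coprod x)) =
      (reduced k (e []) h.counit h.coprod + (TensorProduct.gradedComm k A A).toLinearMap ∘ₗ
        reduced k (e []) h.counit h.coprod).lTensor _ (reduced k (e []) h.counit h.coprod x) := by
  -- `U` inserts a factor `1` in the middle
  let U : ((⨁ n, A n) ⊗[k] (⨁ n, A n)) →ₗ[k] ((⨁ n, A n) ⊗[k] ((⨁ n, A n) ⊗[k] (⨁ n, A n))) :=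
    (TensorProduct.mk k _ _ (e [])).lTensor _
  have hl : ∀ z : (⨁ n, A n) ⊗[k] (⨁ n, A n),
      TensorProduct.assoc k _ _ _ ((reduced k (e []) h.counit h.coprod).rTensor _ z) =
        TensorProduct.assoc k _ _ _ (h.coprod.rTensor _ z) - U z +
          e [] ⊗ₜ (e [] ⊗ₜ TensorProduct.lid k _ (h.counit.rTensor _ z)) := fun z => by
    induction z using TensorProduct.induction_on with
    | zero => simp
    | add z w hz hw => simp only [map_add, hz, hw, TensorProduct.tmul_add]; abel
    | tmul x y =>
      simp [U, reduced_apply, TensorProduct.add_tmul, TensorProduct.sub_tmul,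
        TensorProduct.tmul_smul, ← TensorProduct.smul_tmul']
  have hr : ∀ z : (⨁ n, A n) ⊗[k] (⨁ n, A n),
      (reduced k (e []) h.counit h.coprod + (TensorProduct.gradedComm k A A).toLinearMap ∘ₗ
        reduced k (e []) h.counit h.coprod).lTensor _ z =
        h.diag.lTensor _ z - TensorProduct.assoc k _ _ _ (z ⊗ₜ e []) - U z +
          TensorProduct.rid k _ (h.counit.lTensor _ z) ⊗ₜ (e [] ⊗ₜ e []) := fun z => by
    induction z using TensorProduct.induction_on with
    | zero => simp
    | add z w hz hw => simp only [map_add, hz, hw, TensorProduct.add_tmul]; abel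
    | tmul x y =>
      rw [LinearMap.lTensor_tmul, reduced_add_comm_reduced]
      simp [U, TensorProduct.tmul_add, TensorProduct.tmul_sub, TensorProduct.tmul_smul,
        ← TensorProduct.smul_tmul']
  have hU : U (x ⊗ₜ e []) = x ⊗ₜ (e [] ⊗ₜ e []) := rfl
  rw [hl, hr, reduced_apply, hx, zero_smul, add_zero]
  simp only [map_sub, h.rTensor_counit_coprod hx, h.rid_lTensor_counit_coprod hx,
    h.coprod_coassoc hx, LinearMap.rTensor_tmul, LinearMap.lTensor_tmul, hx,
    TensorProduct.zero_tmul, TensorProduct.sub_tmul, TensorProduct.assoc_tmul, diag_nil,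
    counit_nil, TensorProduct.rid_tmul, one_smul, hU, map_zero, TensorProduct.tmul_zero,
    sub_self, add_zero]
  abel

/-! ### Degrees and connectedness -/

/-- The span of the tensors `e a ⊗ e b` where the lengths of `a` and `b` satisfy a condition. -/
def tensorSpan (k : Type u) [CommRing k] {A : ℕ → Type u} [∀ n, AddCommGroup (A n)]
    [∀ n, Module k (A n)] (e : List X → ⨁ n, A n) (P : ℕ → ℕ → Prop) :
    Submodule k ((⨁ n, A n) ⊗[k] (⨁ n, A n)) :=
  Submodule.span k {z | ∃ a b : List X, P a.length b.length ∧ e a ⊗ₜ e b = z}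

theorem tmul_mem_tensorSpan {P : ℕ → ℕ → Prop} {a b : List X} (hP : P a.length b.length) :
    e a ⊗ₜ e b ∈ tensorSpan k e P :=
  Submodule.subset_span ⟨a, b, hP, rfl⟩

theorem rTensor_cons_mem (h : IsWordModule k pt A e) {P Q : ℕ → ℕ → Prop}
    (hPQ : ∀ i j, P i j → Q (i + 1) j) (g : X) {z : (⨁ n, A n) ⊗[k] (⨁ n, A n)}
    (hz : z ∈ tensorSpan k e P) : (h.cons g).rTensor _ z ∈ tensorSpan k e Q := by
  have : tensorSpan k e P ≤ (tensorSpan k e Q).comap ((h.cons g).rTensor _) := by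
    refine Submodule.span_le.2 ?_
    rintro _ ⟨a, b, hab, rfl⟩
    rw [SetLike.mem_coe, Submodule.mem_comap, LinearMap.rTensor_tmul, cons_apply]
    exact tmul_mem_tensorSpan (hPQ _ _ hab)
  exact this hz

theorem map_cons_mem (h : IsWordModule k pt A e) {P Q : ℕ → ℕ → Prop}
    (hPQ : ∀ i j, P i j → Q i (j + 1)) (g : X) {z : (⨁ n, A n) ⊗[k] (⨁ n, A n)}
    (hz : z ∈ tensorSpan k e P) :
    TensorProduct.map h.sgn (h.cons g) z ∈ tensorSpan k e Q := by
  have : tensorSpan k e P ≤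
      (tensorSpan k e Q).comap (TensorProduct.map h.sgn (h.cons g)) := by
    refine Submodule.span_le.2 ?_
    rintro _ ⟨a, b, hab, rfl⟩
    rw [SetLike.mem_coe, Submodule.mem_comap, TensorProduct.map_tmul, cons_apply, sgn_apply,
      ← TensorProduct.smul_tmul']
    exact Submodule.smul_mem _ _ (tmul_mem_tensorSpan (hPQ _ _ hab))
  exact this hz

theorem full_mem (h : IsWordModule k pt A e) (l : List X) :
    h.full l ∈ tensorSpan k e fun i j => i + j = l.length := by
  induction l with
  | nil => exact tmul_mem_tensorSpan rfl
  | cons g l ih =>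
    refine add_mem (h.rTensor_cons_mem (fun i j hij => ?_) g ih)
      (h.map_cons_mem (fun i j hij => ?_) g ih)
    · rw [List.length_cons, ← hij]; omega
    · rw [List.length_cons, ← hij]; omega

theorem half_mem (h : IsWordModule k pt A e) (l : List X) :
    h.half l ∈ tensorSpan k e fun i j => i + j = l.length := by
  cases l with
  | nil => exact zero_mem _
  | cons g l =>
    refine h.rTensor_cons_mem (fun i j hij => ?_) g (h.full_mem l)
    rw [List.length_cons, ← hij]; omega

theorem coprod_lof_mem (h : IsWordModule k pt A e) (n : ℕ) (a : A n) :
    h.coprod (DirectSum.lof k ℕ A n a) ∈ ⨆ p : {p : ℕ × ℕ // p.1 + p.2 = n}, LinearMap.range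
      (TensorProduct.map (DirectSum.lof k ℕ A p.1.1) (DirectSum.lof k ℕ A p.1.2)) := by
  have h1 : ∀ l : List X, l.length = n → h.half l ∈ ⨆ p : {p : ℕ × ℕ // p.1 + p.2 = n},
      LinearMap.range
        (TensorProduct.map (DirectSum.lof k ℕ A p.1.1) (DirectSum.lof k ℕ A p.1.2)) := by
    rintro l rfl
    refine Submodule.span_le.2 ?_ (h.half_mem l)
    rintro _ ⟨b, c, hbc, rfl⟩
    refine Submodule.mem_iSup_of_mem ⟨(b.length, c.length), hbc⟩ ?_
    obtain ⟨b', hb⟩ := h.exists_lof_eq b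
    obtain ⟨c', hc⟩ := h.exists_lof_eq c
    exact ⟨b' ⊗ₜ c', by rw [TensorProduct.map_tmul, hb, hc]⟩
  have h2 : Submodule.span k {y | ∃ l : List X, l.length = n ∧ e l = y} ≤
      (⨆ p : {p : ℕ × ℕ // p.1 + p.2 = n}, LinearMap.range
        (TensorProduct.map (DirectSum.lof k ℕ A p.1.1) (DirectSum.lof k ℕ A p.1.2))).comap
          h.coprod := by
    refine Submodule.span_le.2 ?_
    rintro _ ⟨l, hl, rfl⟩
    rw [SetLike.mem_coe, Submodule.mem_comap, coprod_apply]
    exact h1 l hl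
  exact h2 (h.lof_mem_span n a)

/-- Apart from `e l ⊗ 1`, the coproduct of a word involves only tensors with a nonempty right
factor. -/
theorem full_sub_mem (h : IsWordModule k pt A e) (l : List X) :
    h.full l - e l ⊗ₜ e [] ∈ tensorSpan k e fun i j => 0 < j ∧ i + j = l.length := by
  induction l with
  | nil => rw [full, sub_self]; exact zero_mem _
  | cons g l ih =>
    have : h.full (g :: l) - e (g :: l) ⊗ₜ e [] =
        (h.cons g).rTensor _ (h.full l - e l ⊗ₜ e []) +
          TensorProduct.map h.sgn (h.cons g) (h.full l) := by
      rw [full, map_sub, LinearMap.rTensor_tmul, cons_apply]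
      abel
    rw [this]
    refine add_mem (h.rTensor_cons_mem (fun i j hij => ?_) g ih)
      (h.map_cons_mem (fun i j hij => ?_) g (h.full_mem l))
    · rw [List.length_cons, ← hij.2]; exact ⟨hij.1, by omega⟩
    · rw [List.length_cons, ← hij]; omega

theorem reduced_cons_mem (h : IsWordModule k pt A e) (g : X) (l : List X) :
    reduced k (e []) h.counit h.coprod (e (g :: l)) ∈
      tensorSpan k e fun i j => 0 < i ∧ 0 < j ∧ i + j = l.length + 1 := by
  have : reduced k (e []) h.counit h.coprod (e (g :: l)) =
      (h.cons g).rTensor _ (h.full l - e l ⊗ₜ e []) := by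
    rw [reduced_apply, counit_cons, zero_smul, add_zero, coprod_apply, half, map_sub,
      LinearMap.rTensor_tmul, cons_apply]
  rw [this]
  exact h.rTensor_cons_mem (fun i j hij => ⟨by omega, hij.1, by omega⟩) g (h.full_sub_mem l)

/-- A nonempty word of length at most `r` is in the `r`-th step of the filtration, since its
reduced coproduct involves only shorter nonempty words. -/
theorem cons_mem_filtration (h : IsWordModule k pt A e) (r : ℕ) (g : X) (l : List X)
    (hl : l.length < r) : e (g :: l) ∈ filtration k (e []) h.counit h.coprod r := by
  induction r generalizing g l with
  | zero => omega
  | succ r ih =>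
    refine ⟨LinearMap.mem_ker.2 (h.counit_cons g l), Submodule.mem_comap.2 ?_⟩
    refine Submodule.span_le.2 ?_ (h.reduced_cons_mem g l)
    rintro _ ⟨a, b, ⟨ha, hb, hab⟩, rfl⟩
    have hmem : ∀ c : List X, 0 < c.length → c.length ≤ r →
        e c ∈ filtration k (e []) h.counit h.coprod r := by
      rintro (_ | ⟨g, c⟩) h0 hc
      · simp at h0
      · exact ih g c (by simpa using hc)
    exact ⟨⟨e a, hmem a ha (by omega)⟩ ⊗ₜ ⟨e b, hmem b hb (by omega)⟩, rfl⟩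

theorem exists_mem_filtration (h : IsWordModule k pt A e) {x : ⨁ n, A n} (hx : h.counit x = 0) :
    ∃ r, x ∈ filtration k (e []) h.counit h.coprod r := by
  suffices ∃ r, ∀ s, r ≤ s → x - h.counit x • e [] ∈ filtration k (e []) h.counit h.coprod s by
    obtain ⟨r, hr⟩ := this
    have := hr r le_rfl
    rw [hx, zero_smul, sub_zero] at this
    exact ⟨r, this⟩
  have hmem : x ∈ Submodule.span k (Set.range e) := h.span_range ▸ Submodule.mem_top
  clear hx
  induction hmem using Submodule.span_induction with
  | zero => exact ⟨0, fun s _ => by simp⟩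
  | mem x hx =>
    obtain ⟨l, rfl⟩ := hx
    cases l with
    | nil => exact ⟨0, fun s _ => by simp⟩
    | cons g l =>
      refine ⟨l.length + 1, fun s hs => ?_⟩
      rw [counit_cons, zero_smul, sub_zero]
      exact h.cons_mem_filtration s g l hs
  | add x y _ _ hx hy =>
    obtain ⟨r, hr⟩ := hx
    obtain ⟨s, hs⟩ := hy
    refine ⟨max r s, fun t ht => ?_⟩
    have := add_mem (hr t (le_trans (le_max_left _ _) ht)) (hs t (le_trans (le_max_right _ _) ht))
    rwa [map_add, add_smul, add_sub_add_comm]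
  | smul a x _ hx =>
    obtain ⟨r, hr⟩ := hx
    refine ⟨r, fun s hs => ?_⟩
    have := Submodule.smul_mem _ a (hr s hs)
    rwa [map_smul, smul_eq_mul, mul_smul, ← smul_sub]

theorem mul_lof_mem (h : IsWordModule k pt A e) (p q : ℕ) (a : A p) (b : A q) :
    h.mul (DirectSum.lof k ℕ A p a) (DirectSum.lof k ℕ A q b) ∈
      LinearMap.range (DirectSum.lof k ℕ A (p + q)) := by
  refine Submodule.span_le.2 ?_ (Submodule.apply_mem_map₂ h.mul (h.lof_mem_span p a)
    (h.lof_mem_span q b) |> (Submodule.map₂_span_span k h.mul _ _).le)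
  rintro _ ⟨_, ⟨l, rfl, rfl⟩, _, ⟨m, rfl, rfl⟩, rfl⟩
  change h.mul (e l) (e m) ∈ LinearMap.range _
  rw [mul_apply]
  obtain ⟨c, hc⟩ := h.exists_lof_eq (l ++ m)
  rw [← hc, ← List.length_append]
  exact ⟨c, rfl⟩

/-- The words form a connected coZinbiel-associative bialgebra. -/
theorem isConnectedCoZinbielAssociativeBialgebra (h : IsWordModule k pt A e) :
    IsConnectedCoZinbielAssociativeBialgebra k (A := A) (e []) h.counit h.mul h.coprod where
  one_mem := h.exists_lof_eq []
  counit_lof n hn a := by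
    have : Submodule.span k {y | ∃ l : List X, l.length = n ∧ e l = y} ≤
        LinearMap.ker h.counit := by
      refine Submodule.span_le.2 ?_
      rintro _ ⟨l, rfl, rfl⟩
      cases l with
      | nil => exact absurd rfl hn
      | cons g l => exact h.counit_cons g l
    exact this (h.lof_mem_span n a)
  mul_mem := h.mul_lof_mem
  coprod_mem := h.coprod_lof_mem
  mul_assoc x y z := by
    have : h.mul.compr₂ h.mul = (LinearMap.llcomp k _ _ _).compl₁₂ h.mul h.mul :=
      h.hom_ext fun l => h.hom_ext fun m => h.hom_ext fun n => by simp
    exact LinearMap.congr_fun (LinearMap.congr_fun₂ this x y) z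
  one_mul := h.mul_nil
  mul_one x := LinearMap.congr_fun (h.hom_ext (F := h.mul.flip (e [])) (F' := LinearMap.id)
    fun m => by simp) x
  counit_one := h.counit_nil
  counit_mul x y := by
    have : h.mul.compr₂ h.counit = (LinearMap.mul k k).compl₁₂ h.counit h.counit :=
      h.hom_ext fun l => h.hom_ext fun m => by
        cases l <;> cases m <;> simp
    exact LinearMap.congr_fun₂ this x y
  coprod_one := h.coprod_nil
  counit_coprod x hx := by rw [h.rTensor_counit_coprod hx, map_zero]
  coprod_counit x hx := h.rid_lTensor_counit_coprod hx
  coZinbiel x hx := h.coZinbiel hx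
  semiHopf x y hx := by rw [h.fullCoprod_eq]; exact h.coprod_mul hx y
  connected x hx := h.exists_mem_filtration hx

end IsWordModule

/-! ### The half-shuffle coproduct by recursion -/

section Shuffle

/-- A permutation with value `0` at `j` is a `p`-shuffle in two cases: either `j` starts the first
block, or it starts the second one, that is, `j = p`. Removing `j` leaves a shuffle. -/
theorem isShuffle_insertPerm_zero {n : ℕ} (p : ℕ) (j : Fin (n + 1)) (σ : Equiv.Perm (Fin n)) :
    IsShuffle p (insertPerm 0 j σ) ↔
      (j = 0 ∧ 0 < p ∧ IsShuffle (p - 1) σ) ∨ ((j : ℕ) = p ∧ IsShuffle p σ) := by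
  have hlt : ∀ a b : Fin n, insertPerm 0 j σ (j.succAbove a) < insertPerm 0 j σ (j.succAbove b) ↔
      σ a < σ b := fun a b => by simp
  have hval : ∀ a : Fin n, ((j.succAbove a : Fin (n + 1)) : ℕ) =
      if (a : ℕ) < j then (a : ℕ) else a + 1 := fun a => by
    simp only [Fin.succAbove, Fin.lt_def, Fin.val_castSucc]
    split_ifs <;> simp
  have hpos : ∀ a : Fin n, 0 < insertPerm 0 j σ (j.succAbove a) := fun a => by simp
  constructor
  · intro h
    -- the value `0` is taken at the beginning of one of the two blocks
    have hj : (j = 0 ∧ 0 < p) ∨ (j : ℕ) = p := by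
      by_contra hcon
      push Not at hcon
      have hj0 : (j : ℕ) ≠ 0 := fun h0 => by
        have := hcon.1 (Fin.ext h0)
        omega
      let i : Fin (n + 1) := ⟨j - 1, by omega⟩
      have hij : i < j := Fin.lt_def.2 (show (j : ℕ) - 1 < j by omega)
      have : insertPerm 0 j σ i < insertPerm 0 j σ j := by
        rcases lt_or_ge (j : ℕ) p with hjp | hjp
        · exact h.1 i j hij hjp
        · exact h.2 i j hij (show p ≤ (j : ℕ) - 1 by omega)
      rw [insertPerm_self] at this
      exact absurd this (Fin.not_lt_zero _)
    rcases hj with ⟨rfl, hp⟩ | hj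
    · refine Or.inl ⟨rfl, hp, fun a b hab hb => (hlt a b).1 (h.1 _ _ ?_ ?_),
        fun a b hab ha => (hlt a b).1 (h.2 _ _ ?_ ?_)⟩
      · simpa using hab
      · rw [hval]; simp; omega
      · simpa using hab
      · rw [hval]; simp; omega
    · refine Or.inr ⟨hj, fun a b hab hb => (hlt a b).1 (h.1 _ _ (by simpa using hab) ?_),
        fun a b hab ha => (hlt a b).1 (h.2 _ _ (by simpa using hab) ?_)⟩
      · rw [hval]; split_ifs <;> omega
      · rw [hval]; split_ifs <;> omega
  · have key : ∀ (P : Fin (n + 1) → Fin (n + 1) → Prop),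
        (∀ a b, a < b → P (j.succAbove a) (j.succAbove b) → σ a < σ b) →
        (∀ a, j.succAbove a < j → ¬ P (j.succAbove a) j) →
        ∀ a b, a < b → P a b → insertPerm 0 j σ a < insertPerm 0 j σ b := by
      intro P h1 h2 a b hab hP
      rcases Fin.eq_self_or_eq_succAbove j b with rfl | ⟨b, rfl⟩
      · rcases Fin.eq_self_or_eq_succAbove b a with rfl | ⟨a, rfl⟩
        · exact absurd hab (lt_irrefl _)
        · exact absurd hP (h2 a hab)
      · rcases Fin.eq_self_or_eq_succAbove j a with rfl | ⟨a, rfl⟩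
        · rw [insertPerm_self]
          exact hpos b
        · exact (hlt a b).2 (h1 a b (by simpa using hab) hP)
    rintro (⟨rfl, hp, h⟩ | ⟨hj, h⟩)
    · constructor
      · refine key (fun _ b => (b : ℕ) < p) (fun a b hab hb => h.1 a b hab ?_)
          fun a ha => absurd ha (Fin.not_lt_zero _)
        rw [hval] at hb; simp at hb; omega
      · refine key (fun a _ => p ≤ (a : ℕ)) (fun a b hab ha => h.2 a b hab ?_)
          fun a ha => absurd ha (Fin.not_lt_zero _)
        rw [hval] at ha; simp at ha; omega
    · constructor
      · refine key (fun _ b => (b : ℕ) < p) (fun a b hab hb => h.1 a b hab ?_)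
          fun a _ hjp => ?_
        · rw [hval] at hb; split_ifs at hb <;> omega
        · omega
      · refine key (fun a _ => p ≤ (a : ℕ)) (fun a b hab ha => h.2 a b hab ?_)
          fun a ha hpa => ?_
        · rw [hval] at ha; split_ifs at ha <;> omega
        · have := Fin.lt_def.1 ha
          omega

theorem isShuffleOne_insertPerm_zero {n : ℕ} (p : ℕ) (j : Fin (n + 1)) (σ : Equiv.Perm (Fin n)) :
    IsShuffleOne p (insertPerm 0 j σ) ↔ j = 0 ∧ 0 < p ∧ IsShuffle (p - 1) σ := by
  constructor
  · rintro ⟨h, hp, h0⟩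
    have hj : j = 0 := by
      refine (insertPerm 0 j σ).injective ?_
      rw [insertPerm_self, h0 0 rfl]
    rcases (isShuffle_insertPerm_zero p j σ).1 h with h | ⟨hjp, -⟩
    · exact h
    · rw [hj, Fin.val_zero] at hjp
      omega
  · rintro h
    refine ⟨(isShuffle_insertPerm_zero p j σ).2 (Or.inl h), h.2.1, fun i hi => ?_⟩
    obtain rfl : i = 0 := Fin.ext hi
    rw [h.1, insertPerm_self]

end Shuffle

namespace IsWordModule

variable {k : Type u} [CommRing k] {X : Type u} {pt : X} {A : ℕ → Type u}
  [∀ n, AddCommGroup (A n)] [∀ n, Module k (A n)] {e : List X → ⨁ n, A n}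

/-- The tensor of the first `p` letters of a word with the other ones. -/
def cut (k : Type u) [CommRing k] {A : ℕ → Type u} [∀ n, AddCommGroup (A n)]
    [∀ n, Module k (A n)] (e : List X → ⨁ n, A n) (p : ℕ) {n : ℕ} (x : Fin n → X) :
    (⨁ n, A n) ⊗[k] (⨁ n, A n) :=
  e ((List.ofFn x).take p) ⊗ₜ e ((List.ofFn x).drop p)

theorem cut_insertNth_zero (h : IsWordModule k pt A e) (p : ℕ) {n : ℕ} (a : X) (x : Fin n → X) :
    cut k e (p + 1) ((0 : Fin (n + 1)).insertNth a x : Fin (n + 1) → X) =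
      (h.cons a).rTensor _ (cut k e p x) := by
  simp [cut, List.ofFn_succ]

theorem cut_insertNth_self (h : IsWordModule k pt A e) {n : ℕ} (j : Fin (n + 1)) (a : X)
    (x : Fin n → X) :
    (-1 : k) ^ (j : ℕ) • cut k e j (j.insertNth a x : Fin (n + 1) → X) =
      TensorProduct.map h.sgn (h.cons a) (cut k e j x) := by
  have h1 : List.ofFn (j.insertNth a x : Fin (n + 1) → X) =
      (List.ofFn x).take j ++ a :: (List.ofFn x).drop j := by
    refine List.ext_getElem (by simp; omega) fun i h1 h2 => ?_
    rw [List.getElem_ofFn]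
    rcases lt_trichotomy i j with hij | hij | hij
    · have hi : (⟨i, by simpa using h1⟩ : Fin (n + 1)) = j.succAbove ⟨i, by omega⟩ := by
        rw [Fin.succAbove_of_castSucc_lt j ⟨i, by omega⟩ (Fin.lt_def.2 hij)]
        rfl
      rw [hi, Fin.insertNth_apply_succAbove, List.getElem_append_left (by simp; omega),
        List.getElem_take, List.getElem_ofFn]
    · subst hij
      rw [Fin.insertNth_apply_same, List.getElem_append_right (by simp)]
      simp [Nat.min_eq_left (Nat.lt_succ_iff.1 j.2)]
    · obtain ⟨i, rfl⟩ : ∃ l, i = l + 1 := ⟨i - 1, by omega⟩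
      have hin : i < n := by simpa using h1
      have hi : (⟨i + 1, by simpa using h1⟩ : Fin (n + 1)) = j.succAbove ⟨i, hin⟩ := by
        rw [Fin.succAbove_of_le_castSucc _ _ (Fin.le_def.2 (Nat.lt_succ_iff.1 hij))]
        rfl
      have hm : min (j : ℕ) n = j := Nat.min_eq_left (Nat.lt_succ_iff.1 j.2)
      have hs : i + 1 - (j : ℕ) = (i - j) + 1 := by omega
      have hij' : (j : ℕ) + (i - j) = i := by omega
      rw [hi, Fin.insertNth_apply_succAbove, List.getElem_append_right (by simp; omega)]
      simp [hm, hs, hij']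
  have h2 : ((List.ofFn x).take j).length = j := by simp; omega
  simp only [cut, TensorProduct.map_tmul, sgn_apply, cons_apply, ← TensorProduct.smul_tmul', h2, h1]
  rw [List.take_left' h2, List.drop_left' h2]

open Classical in
/-- The permutation `insertPerm 0 j σ` is a shuffle in two cases, and these correspond to the two
terms in the recursion for the coproduct of a word. -/
theorem ite_isShuffle_insertPerm (h : IsWordModule k pt A e) {n : ℕ} (x : Fin (n + 1) → X) (p : ℕ)
    (j : Fin (n + 1)) (σ : Equiv.Perm (Fin n)) :
    (if IsShuffle p (insertPerm 0 j σ) then ((Equiv.Perm.sign (insertPerm 0 j σ) : ℤ) : k) •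
        cut k e p (fun i => x (insertPerm 0 j σ i)) else 0) =
      (if j = 0 ∧ 0 < p ∧ IsShuffle (p - 1) σ then ((Equiv.Perm.sign σ : ℤ) : k) •
        (h.cons (x 0)).rTensor _ (cut k e (p - 1) fun i => x (σ i).succ) else 0) +
      (if (j : ℕ) = p ∧ IsShuffle p σ then ((Equiv.Perm.sign σ : ℤ) : k) •
        TensorProduct.map h.sgn (h.cons (x 0)) (cut k e p fun i => x (σ i).succ) else 0) := by
  rw [comp_insertPerm, sign_insertPerm, if_congr (isShuffle_insertPerm_zero p j σ) rfl rfl]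
  simp only [Fin.zero_succAbove]
  by_cases h1 : j = 0 ∧ 0 < p ∧ IsShuffle (p - 1) σ
  · have h2 : ¬ ((j : ℕ) = p ∧ IsShuffle p σ) := by
      rintro ⟨h2, -⟩
      rw [h1.1, Fin.val_zero] at h2
      omega
    rw [if_pos (Or.inl h1), if_pos h1, if_neg h2, add_zero]
    obtain ⟨rfl, hp, -⟩ := h1
    obtain ⟨p, rfl⟩ : ∃ q, p = q + 1 := ⟨p - 1, by omega⟩
    rw [h.cut_insertNth_zero]
    simp
  · by_cases h2 : (j : ℕ) = p ∧ IsShuffle p σ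
    · rw [if_pos (Or.inr h2), if_neg h1, if_pos h2, zero_add]
      obtain ⟨rfl, -⟩ := h2
      rw [← h.cut_insertNth_self, smul_smul]
      congr 1
      simp [mul_comm]
    · rw [if_neg (not_or.2 ⟨h1, h2⟩), if_neg h1, if_neg h2, add_zero]

open Classical in
/-- The sum over all shuffles satisfies the recursion that defines the coproduct of a word. -/
theorem sum_isShuffle_cut (h : IsWordModule k pt A e) {n : ℕ} (x : Fin n → X) :
    ∑ p : Fin (n + 1), ∑ σ ∈ Finset.univ.filter (IsShuffle (n := n) p),
      ((Equiv.Perm.sign σ : ℤ) : k) • cut k e p (fun i => x (σ i)) = h.full (List.ofFn x) := by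
  induction n with
  | zero =>
    have : ∀ σ : Equiv.Perm (Fin 0), IsShuffle 0 σ := fun σ => ⟨fun i => i.elim0, fun i => i.elim0⟩
    simp [full, cut, this]
  | succ n ih =>
    have ih' := ih fun i => x i.succ
    simp only [Finset.sum_filter] at ih' ⊢
    rw [List.ofFn_succ, full, ← ih']
    simp only [sum_perm_eq_sum_insertPerm 0, h.ite_isShuffle_insertPerm, Finset.sum_add_distrib]
    congr 1
    · rw [Fin.sum_univ_succ]
      simp only [Fin.val_zero, lt_irrefl, false_and, and_false, if_false, Finset.sum_const_zero,
        zero_add, map_sum]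
      refine Finset.sum_congr rfl fun p _ => ?_
      rw [Fintype.sum_eq_single 0 fun j hj => by simp [hj]]
      refine Finset.sum_congr rfl fun σ _ => ?_
      by_cases hs : IsShuffle (p : ℕ) σ <;> simp [hs]
    · rw [Finset.sum_comm, map_sum]
      refine Finset.sum_congr rfl fun j _ => ?_
      rw [Fintype.sum_eq_single j.castSucc fun p hp => by
        have : (j : ℕ) ≠ p := fun hjp => hp (Fin.ext hjp.symm)
        simp [this], map_sum]
      refine Finset.sum_congr rfl fun σ _ => ?_
      by_cases hs : IsShuffle (j : ℕ) σ <;> simp [hs]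

open Classical in
/-- For the shuffles that fix the first index only one of the two terms remains. -/
theorem sum_isShuffleOne_cut (h : IsWordModule k pt A e) {n : ℕ} (x : Fin n → X) :
    ∑ p : Fin (n + 1), ∑ σ ∈ Finset.univ.filter (IsShuffleOne (n := n) p),
      ((Equiv.Perm.sign σ : ℤ) : k) • cut k e p (fun i => x (σ i)) = h.half (List.ofFn x) := by
  cases n with
  | zero =>
    have : ∀ σ : Equiv.Perm (Fin 0), ¬ IsShuffleOne 0 σ := fun σ hσ => lt_irrefl _ hσ.2.1
    simp [half, this]
  | succ n =>
    have hterm : ∀ (p : ℕ) (j : Fin (n + 1)) (σ : Equiv.Perm (Fin n)),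
        (if IsShuffleOne p (insertPerm 0 j σ) then ((Equiv.Perm.sign (insertPerm 0 j σ) : ℤ) : k) •
          cut k e p (fun i => x (insertPerm 0 j σ i)) else 0) =
        if j = 0 ∧ 0 < p ∧ IsShuffle (p - 1) σ then ((Equiv.Perm.sign σ : ℤ) : k) •
          (h.cons (x 0)).rTensor _ (cut k e (p - 1) fun i => x (σ i).succ) else 0 := by
      intro p j σ
      rw [if_congr (isShuffleOne_insertPerm_zero p j σ) rfl rfl]
      refine if_ctx_congr Iff.rfl (fun hj => ?_) fun _ => rfl
      have := h.ite_isShuffle_insertPerm x p j σ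
      rwa [if_pos ((isShuffle_insertPerm_zero p j σ).2 (Or.inl hj)), if_pos hj, if_neg (by
        rintro ⟨h2, -⟩
        rw [hj.1, Fin.val_zero] at h2
        omega), add_zero] at this
    have key := h.sum_isShuffle_cut fun i => x i.succ
    simp only [Finset.sum_filter] at key ⊢
    rw [List.ofFn_succ, half, ← key]
    simp only [sum_perm_eq_sum_insertPerm 0, hterm]
    rw [Fin.sum_univ_succ]
    simp only [Fin.val_zero, lt_irrefl, false_and, and_false, if_false, Finset.sum_const_zero,
      zero_add, map_sum]
    refine Finset.sum_congr rfl fun p _ => ?_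
    rw [Fintype.sum_eq_single 0 fun j hj => by simp [hj]]
    refine Finset.sum_congr rfl fun σ _ => ?_
    by_cases hs : IsShuffle (p : ℕ) σ <;> simp [hs]

end IsWordModule

/-! ### The rack homology of a trivial rack as a module of words -/

section Words

variable {k : Type u} [CommRing k] {X : Type u} {R : PointedRack X}

/-- The class of a word in the total rack homology. -/
def wordClass (k : Type u) [CommRing k] (hR : R.IsTrivial) (l : List X) : ⨁ n, HR k R n :=
  DirectSum.lof k ℕ (fun n => HR k R n) l.length (cls k hR l.get)

/-- The class of a tuple is the class of the word of its entries. -/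
theorem lof_cls (hR : R.IsTrivial) {n : ℕ} (x : Fin n → X) :
    DirectSum.lof k ℕ (fun n => HR k R n) n (cls k hR x) = wordClass k hR (List.ofFn x) := by
  have : ∀ (m : ℕ) (hm : m = n) (y : Fin m → X), (∀ i, y i = x (Fin.cast hm i)) →
      DirectSum.lof k ℕ (fun n => HR k R n) n (cls k hR x) =
        DirectSum.lof k ℕ (fun n => HR k R n) m (cls k hR y) := by
    rintro m rfl y hy
    rw [show y = x from funext hy]
  exact this _ List.length_ofFn _ fun i => by simp [Fin.cast]

/-- The total rack homology of a trivial rack is free on the words without the neutral element. -/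
theorem isWordModule_HR (hR : R.IsTrivial) :
    IsWordModule k R.pt (fun n => HR k R n) (wordClass k hR) where
  eq_zero l hl := by
    obtain ⟨i, hi⟩ := List.mem_iff_get.1 hl
    rw [wordClass, cls_eq_zero hR i hi, map_zero]
  exists_lof_eq l := ⟨_, rfl⟩
  lof_mem_span n a := by
    let S : Submodule k (⨁ n, HR k R n) :=
      Submodule.span k {y | ∃ l : List X, l.length = n ∧ wordClass k hR l = y}
    have : S.mkQ ∘ₗ DirectSum.lof k ℕ (fun n => HR k R n) n = 0 :=
      HR_hom_ext hR fun x => (Submodule.Quotient.mk_eq_zero _).2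
        (Submodule.subset_span ⟨List.ofFn x, List.length_ofFn, (lof_cls hR x).symm⟩)
    exact (Submodule.Quotient.mk_eq_zero _).1 (LinearMap.congr_fun this a)
  exists_lift f hf := by
    refine ⟨DirectSum.toModule k ℕ _ fun n => HRlift hR (fun x : Fin n → X => f (List.ofFn x))
      fun x i hx => hf _ (List.mem_ofFn.2 ⟨i, hx⟩), fun l => ?_⟩
    rw [wordClass, DirectSum.toModule_lof, HRlift_cls, List.ofFn_get]

theorem halfShuffle_eq_half (hR : R.IsTrivial) {n : ℕ} (x : Fin n → X) :
    halfShuffle k hR x = (isWordModule_HR (k := k) hR).half (List.ofFn x) := by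
  classical
  rw [← (isWordModule_HR hR).sum_isShuffleOne_cut, halfShuffle]
  refine Finset.sum_congr rfl fun p _ => Finset.sum_congr (by congr) fun σ _ => ?_
  rw [lof_cls, lof_cls, IsWordModule.cut]
  have h1 : List.ofFn (fun i : Fin p => x (σ (Fin.castLE (Nat.lt_succ_iff.1 p.2) i))) =
      (List.ofFn fun i => x (σ i)).take p :=
    List.ext_getElem (by simp; omega) fun i _ _ => by simp
  have h2 : List.ofFn (fun j : Fin (n - p) => x (σ ⟨p + j, by omega⟩)) =
      (List.ofFn fun i => x (σ i)).drop p :=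
    List.ext_getElem (by simp) fun i _ _ => by simp
  simp only [hR.twist, h1, h2]

end Words

end RackHomology

end

/-! ### The rack homology of an abelian group -/

open RackHomology in
theorem mainTheorem5 {k G : Type u} [CommRing k] [CommGroup G] :
    -- the isomorphisms `HRₙ(G, k) ≃ Tⁿ(k[G ∖ {1}])` and the maps `Sₙ : HRₙ(G, k) → Hₙ(G, k)`
    (∃ (φ : ∀ n : ℕ, HR k (PointedRack.conj G) n ≃ₗ[k] ⨂[k]^n ({g : G // g ≠ 1} →₀ k))
        (S : ∀ n : ℕ, HR k (PointedRack.conj G) n →ₗ[k] groupHomology (Rep.trivial k G k) n),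
      (∀ (n : ℕ) (g : Fin n → G) (hg : ∀ i, g i ≠ 1),
        φ n (cls k (PointedRack.isTrivial_conj G) g) =
          PiTensorProduct.tprod k fun i => Finsupp.single (⟨g i, hg i⟩ : {g : G // g ≠ 1}) 1) ∧
      (∀ (n : ℕ) (g : Fin n → G),
        Represents (groupHomology.inhomogeneousChains (Rep.trivial k G k)) n (symChain k g)
          (S n (cls k (PointedRack.isTrivial_conj G) g))) ∧
      -- over a field of characteristic zero, `Sₙ` is the canonical projection under `φ` and the
      -- isomorphism `Hₙ(G, k) ≃ Λⁿ(G ⊗ k)` given by the Pontryagin product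
      (IsField k → CharZero k →
        ∃ ψ : ∀ n : ℕ, groupHomology (Rep.trivial k G k) n ≃ₗ[k] ⋀[k]^n (k ⊗[ℤ] Additive G),
          (∀ (n : ℕ) (g : Fin n → G),
            Represents (groupHomology.inhomogeneousChains (Rep.trivial k G k)) n
              (pontryaginList k n g)
              ((ψ n).symm (exteriorPower.ιMulti k n fun i =>
                (1 : k) ⊗ₜ[ℤ] Additive.ofMul (g i)))) ∧
          (∀ (n : ℕ) (x : HR k (PointedRack.conj G) n),
            ψ n (S n x) = canonicalMap k G n (φ n x)) ∧
          ∀ n : ℕ, Function.Surjective (canonicalMap k G n))) ∧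
    -- the connected coZinbiel-associative bialgebra structure
    ∃ (counit : (⨁ n, HR k (PointedRack.conj G) n) →ₗ[k] k)
      (mul : (⨁ n, HR k (PointedRack.conj G) n) →ₗ[k] (⨁ n, HR k (PointedRack.conj G) n) →ₗ[k]
        (⨁ n, HR k (PointedRack.conj G) n))
      (coprod : (⨁ n, HR k (PointedRack.conj G) n) →ₗ[k]
        (⨁ n, HR k (PointedRack.conj G) n) ⊗[k] (⨁ n, HR k (PointedRack.conj G) n)),
      -- the product is induced by the morphism of racks `G × G → G`, and is concatenation
      (∀ (p q : ℕ) (g : Fin p → G) (h : Fin q → G),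
        mul (DirectSum.lof k ℕ (fun n => HR k (PointedRack.conj G) n) p
              (cls k (PointedRack.isTrivial_conj G) g))
            (DirectSum.lof k ℕ (fun n => HR k (PointedRack.conj G) n) q
              (cls k (PointedRack.isTrivial_conj G) h)) =
          DirectSum.lof k ℕ (fun n => HR k (PointedRack.conj G) n) (p + q)
            (HRmap k (mulHom G) (p + q)
              (cls k ((PointedRack.isTrivial_conj G).prod (PointedRack.isTrivial_conj G))
                (crossTuple (PointedRack.conj G) (PointedRack.conj G) g h))) ∧
        mul (DirectSum.lof k ℕ (fun n => HR k (PointedRack.conj G) n) p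
              (cls k (PointedRack.isTrivial_conj G) g))
            (DirectSum.lof k ℕ (fun n => HR k (PointedRack.conj G) n) q
              (cls k (PointedRack.isTrivial_conj G) h)) =
          DirectSum.lof k ℕ (fun n => HR k (PointedRack.conj G) n) (p + q)
            (cls k (PointedRack.isTrivial_conj G) (Fin.append g h))) ∧
      -- the half-coproduct of rack homology
      (∀ (n : ℕ) (g : Fin n → G),
        coprod (DirectSum.lof k ℕ (fun n => HR k (PointedRack.conj G) n) n
            (cls k (PointedRack.isTrivial_conj G) g)) =
          halfShuffle k (PointedRack.isTrivial_conj G) g) ∧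
      IsConnectedCoZinbielAssociativeBialgebra k
        (A := fun n => HR k (PointedRack.conj G) n)
        (DirectSum.lof k ℕ (fun n => HR k (PointedRack.conj G) n) 0
          (cls k (PointedRack.isTrivial_conj G) Fin.elim0))
        counit mul coprod := by
  refine ⟨⟨tensorPowerEquiv k G, symMap k G, fun n g hg => tensorPowerEquiv_cls g hg,
    fun n g => ?_, fun hk h0 => ?_⟩, ?_⟩
  · rw [symMap_cls, symChain_eq_symSum]
    exact represents_symClass k g
  · -- the ring structure of this field is the given one
    let := hk.toField
    refine ⟨homologyWedgeEquiv k G, fun n g => ?_, fun n x => homologyWedgeEquiv_symMap k x,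
      fun n => canonicalMap_surjective k n⟩
    have : (homologyWedgeEquiv k G n).symm (wedge k g) = symClass k g :=
      (LinearEquiv.symm_apply_eq _).2 (homologyWedgeEquiv_symClass k g).symm
    rw [pontryaginList_eq_symSum]
    exact this ▸ represents_symClass k g
  · have hR := PointedRack.isTrivial_conj G
    have h := isWordModule_HR (k := k) hR
    have hmul : ∀ (p q : ℕ) (g : Fin p → G) (g' : Fin q → G),
        h.mul (DirectSum.lof k ℕ (fun n => HR k (PointedRack.conj G) n) p (cls k hR g))
            (DirectSum.lof k ℕ (fun n => HR k (PointedRack.conj G) n) q (cls k hR g')) =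
          DirectSum.lof k ℕ (fun n => HR k (PointedRack.conj G) n) (p + q)
            (cls k hR (Fin.append g g')) := fun p q g g' => by
      rw [lof_cls, lof_cls, lof_cls, h.mul_apply, List.ofFn_fin_append]
    have hone : DirectSum.lof k ℕ (fun n => HR k (PointedRack.conj G) n) 0
        (cls k hR Fin.elim0) = wordClass k hR [] := by
      rw [lof_cls, List.ofFn_zero]
    refine ⟨h.counit, h.mul, h.coprod, fun p q g g' => ⟨?_, hmul p q g g'⟩, fun n g => ?_, ?_⟩
    · have hcross : (fun i => (mulHom G).toFun
          (crossTuple (PointedRack.conj G) (PointedRack.conj G) g g' i)) = Fin.append g g' := by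
        funext i
        refine Fin.addCases (fun i => ?_) (fun i => ?_) i
        · simp [crossTuple, mulHom, PointedRack.conj]
        · simp [crossTuple, mulHom, PointedRack.conj]
      rw [HRmap_cls (hR.prod hR) hR, hcross]
      exact hmul p q g g'
    · rw [lof_cls, h.coprod_apply, halfShuffle_eq_half]
    · rw [hone]
      exact h.isConnectedCoZinbielAssociativeBialgebra
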